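/- Conventions. All bicategories are small and enriched over simplicial sets: between parallel $1$-morphisms $f,g$ there is a simplicial set of $2$-cells whose vertices are the $2$-morphisms $f\Rightarrow g$, vertical composition and whiskering are simplicial, and the associativity and unit constraints (which are vertices) are natural with respect to simplices of $2$-cells of every dimension. Ordinary bicategories are those whose simplicial sets of $2$-cells are discrete. Pseudofunctors and (pseudonatural) transformations are understood in the enriched sense. $Bicat$ is the category of bicategories and pseudofunctors. A natural equivalence is a transformation all of whose components are equivalences, and a pseudofunctor $F:\mathcal C\to\mathcal D$ is an equivalence of bicategories if there are a pseudofunctor $G:\mathcal D\to\mathcal C$ and natural equivalences $\mathrm{id}_{\mathcal C}\simeq G\circ F$ and $\mathrm{id}_{\mathcal D}\simeq F\circ G$. A pseudofunctor is normal if its identity constraints are identities; a normalization of a pseudofunctor $F$ is a normal pseudofunctor naturally equivalent to $F$. The Segal nerve of a bicategory $\mathcal C$ is the simplicial object $\mathbf N_n\mathcal C=\underline{NorHom}([n],\mathcal C)$ in simplicially enriched categories: its objects are the normal pseudofunctors $[n]\to\mathcal C$ and its morphisms are icons, that is oplax transformations with identity components on objects (the $k$-simplices of the simplicial set of icons have $k$-simplices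 of $2$-cells as components). The classifying space $|\mathbf N\mathcal C|$ is the geometric realization of the diagonal of the trisimplicial set $(n,k,p)\mapsto N_p\big((\mathbf N_n\mathcal C)_k\big)$, where $(\mathbf N_n\mathcal C)_k$ is the category of $k$-simplices of $\mathbf N_n\mathcal C$ and $N$ is the nerve of a category. It is a functor on bicategories and normal pseudofunctors. Let $Fin_*$ be the category of the pointed sets $\underline n=\{0,1,\dots,n\}$ (base point $0$, $n\ge 0$) and pointed maps, and for $1\le k\le n$ let $i_k:\underline n\to\underline 1$ send $k$ to $1$ and all other elements to $0$. A $\Gamma$-space is a functor $X:Fin_*\to Top$; it is special if for every $n\ge0$ the map $P_n=(X(i_k))_k:X(\underline n)\to X(\underline 1)^{\times n}$ is a weak homotopy equivalence. A $\Gamma$-bicategory is a functor $A:Fin_*\to Bicat$; it is special if for every $n\ge0$ the pseudofunctor $P_n=(A(i_k))_k:A(\underline n)\to A(\underline 1)^{\times n}$ is an equivalence of bicategories. **Lemma 3.5.** Let $A$ be a special $\Gamma$-bicategory. Then $|\mathbf N A|$ is a special $\Gamma$-space. Precisely: (1) If all the pseudofunctors $A(f)$ are normal, so that $|\mathbf N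 A|:Fin_*\to Top$, $\underline n\mapsto|\mathbf N A(\underline n)|$, is a functor, then this $\Gamma$-space is special. (2) In general, call a $\Gamma$-space $X$ a model of $|\mathbf N A|$ if there are homotopy equivalences $e_n:|\mathbf N A(\underline n)|\to X(\underline n)$, $n\ge 0$, such that for every $f:\underline m\to\underline n$ in $Fin_*$ the pseudofunctor $A(f)$ has a normalization and, for every normalization $F$ of $A(f)$, the maps $X(f)\circ e_m$ and $e_n\circ|\mathbf N F|$ are homotopic. Then $|\mathbf N A|$ has a model, and every model of $|\mathbf N A|$ is a special $\Gamma$-space. -/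

import Mathlib

open CategoryTheory Opposite

universe u

namespace SegalGamma

/-! ### Bicategories enriched over simplicial sets -/

/-- The data of an enrichment over simplicial sets of the categories of 1-morphisms of a
bicategory: simplicial sets of 2-cells whose vertices are the given 2-morphisms, together with
simplicial vertical composition and whiskering. -/
class SimplicialCells (B : Type u) [Bicategory.{u, u} B] where
  /-- the simplicial set of 2-cells between parallel 1-morphisms -/
  cell {a b : B} (f g : a ⟶ b) : SSet.{u}
  /-- the 2-morphisms are the vertices -/
  vertex {a b : B} {f g : a ⟶ b} : (f ⟶ g) ≃ (cell f g).obj (op (SimplexCategory.mk 0))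
  /-- vertical composition of `k`-simplices of 2-cells -/
  comp {a b : B} {f g h : a ⟶ b} {k : SimplexCategoryᵒᵖ} :
    (cell f g).obj k → (cell g h).obj k → (cell f h).obj k
  /-- left whiskering of `k`-simplices of 2-cells -/
  whiskerLeft {a b c : B} (f : a ⟶ b) {g h : b ⟶ c} {k : SimplexCategoryᵒᵖ} :
    (cell g h).obj k → (cell (f ≫ g) (f ≫ h)).obj k
  /-- right whiskering of `k`-simplices of 2-cells -/
  whiskerRight {a b c : B} {f g : a ⟶ b} {k : SimplexCategoryᵒᵖ} :
    (cell f g).obj k → ∀ h : b ⟶ c, (cell (f ≫ h) (g ≫ h)).obj k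

namespace SimplicialCells

variable {B : Type u} [Bicategory.{u, u} B] [SimplicialCells B]

/-- The totally degenerate `k`-simplex on the vertex given by a 2-morphism. -/
def deg (k : SimplexCategoryᵒᵖ) {a b : B} {f g : a ⟶ b} (η : f ⟶ g) : (cell f g).obj k :=
  (cell f g).map (SimplexCategory.const k.unop (SimplexCategory.mk 0) 0).op (vertex η)

end SimplicialCells

open SimplicialCells

/-- A bicategory enriched over simplicial sets: every category of 1-morphisms is enriched over
simplicial sets, whiskering is simplicially enriched, and the associators and unitors (which are
vertices) are natural with respect to simplices of 2-cells of every dimension. -/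
class SimplicialBicategory (B : Type u) [Bicategory.{u, u} B] extends SimplicialCells B where
  map_comp {a b : B} {f g h : a ⟶ b} {k l : SimplexCategoryᵒᵖ} (θ : k ⟶ l)
    (x : (cell f g).obj k) (y : (cell g h).obj k) :
    (cell f h).map θ (comp x y) = comp ((cell f g).map θ x) ((cell g h).map θ y)
  vertex_comp {a b : B} {f g h : a ⟶ b} (η : f ⟶ g) (θ : g ⟶ h) :
    vertex (η ≫ θ) = comp (vertex η) (vertex θ)
  id_comp {a b : B} {f g : a ⟶ b} {k : SimplexCategoryᵒᵖ} (x : (cell f g).obj k) :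
    comp (deg k (𝟙 f)) x = x
  comp_id {a b : B} {f g : a ⟶ b} {k : SimplexCategoryᵒᵖ} (x : (cell f g).obj k) :
    comp x (deg k (𝟙 g)) = x
  assoc {a b : B} {f g h i : a ⟶ b} {k : SimplexCategoryᵒᵖ} (x : (cell f g).obj k)
    (y : (cell g h).obj k) (z : (cell h i).obj k) : comp (comp x y) z = comp x (comp y z)
  map_whiskerLeft {a b c : B} (f : a ⟶ b) {g h : b ⟶ c} {k l : SimplexCategoryᵒᵖ} (θ : k ⟶ l)
    (x : (cell g h).obj k) :
    (cell (f ≫ g) (f ≫ h)).map θ (whiskerLeft f x) = whiskerLeft f ((cell g h).map θ x)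
  vertex_whiskerLeft {a b c : B} (f : a ⟶ b) {g h : b ⟶ c} (η : g ⟶ h) :
    vertex (Bicategory.whiskerLeft f η) = whiskerLeft f (vertex η)
  whiskerLeft_comp {a b c : B} (f : a ⟶ b) {g h i : b ⟶ c} {k : SimplexCategoryᵒᵖ}
    (x : (cell g h).obj k) (y : (cell h i).obj k) :
    whiskerLeft f (comp x y) = comp (whiskerLeft f x) (whiskerLeft f y)
  map_whiskerRight {a b c : B} {f g : a ⟶ b} {k l : SimplexCategoryᵒᵖ} (θ : k ⟶ l)
    (x : (cell f g).obj k) (h : b ⟶ c) :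
    (cell (f ≫ h) (g ≫ h)).map θ (whiskerRight x h) = whiskerRight ((cell f g).map θ x) h
  vertex_whiskerRight {a b c : B} {f g : a ⟶ b} (η : f ⟶ g) (h : b ⟶ c) :
    vertex (Bicategory.whiskerRight η h) = whiskerRight (vertex η) h
  whiskerRight_comp {a b c : B} {f g h : a ⟶ b} {k : SimplexCategoryᵒᵖ}
    (x : (cell f g).obj k) (y : (cell g h).obj k) (i : b ⟶ c) :
    whiskerRight (comp x y) i = comp (whiskerRight x i) (whiskerRight y i)
  whisker_exchange {a b c : B} {f g : a ⟶ b} {h i : b ⟶ c} {k : SimplexCategoryᵒᵖ}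
    (x : (cell f g).obj k) (y : (cell h i).obj k) :
    comp (whiskerLeft f y) (whiskerRight x i) = comp (whiskerRight x h) (whiskerLeft g y)
  leftUnitor_naturality {a b : B} {f g : a ⟶ b} {k : SimplexCategoryᵒᵖ} (x : (cell f g).obj k) :
    comp (whiskerLeft (𝟙 a) x) (deg k (Bicategory.leftUnitor g).hom) =
      comp (deg k (Bicategory.leftUnitor f).hom) x
  rightUnitor_naturality {a b : B} {f g : a ⟶ b} {k : SimplexCategoryᵒᵖ} (x : (cell f g).obj k) :
    comp (whiskerRight x (𝟙 b)) (deg k (Bicategory.rightUnitor g).hom) =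
      comp (deg k (Bicategory.rightUnitor f).hom) x
  associator_naturality_left {a b c d : B} {f f' : a ⟶ b} {k : SimplexCategoryᵒᵖ}
    (x : (cell f f').obj k) (g : b ⟶ c) (h : c ⟶ d) :
    comp (whiskerRight (whiskerRight x g) h) (deg k (Bicategory.associator f' g h).hom) =
      comp (deg k (Bicategory.associator f g h).hom) (whiskerRight x (g ≫ h))
  associator_naturality_middle {a b c d : B} (f : a ⟶ b) {g g' : b ⟶ c} {k : SimplexCategoryᵒᵖ}
    (x : (cell g g').obj k) (h : c ⟶ d) :
    comp (whiskerRight (whiskerLeft f x) h) (deg k (Bicategory.associator f g' h).hom) =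
      comp (deg k (Bicategory.associator f g h).hom) (whiskerLeft f (whiskerRight x h))
  associator_naturality_right {a b c d : B} (f : a ⟶ b) (g : b ⟶ c) {h h' : c ⟶ d}
    {k : SimplexCategoryᵒᵖ} (x : (cell h h').obj k) :
    comp (whiskerLeft (f ≫ g) x) (deg k (Bicategory.associator f g h').hom) =
      comp (deg k (Bicategory.associator f g h).hom) (whiskerLeft f (whiskerLeft g x))

section deg

variable {B : Type u} [Bicategory.{u, u} B] [SimplicialBicategory B]

theorem map_deg {k l : SimplexCategoryᵒᵖ} (θ : k ⟶ l) {a b : B} {f g : a ⟶ b} (η : f ⟶ g) :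
    (cell f g).map θ (deg k η) = deg l η := by
  unfold deg
  rw [← CategoryTheory.comp_apply, ← Functor.map_comp]
  rfl

theorem deg_comp (k : SimplexCategoryᵒᵖ) {a b : B} {f g h : a ⟶ b} (η : f ⟶ g) (θ : g ⟶ h) :
    deg k (η ≫ θ) = comp (deg k η) (deg k θ) := by
  simp only [deg, SimplicialBicategory.vertex_comp, SimplicialBicategory.map_comp]

theorem deg_whiskerLeft (k : SimplexCategoryᵒᵖ) {a b c : B} (f : a ⟶ b) {g h : b ⟶ c}
    (η : g ⟶ h) : deg k (Bicategory.whiskerLeft f η) = whiskerLeft f (deg k η) := by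
  simp only [deg, SimplicialBicategory.vertex_whiskerLeft, SimplicialBicategory.map_whiskerLeft]

theorem deg_whiskerRight (k : SimplexCategoryᵒᵖ) {a b c : B} {f g : a ⟶ b} (η : f ⟶ g)
    (h : b ⟶ c) : deg k (Bicategory.whiskerRight η h) = whiskerRight (deg k η) h := by
  simp only [deg, SimplicialBicategory.vertex_whiskerRight, SimplicialBicategory.map_whiskerRight]

end deg

/-! ### Enriched pseudofunctors and transformations -/

/-- A pseudofunctor between bicategories enriched over simplicial sets: a pseudofunctor whose
action on 2-morphisms is extended to simplices of 2-cells, and whose composition constraints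
are natural with respect to these. -/
structure SPseudofunctor (B C : Type u) [Bicategory.{u, u} B] [SimplicialBicategory B]
    [Bicategory.{u, u} C] [SimplicialBicategory C] extends Pseudofunctor B C where
  /-- the simplicial map on 2-cells -/
  mapCell {a b : B} (f g : a ⟶ b) : cell f g ⟶ cell (map f) (map g)
  mapCell_vertex {a b : B} {f g : a ⟶ b} (η : f ⟶ g) :
    (mapCell f g).app _ (vertex η) = vertex (map₂ η)
  mapCell_comp {a b : B} {f g h : a ⟶ b} {k : SimplexCategoryᵒᵖ}
    (x : (cell f g).obj k) (y : (cell g h).obj k) :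
    (mapCell f h).app k (comp x y) = comp ((mapCell f g).app k x) ((mapCell g h).app k y)
  mapCell_whiskerLeft {a b c : B} (f : a ⟶ b) {g h : b ⟶ c} {k : SimplexCategoryᵒᵖ}
    (x : (cell g h).obj k) :
    comp ((mapCell (f ≫ g) (f ≫ h)).app k (whiskerLeft f x)) (deg k (mapComp f h).hom) =
      comp (deg k (mapComp f g).hom) (whiskerLeft (map f) ((mapCell g h).app k x))
  mapCell_whiskerRight {a b c : B} {f g : a ⟶ b} {k : SimplexCategoryᵒᵖ}
    (x : (cell f g).obj k) (h : b ⟶ c) :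
    comp ((mapCell (f ≫ h) (g ≫ h)).app k (whiskerRight x h)) (deg k (mapComp g h).hom) =
      comp (deg k (mapComp f h).hom) (whiskerRight ((mapCell f g).app k x) (map h))

namespace SPseudofunctor

variable {B C D E : Type u} [Bicategory.{u, u} B] [SimplicialBicategory B]
  [Bicategory.{u, u} C] [SimplicialBicategory C] [Bicategory.{u, u} D] [SimplicialBicategory D]
  [Bicategory.{u, u} E] [SimplicialBicategory E]

theorem mapCell_deg (F : SPseudofunctor B C) (k : SimplexCategoryᵒᵖ) {a b : B} {f g : a ⟶ b}
    (η : f ⟶ g) : (F.mapCell f g).app k (deg k η) = deg k (F.map₂ η) := by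
  unfold deg
  rw [← F.mapCell_vertex, ← CategoryTheory.comp_apply, (F.mapCell f g).naturality,
    CategoryTheory.comp_apply]

theorem mapCell_map (F : SPseudofunctor B C) {k l : SimplexCategoryᵒᵖ} (θ : k ⟶ l) {a b : B}
    {f g : a ⟶ b} (x : (cell f g).obj k) :
    (F.mapCell f g).app l ((cell f g).map θ x) =
      (cell (F.map f) (F.map g)).map θ ((F.mapCell f g).app k x) := by
  rw [← CategoryTheory.comp_apply, (F.mapCell f g).naturality, CategoryTheory.comp_apply]

theorem ext' {F G : SPseudofunctor B C} (h : F.toPseudofunctor = G.toPseudofunctor)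
    (h' : ∀ {a b : B} (f g : a ⟶ b), HEq (F.mapCell f g) (G.mapCell f g)) : F = G := by
  obtain ⟨F, m, _, _, _, _⟩ := F
  obtain ⟨G, m', _, _, _, _⟩ := G
  obtain rfl : F = G := h
  obtain rfl : @m = @m' := by
    funext a b f g
    exact eq_of_heq (h' f g)
  rfl

/-- The identity pseudofunctor. -/
def id (B : Type u) [Bicategory.{u, u} B] [SimplicialBicategory B] : SPseudofunctor B B where
  toPseudofunctor := Pseudofunctor.id B
  mapCell f g := 𝟙 (cell f g)
  mapCell_vertex _ := rfl
  mapCell_comp _ _ := rfl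
  mapCell_whiskerLeft _ _ _ _ _ :=
    (SimplicialBicategory.comp_id _).trans (SimplicialBicategory.id_comp _).symm
  mapCell_whiskerRight _ _ :=
    (SimplicialBicategory.comp_id _).trans (SimplicialBicategory.id_comp _).symm

/-- Composition of pseudofunctors (in diagrammatic order). -/
def comp (F : SPseudofunctor B C) (G : SPseudofunctor C D) : SPseudofunctor B D where
  toPseudofunctor := F.toPseudofunctor.comp G.toPseudofunctor
  mapCell f g := F.mapCell f g ≫ G.mapCell (F.map f) (F.map g)
  mapCell_vertex η := by
    change (G.mapCell _ _).app _ ((F.mapCell _ _).app _ _) = _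
    rw [F.mapCell_vertex, G.mapCell_vertex]
    rfl
  mapCell_comp x y := by
    change (G.mapCell _ _).app _ ((F.mapCell _ _).app _ _) = _
    rw [F.mapCell_comp, G.mapCell_comp]
    rfl
  mapCell_whiskerLeft f g h k x := by
    change SimplicialCells.comp ((G.mapCell _ _).app _ ((F.mapCell _ _).app _ _))
        (deg k (G.map₂ (F.mapComp f h).hom ≫ (G.mapComp (F.map f) (F.map h)).hom)) =
      SimplicialCells.comp (deg k (G.map₂ (F.mapComp f g).hom ≫
        (G.mapComp (F.map f) (F.map g)).hom)) (whiskerLeft (G.map (F.map f))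
          ((G.mapCell _ _).app _ ((F.mapCell _ _).app _ x)))
    rw [deg_comp, deg_comp, ← mapCell_deg, ← mapCell_deg, ← SimplicialBicategory.assoc,
      ← G.mapCell_comp, F.mapCell_whiskerLeft, G.mapCell_comp, SimplicialBicategory.assoc,
      G.mapCell_whiskerLeft, SimplicialBicategory.assoc]
  mapCell_whiskerRight {a b c f g k} x h := by
    change SimplicialCells.comp ((G.mapCell _ _).app _ ((F.mapCell _ _).app _ _))
        (deg k (G.map₂ (F.mapComp g h).hom ≫ (G.mapComp (F.map g) (F.map h)).hom)) =
      SimplicialCells.comp (deg k (G.map₂ (F.mapComp f h).hom ≫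
        (G.mapComp (F.map f) (F.map h)).hom)) (whiskerRight
          ((G.mapCell _ _).app _ ((F.mapCell _ _).app _ x)) (G.map (F.map h)))
    rw [deg_comp, deg_comp, ← mapCell_deg, ← mapCell_deg, ← SimplicialBicategory.assoc,
      ← G.mapCell_comp, F.mapCell_whiskerRight, G.mapCell_comp, SimplicialBicategory.assoc,
      G.mapCell_whiskerRight, SimplicialBicategory.assoc]

theorem pseudo_ext {B C : Type u} [Bicategory.{u, u} B] [Bicategory.{u, u} C] {F G : Pseudofunctor B C} (h : F.toPrelaxFunctor = G.toPrelaxFunctor)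
    (h₁ : ∀ a, HEq (F.mapId a) (G.mapId a))
    (h₂ : ∀ {a b c : B} (f : a ⟶ b) (g : b ⟶ c), HEq (F.mapComp f g) (G.mapComp f g)) :
    F = G := by
  obtain ⟨F, i, m, _, _, _, _, _⟩ := F
  obtain ⟨G, i', m', _, _, _, _, _⟩ := G
  obtain rfl : F = G := h
  obtain rfl : @i = @i' := by
    funext a
    exact eq_of_heq (h₁ a)
  obtain rfl : @m = @m' := by
    funext a b c f g
    exact eq_of_heq (h₂ f g)
  rfl

theorem id_comp (F : SPseudofunctor B C) : (id B).comp F = F := by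
  refine ext' (pseudo_ext rfl (fun a => heq_of_eq ?_) (fun f g => heq_of_eq ?_))
    (fun f g => HEq.rfl)
  · ext
    exact (congrArg (· ≫ _) (F.map₂_id _)).trans (Category.id_comp _)
  · ext
    exact (congrArg (· ≫ _) (F.map₂_id _)).trans (Category.id_comp _)

theorem comp_id (F : SPseudofunctor B C) : F.comp (id C) = F := by
  refine ext' (pseudo_ext rfl (fun a => heq_of_eq ?_) (fun f g => heq_of_eq ?_))
    (fun f g => HEq.rfl)
  · ext
    exact Category.comp_id _
  · ext
    exact Category.comp_id _

theorem assoc (F : SPseudofunctor B C) (G : SPseudofunctor C D) (H : SPseudofunctor D E) :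
    (F.comp G).comp H = F.comp (G.comp H) := by
  refine ext' (pseudo_ext rfl (fun a => heq_of_eq ?_) (fun f g => heq_of_eq ?_))
    (fun f g => HEq.rfl)
  · ext
    exact (congrArg (· ≫ _) (H.map₂_comp _ _)).trans (Category.assoc _ _ _)
  · ext
    exact (congrArg (· ≫ _) (H.map₂_comp _ _)).trans (Category.assoc _ _ _)

/-- A pseudofunctor is normal if its identity constraints are identities. -/
def IsNormal (F : SPseudofunctor B C) : Prop :=
  ∃ h : ∀ a : B, F.map (𝟙 a) = 𝟙 (F.obj a), ∀ a : B, F.mapId a = eqToIso (h a)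

theorem isNormal_id : (id B).IsNormal :=
  ⟨fun _ => rfl, fun _ => rfl⟩

theorem IsNormal.comp {F : SPseudofunctor B C} {G : SPseudofunctor C D} (hF : F.IsNormal)
    (hG : G.IsNormal) : (F.comp G).IsNormal := by
  obtain ⟨hF, hF'⟩ := hF
  obtain ⟨hG, hG'⟩ := hG
  refine ⟨fun a => (congrArg G.map (hF a)).trans (hG _), fun a => ?_⟩
  ext
  change G.map₂ (F.mapId a).hom ≫ (G.mapId (F.obj a)).hom = _
  rw [hF', hG', eqToIso.hom, eqToIso.hom, PrelaxFunctor.map₂_eqToHom, eqToHom_trans]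
  rfl

end SPseudofunctor

section Transformations

variable {B C : Type u} [Bicategory.{u, u} B] [SimplicialBicategory B]
  [Bicategory.{u, u} C] [SimplicialBicategory C]

/-- A (pseudonatural) transformation of enriched pseudofunctors: the naturality constraints are
natural with respect to simplices of 2-cells. -/
structure STrans (F G : SPseudofunctor B C) extends
    Pseudofunctor.StrongTrans F.toPseudofunctor G.toPseudofunctor where
  naturality_cell {a b : B} {f g : a ⟶ b} {k : SimplexCategoryᵒᵖ} (x : (cell f g).obj k) :
    comp (whiskerRight ((F.mapCell f g).app k x) (app b)) (deg k (naturality g).hom) =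
      comp (deg k (naturality f).hom) (whiskerLeft (app a) ((G.mapCell f g).app k x))

/-- A 1-morphism which is invertible up to invertible 2-morphisms. -/
def IsEquivalence₁ {a b : C} (f : a ⟶ b) : Prop :=
  ∃ g : b ⟶ a, Nonempty (f ≫ g ≅ 𝟙 a) ∧ Nonempty (g ≫ f ≅ 𝟙 b)

/-- `F` and `G` are related by a natural equivalence, that is by a transformation whose
components are equivalences (equivalently, a weakly invertible transformation). -/
def NatEquivalent (F G : SPseudofunctor B C) : Prop :=
  ∃ η : STrans F G, ∀ a : B, IsEquivalence₁ (η.app a)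

/-- `F` is an equivalence of bicategories. -/
def IsBiequivalence (F : SPseudofunctor B C) : Prop :=
  ∃ G : SPseudofunctor C B, NatEquivalent (SPseudofunctor.id B) (F.comp G) ∧
    NatEquivalent (SPseudofunctor.id C) (G.comp F)

end Transformations

/-! ### The categories of bicategories -/

/-- Small bicategories enriched over simplicial sets. -/
structure Bicat : Type (u + 1) where
  /-- the type of objects -/
  carrier : Type u
  [bicategory : Bicategory.{u, u} carrier]
  [simplicial : SimplicialBicategory carrier]

attribute [instance] Bicat.bicategory Bicat.simplicial

/-- The category of small bicategories and pseudofunctors. -/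
instance : Category Bicat.{u} where
  Hom B C := SPseudofunctor B.carrier C.carrier
  id B := SPseudofunctor.id B.carrier
  comp F G := SPseudofunctor.comp F G
  id_comp := SPseudofunctor.id_comp
  comp_id := SPseudofunctor.comp_id
  assoc := SPseudofunctor.assoc

/-- The pseudofunctor underlying a morphism of `Bicat`. -/
abbrev Bicat.toPseudo {B C : Bicat.{u}} (F : B ⟶ C) : SPseudofunctor B.carrier C.carrier := F

/-- The class of normal pseudofunctors. -/
def normal : MorphismProperty Bicat.{u} := fun _ _ F => (Bicat.toPseudo F).IsNormal

instance : normal.{u}.IsMultiplicative where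
  id_mem _ := SPseudofunctor.isNormal_id
  comp_mem _ _ hF hG := SPseudofunctor.IsNormal.comp hF hG

/-- The category of small bicategories and normal pseudofunctors. -/
abbrev NormalBicat : Type (u + 1) := WideSubcategory normal.{u}

/-! ### Products of bicategories -/

section Pi

variable {ι : Type} (B : ι → Type u) [∀ i, Bicategory.{u, u} (B i)]

/-- The product of a family of bicategories. -/
instance piBicategory : Bicategory.{u, u} (∀ i, B i) where
  Hom a b := ∀ i, a i ⟶ b i
  id a := fun i => 𝟙 (a i)
  comp f g := fun i => f i ≫ g i
  homCategory a b := CategoryTheory.pi (fun i => (a i ⟶ b i))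
  whiskerLeft f _ _ η := fun i => Bicategory.whiskerLeft (f i) (η i)
  whiskerRight η h := fun i => Bicategory.whiskerRight (η i) (h i)
  associator f g h := Pi.isoMk fun i => Bicategory.associator (f i) (g i) (h i)
  leftUnitor f := Pi.isoMk fun i => Bicategory.leftUnitor (f i)
  rightUnitor f := Pi.isoMk fun i => Bicategory.rightUnitor (f i)
  whiskerLeft_id _ _ := funext fun _ => Bicategory.whiskerLeft_id _ _
  whiskerLeft_comp _ _ _ _ _ _ := funext fun _ => Bicategory.whiskerLeft_comp _ _ _
  id_whiskerLeft _ := funext fun _ => Bicategory.id_whiskerLeft _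
  comp_whiskerLeft _ _ _ _ _ := funext fun _ => Bicategory.comp_whiskerLeft _ _ _
  id_whiskerRight _ _ := funext fun _ => Bicategory.id_whiskerRight _ _
  comp_whiskerRight _ _ _ := funext fun _ => Bicategory.comp_whiskerRight _ _ _
  whiskerRight_id _ := funext fun _ => Bicategory.whiskerRight_id _
  whiskerRight_comp _ _ _ := funext fun _ => Bicategory.whiskerRight_comp _ _ _
  whisker_assoc _ _ _ _ _ := funext fun _ => Bicategory.whisker_assoc _ _ _
  whisker_exchange _ _ := funext fun _ => Bicategory.whisker_exchange _ _
  pentagon _ _ _ _ := funext fun _ => Bicategory.pentagon _ _ _ _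
  triangle _ _ := funext fun _ => Bicategory.triangle _ _

/-- The product simplicial set. -/
def piSSet {ι : Type} (X : ι → SSet.{u}) : SSet.{u} where
  obj k := ∀ i, (X i).obj k
  map θ := TypeCat.ofHom fun x i => (X i).map θ (x i)
  map_id k := by
    ext x i
    exact (X i).map_id_apply k (x i)
  map_comp θ θ' := by
    ext x i
    exact (X i).map_comp_apply θ θ' (x i)

variable [∀ i, SimplicialBicategory (B i)]

instance piSimplicialCells : SimplicialCells (∀ i, B i) where
  cell f g := piSSet fun i => cell (f i) (g i)
  vertex := Equiv.piCongrRight fun _ => vertex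
  comp x y := fun i => comp (x i) (y i)
  whiskerLeft f _ _ _ x := fun i => whiskerLeft (f i) (x i)
  whiskerRight x h := fun i => whiskerRight (x i) (h i)

/-- The product of a family of enriched bicategories is enriched. -/
instance piSimplicialBicategory : SimplicialBicategory (∀ i, B i) where
  map_comp _ _ _ := funext fun _ => SimplicialBicategory.map_comp _ _ _
  vertex_comp _ _ := funext fun _ => SimplicialBicategory.vertex_comp _ _
  id_comp _ := funext fun _ => SimplicialBicategory.id_comp _
  comp_id _ := funext fun _ => SimplicialBicategory.comp_id _
  assoc _ _ _ := funext fun _ => SimplicialBicategory.assoc _ _ _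
  map_whiskerLeft _ _ _ _ _ _ _ := funext fun _ => SimplicialBicategory.map_whiskerLeft _ _ _
  vertex_whiskerLeft _ _ _ _ := funext fun _ => SimplicialBicategory.vertex_whiskerLeft _ _
  whiskerLeft_comp _ _ _ _ _ _ _ := funext fun _ => SimplicialBicategory.whiskerLeft_comp _ _ _
  map_whiskerRight _ _ _ := funext fun _ => SimplicialBicategory.map_whiskerRight _ _ _
  vertex_whiskerRight _ _ := funext fun _ => SimplicialBicategory.vertex_whiskerRight _ _
  whiskerRight_comp _ _ _ := funext fun _ => SimplicialBicategory.whiskerRight_comp _ _ _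
  whisker_exchange _ _ := funext fun _ => SimplicialBicategory.whisker_exchange _ _
  leftUnitor_naturality _ := funext fun _ => SimplicialBicategory.leftUnitor_naturality _
  rightUnitor_naturality _ := funext fun _ => SimplicialBicategory.rightUnitor_naturality _
  associator_naturality_left _ _ _ :=
    funext fun _ => SimplicialBicategory.associator_naturality_left _ _ _
  associator_naturality_middle _ _ _ _ _ _ :=
    funext fun _ => SimplicialBicategory.associator_naturality_middle _ _ _
  associator_naturality_right _ _ _ _ _ _ :=
    funext fun _ => SimplicialBicategory.associator_naturality_right _ _ _

variable {B} {A : Type u} [Bicategory.{u, u} A]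

/-- The pseudofunctor to a product with given components (without enrichment). -/
def piLift₀ (F : ∀ i, Pseudofunctor A (B i)) : Pseudofunctor A (∀ i, B i) where
  obj a := fun i => (F i).obj a
  map f := fun i => (F i).map f
  map₂ η := fun i => (F i).map₂ η
  map₂_id _ := funext fun i => (F i).map₂_id _
  map₂_comp _ _ := funext fun i => (F i).map₂_comp _ _
  mapId a := Pi.isoMk fun i => (F i).mapId a
  mapComp f g := Pi.isoMk fun i => (F i).mapComp f g
  map₂_whisker_left _ _ _ _ := funext fun i => (F i).map₂_whisker_left _ _
  map₂_whisker_right _ _ := funext fun i => (F i).map₂_whisker_right _ _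
  map₂_associator _ _ _ := funext fun i => (F i).map₂_associator _ _ _
  map₂_left_unitor _ := funext fun i => (F i).map₂_left_unitor _
  map₂_right_unitor _ := funext fun i => (F i).map₂_right_unitor _

/-- The pseudofunctor to a product with given components. -/
def piLift [SimplicialBicategory A] (F : ∀ i, SPseudofunctor A (B i)) :
    SPseudofunctor A (∀ i, B i) where
  toPseudofunctor := piLift₀ fun i => (F i).toPseudofunctor
  mapCell f g :=
    { app := fun k => TypeCat.ofHom fun x i => ((F i).mapCell f g).app k x
      naturality := fun k l θ => by
        ext x
        funext i
        exact (F i).mapCell_map θ x }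
  mapCell_vertex _ := funext fun i => (F i).mapCell_vertex _
  mapCell_comp _ _ := funext fun i => (F i).mapCell_comp _ _
  mapCell_whiskerLeft _ _ _ _ _ := funext fun i => (F i).mapCell_whiskerLeft _ _
  mapCell_whiskerRight _ _ := funext fun i => (F i).mapCell_whiskerRight _ _

end Pi

/-! ### The Segal nerve -/

section Nerve

variable {C : Type u} [Bicategory.{u, u} C]

/-- A normal pseudofunctor from a preordered set `I` (regarded as a bicategory with only identity
2-morphisms) to `C` whose action on objects is `c`. -/
@[ext]
structure NorHom {I : Type} [Preorder I] (C : Type u) [Bicategory.{u, u} C] (c : I → C) where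
  /-- the 1-morphisms -/
  map {i j : I} : i ≤ j → (c i ⟶ c j)
  /-- the identity constraints -/
  mapId (i : I) : map (le_refl i) ≅ 𝟙 (c i)
  /-- the composition constraints -/
  mapComp {i j k : I} (hij : i ≤ j) (hjk : j ≤ k) :
    map (hij.trans hjk) ≅ map hij ≫ map hjk
  map_assoc {i j k l : I} (hij : i ≤ j) (hjk : j ≤ k) (hkl : k ≤ l) :
    (mapComp (hij.trans hjk) hkl).hom ≫
        Bicategory.whiskerRight (mapComp hij hjk).hom (map hkl) ≫
          (Bicategory.associator (map hij) (map hjk) (map hkl)).hom =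
      (mapComp hij (hjk.trans hkl)).hom ≫
        Bicategory.whiskerLeft (map hij) (mapComp hjk hkl).hom
  map_left_unitor {i j : I} (h : i ≤ j) :
    (mapComp (le_refl i) h).hom ≫ Bicategory.whiskerRight (mapId i).hom (map h) ≫
      (Bicategory.leftUnitor (map h)).hom = 𝟙 (map h)
  map_right_unitor {i j : I} (h : i ≤ j) :
    (mapComp h (le_refl j)).hom ≫ Bicategory.whiskerLeft (map h) (mapId j).hom ≫
      (Bicategory.rightUnitor (map h)).hom = 𝟙 (map h)
  normal : ∃ h : ∀ i, map (le_refl i) = 𝟙 (c i), ∀ i, mapId i = eqToIso (h i)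

variable [SimplicialBicategory C]

/-- The `k`-simplices of the simplicial set of icons between normal pseudofunctors from `I`
with the same action on objects. -/
@[ext]
structure Icon {I : Type} [Preorder I] {c : I → C} (k : SimplexCategoryᵒᵖ)
    (X Y : NorHom C c) where
  /-- the components -/
  app {i j : I} (h : i ≤ j) : (cell (X.map h) (Y.map h)).obj k
  app_id (i : I) : comp (app (le_refl i)) (deg k (Y.mapId i).hom) = deg k (X.mapId i).hom
  app_comp {i j l : I} (hij : i ≤ j) (hjl : j ≤ l) :
    comp (app (hij.trans hjl)) (deg k (Y.mapComp hij hjl).hom) =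
      comp (deg k (X.mapComp hij hjl).hom)
        (comp (whiskerRight (app hij) (X.map hjl)) (whiskerLeft (Y.map hij) (app hjl)))

/-- The objects of the `k`-th level of the simplicially enriched category of normal pseudofunctors
`I → C` with action on objects `c`. -/
def NorLevel {I : Type} [Preorder I] (_k : SimplexCategoryᵒᵖ) (c : I → C) : Type u :=
  NorHom C c

/-- Icons compose vertically. -/
instance {I : Type} [Preorder I] (k : SimplexCategoryᵒᵖ) (c : I → C) :
    Category.{u} (NorLevel k c) where
  Hom X Y := Icon k X Y
  id X :=
    { app := fun h => deg k (𝟙 (X.map h))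
      app_id := fun i => SimplicialBicategory.id_comp _
      app_comp := fun hij hjl => by
        rw [SimplicialBicategory.id_comp, ← deg_whiskerLeft, ← deg_whiskerRight,
          Bicategory.id_whiskerRight, Bicategory.whiskerLeft_id, SimplicialBicategory.id_comp,
          SimplicialBicategory.comp_id] }
  comp {X Y Z} x y :=
    { app := fun h => comp (x.app h) (y.app h)
      app_id := fun i => by
        rw [SimplicialBicategory.assoc, y.app_id, x.app_id]
      app_comp := fun hij hjl => by
        rw [SimplicialBicategory.assoc, y.app_comp, ← SimplicialBicategory.assoc, x.app_comp,
          SimplicialBicategory.whiskerRight_comp, SimplicialBicategory.whiskerLeft_comp]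
        simp only [SimplicialBicategory.assoc]
        rw [← SimplicialBicategory.assoc (whiskerLeft (Y.map hij) (x.app hjl)),
          SimplicialBicategory.whisker_exchange]
        simp only [SimplicialBicategory.assoc] }
  id_comp x := Icon.ext (by
    funext i j h
    exact SimplicialBicategory.id_comp _)
  comp_id x := Icon.ext (by
    funext i j h
    exact SimplicialBicategory.comp_id _)
  assoc x y z := Icon.ext (by
    funext i j h
    exact SimplicialBicategory.assoc _ _ _)

/-- The `k`-th level of the simplicially enriched category of normal pseudofunctors `I → C` and
icons between them. Icons exist only between pseudofunctors with the same action on objects. -/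
abbrev NorCat (I : Type) [Preorder I] (C : Type u) [Bicategory.{u, u} C]
    [SimplicialBicategory C] (k : SimplexCategoryᵒᵖ) : Type u :=
  Σ c : I → C, NorLevel k c

variable {I J K : Type} [Preorder I] [Preorder J] [Preorder K]

/-- Restriction of normal pseudofunctors along a monotone map. -/
def NorHom.restrict (t : J →o I) {c : I → C} (X : NorHom C c) : NorHom C (c ∘ t) where
  map h := X.map (t.monotone h)
  mapId j := X.mapId (t j)
  mapComp hij hjk := X.mapComp (t.monotone hij) (t.monotone hjk)
  map_assoc hij hjk hkl := X.map_assoc (t.monotone hij) (t.monotone hjk) (t.monotone hkl)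
  map_left_unitor h := X.map_left_unitor (t.monotone h)
  map_right_unitor h := X.map_right_unitor (t.monotone h)
  normal := X.normal.elim fun h h' => ⟨fun j => h (t j), fun j => h' (t j)⟩

/-- The effect of restriction along a monotone map and a simplicial operator on icons. -/
def Icon.restrict (t : J →o I) {k l : SimplexCategoryᵒᵖ} (θ : k ⟶ l) {c : I → C}
    {X Y : NorHom C c} (x : Icon k X Y) : Icon l (X.restrict t) (Y.restrict t) where
  app h := (cell _ _).map θ (x.app (t.monotone h))
  app_id i := by
    have := congrArg ((cell _ _).map θ) (x.app_id (t i))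
    rw [SimplicialBicategory.map_comp, map_deg, map_deg] at this
    exact this
  app_comp hij hjl := by
    have := congrArg ((cell _ _).map θ) (x.app_comp (t.monotone hij) (t.monotone hjl))
    rw [SimplicialBicategory.map_comp, SimplicialBicategory.map_comp,
      SimplicialBicategory.map_comp, SimplicialBicategory.map_whiskerLeft,
      SimplicialBicategory.map_whiskerRight, map_deg, map_deg] at this
    exact this

/-- Restriction of normal pseudofunctors and icons along a monotone map and a simplicial
operator. -/
def restrictFunctor (C : Type u) [Bicategory.{u, u} C] [SimplicialBicategory C] (t : J →o I)
    {k l : SimplexCategoryᵒᵖ} (θ : k ⟶ l) : NorCat I C k ⥤ NorCat J C l :=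
  Sigma.desc fun c =>
    { obj := fun X => ⟨c ∘ t, NorHom.restrict t X⟩
      map := fun x => Sigma.SigmaHom.mk (Icon.restrict t θ x)
      map_id := fun _ => congrArg Sigma.SigmaHom.mk (Icon.ext (by
        funext i j h
        exact map_deg θ _))
      map_comp := fun x y => congrArg Sigma.SigmaHom.mk (Icon.ext (by
        funext i j h
        exact SimplicialBicategory.map_comp θ _ _)) }

variable {D E : Type u} [Bicategory.{u, u} D] [SimplicialBicategory D]
  [Bicategory.{u, u} E] [SimplicialBicategory E]

/-- Composition of a normal pseudofunctor `I → C` with a normal pseudofunctor `F : C → D`. -/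
def NorHom.postcomp (F : SPseudofunctor C D) (hF : F.IsNormal) {c : I → C} (X : NorHom C c) :
    NorHom D (F.obj ∘ c) where
  map h := F.map (X.map h)
  mapId i := F.map₂Iso (X.mapId i) ≪≫ F.mapId (c i)
  mapComp hij hjk := F.map₂Iso (X.mapComp hij hjk) ≪≫ F.mapComp (X.map hij) (X.map hjk)
  map_assoc hij hjk hkl := by
    have := congrArg (fun z => F.map₂ z) (X.map_assoc hij hjk hkl)
    simp at this
    have := congrArg (fun z => z ≫ (F.mapComp (X.map hij) (X.map hjk ≫ X.map hkl)).hom ≫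
      Bicategory.whiskerLeft (F.map (X.map hij)) (F.mapComp (X.map hjk) (X.map hkl)).hom) this
    simpa [← Bicategory.whiskerLeft_comp] using this
  map_left_unitor h := by
    have := congrArg (fun z => F.map₂ z) (X.map_left_unitor h)
    simpa using this
  map_right_unitor h := by
    have := congrArg (fun z => F.map₂ z) (X.map_right_unitor h)
    simpa using this
  normal := by
    obtain ⟨hF, hF'⟩ := hF
    obtain ⟨hX, hX'⟩ := X.normal
    refine ⟨fun i => (congrArg F.map (hX i)).trans (hF _), fun i => ?_⟩
    ext
    change F.map₂ (X.mapId i).hom ≫ (F.mapId (c i)).hom = _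
    rw [hF', hX', eqToIso.hom, eqToIso.hom, PrelaxFunctor.map₂_eqToHom, eqToHom_trans]
    rfl

/-- The effect of composition with a pseudofunctor on icons. -/
def Icon.postcomp (F : SPseudofunctor C D) (hF : F.IsNormal) {k : SimplexCategoryᵒᵖ} {c : I → C}
    {X Y : NorHom C c} (x : Icon k X Y) : Icon k (X.postcomp F hF) (Y.postcomp F hF) where
  app h := (F.mapCell _ _).app k (x.app h)
  app_id i := by
    change comp _ (deg k (F.map₂ (Y.mapId i).hom ≫ _)) = deg k (F.map₂ (X.mapId i).hom ≫ _)
    rw [deg_comp, deg_comp, ← SPseudofunctor.mapCell_deg, ← SPseudofunctor.mapCell_deg,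
      ← SimplicialBicategory.assoc, ← F.mapCell_comp, x.app_id]
  app_comp {i j l} hij hjl := by
    change comp _ (deg k (F.map₂ (Y.mapComp hij hjl).hom ≫ _)) =
      comp (deg k (F.map₂ (X.mapComp hij hjl).hom ≫ _)) (comp
        (whiskerRight ((F.mapCell _ _).app k (x.app hij)) (F.map (X.map hjl)))
        (whiskerLeft (F.map (Y.map hij)) ((F.mapCell _ _).app k (x.app hjl))))
    rw [deg_comp, deg_comp, ← SPseudofunctor.mapCell_deg, ← SPseudofunctor.mapCell_deg,
      ← SimplicialBicategory.assoc, ← F.mapCell_comp, x.app_comp, F.mapCell_comp, F.mapCell_comp]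
    simp only [SimplicialBicategory.assoc]
    rw [F.mapCell_whiskerLeft,
      ← SimplicialBicategory.assoc (deg k (F.mapComp (X.map hij) (X.map hjl)).hom),
      ← F.mapCell_whiskerRight]
    simp only [SimplicialBicategory.assoc]

/-- Composition of normal pseudofunctors and icons with a normal pseudofunctor. -/
def postcompFunctor (I : Type) [Preorder I] (F : SPseudofunctor C D) (hF : F.IsNormal)
    (k : SimplexCategoryᵒᵖ) : NorCat I C k ⥤ NorCat I D k :=
  Sigma.desc fun c =>
    { obj := fun X => ⟨F.obj ∘ c, NorHom.postcomp F hF X⟩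
      map := fun x => Sigma.SigmaHom.mk (Icon.postcomp F hF x)
      map_id := fun X => congrArg Sigma.SigmaHom.mk (Icon.ext (by
        funext i j h
        exact (F.mapCell_deg k _).trans (congrArg (deg k) (F.map₂_id _))))
      map_comp := fun x y => congrArg Sigma.SigmaHom.mk (Icon.ext (by
        funext i j h
        exact F.mapCell_comp _ _)) }

theorem norCat_functor_ext {𝒟 : Type u} [Category.{u} 𝒟] {k : SimplexCategoryᵒᵖ}
    {P Q : NorCat I C k ⥤ 𝒟} (h₀ : ∀ (c : I → C) (X : NorLevel k c), P.obj ⟨c, X⟩ = Q.obj ⟨c, X⟩)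
    (h₁ : ∀ (c : I → C) (X Y : NorLevel k c) (x : X ⟶ Y),
      HEq (P.map (Sigma.SigmaHom.mk x)) (Q.map (Sigma.SigmaHom.mk x))) : P = Q := by
  refine CategoryTheory.Functor.hext (fun X => h₀ X.1 X.2) ?_
  rintro _ _ ⟨x⟩
  exact h₁ _ _ _ x

theorem sigmaHom_hext {k : SimplexCategoryᵒᵖ} {c : I → C} {X X' Y Y' : NorHom C c}
    (hX : X = X') (hY : Y = Y') (x : Icon k X Y) (x' : Icon k X' Y')
    (h : ∀ {i j : I} (h : i ≤ j), HEq (x.app h) (x'.app h)) :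
    HEq (Sigma.SigmaHom.mk (C := NorLevel (C := C) (I := I) k) (X := X) (Y := Y) x)
      (Sigma.SigmaHom.mk (C := NorLevel (C := C) (I := I) k) (X := X') (Y := Y') x') := by
  subst hX hY
  obtain rfl : x = x' := Icon.ext (by
    funext i j hij
    exact eq_of_heq (h hij))
  rfl

theorem restrictFunctor_id (k : SimplexCategoryᵒᵖ) :
    restrictFunctor C (OrderHom.id : I →o I) (𝟙 k) = 𝟭 (NorCat I C k) :=
  norCat_functor_ext (fun _ _ => rfl) fun _ _ _ x => sigmaHom_hext rfl rfl _ x fun _ =>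
    heq_of_eq (Functor.map_id_apply _ _ _)

theorem restrictFunctor_comp (t : J →o I) (s : K →o J) {k l m : SimplexCategoryᵒᵖ}
    (θ : k ⟶ l) (θ' : l ⟶ m) :
    restrictFunctor C (t.comp s) (θ ≫ θ') = restrictFunctor C t θ ⋙ restrictFunctor C s θ' :=
  norCat_functor_ext (fun _ _ => rfl) fun _ _ _ _ => sigmaHom_hext rfl rfl _ _ fun _ =>
    heq_of_eq (Functor.map_comp_apply _ _ _ _)

theorem postcompFunctor_id (k : SimplexCategoryᵒᵖ) :
    postcompFunctor I (SPseudofunctor.id C) SPseudofunctor.isNormal_id k =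
      𝟭 (NorCat I C k) := by
  have key : ∀ (c : I → C) (X : NorHom C c),
      X.postcomp (SPseudofunctor.id C) SPseudofunctor.isNormal_id = X := by
    intro c X
    refine NorHom.ext rfl (heq_of_eq ?_) (heq_of_eq ?_)
    · funext i
      ext
      exact Category.comp_id _
    · funext i j l h h'
      ext
      exact Category.comp_id _
  exact norCat_functor_ext (fun c X => congrArg (Sigma.mk c) (key c X)) fun c X Y x =>
    sigmaHom_hext (key c X) (key c Y) _ x fun _ => HEq.rfl

theorem postcompFunctor_comp (F : SPseudofunctor C D) (hF : F.IsNormal) (G : SPseudofunctor D E)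
    (hG : G.IsNormal) (k : SimplexCategoryᵒᵖ) :
    postcompFunctor I (F.comp G) (hF.comp hG) k =
      postcompFunctor I F hF k ⋙ postcompFunctor I G hG k := by
  have key : ∀ (c : I → C) (X : NorHom C c),
      X.postcomp (F.comp G) (hF.comp hG) = (X.postcomp F hF).postcomp G hG := by
    intro c X
    refine NorHom.ext rfl (heq_of_eq ?_) (heq_of_eq ?_)
    · funext i
      ext
      exact (Category.assoc _ _ _).symm.trans (congrArg (· ≫ _) (G.map₂_comp _ _).symm)
    · funext i j l h h'
      ext
      exact (Category.assoc _ _ _).symm.trans (congrArg (· ≫ _) (G.map₂_comp _ _).symm)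
  exact norCat_functor_ext (fun c X => congrArg (Sigma.mk _) (key c X)) fun c X Y _ =>
    sigmaHom_hext (key c X) (key c Y) _ _ fun _ => HEq.rfl

theorem restrictFunctor_postcompFunctor (F : SPseudofunctor C D) (hF : F.IsNormal) (t : J →o I)
    {k l : SimplexCategoryᵒᵖ} (θ : k ⟶ l) :
    restrictFunctor C t θ ⋙ postcompFunctor J F hF l =
      postcompFunctor I F hF k ⋙ restrictFunctor D t θ :=
  norCat_functor_ext (fun _ _ => rfl) fun _ _ _ _ => sigmaHom_hext rfl rfl _ _ fun _ =>
    heq_of_eq (F.mapCell_map _ _)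

end Nerve

/-- The Segal nerve of a bicategory. It is a simplicial object `n ↦ NorHom([n], C)` in simplicially
enriched categories; a simplicially enriched category is recorded as the simplicial category
formed by its levels, so that the value at `(n, k)` is the category of normal pseudofunctors
`[n] → C` and `k`-simplices of icons. -/
def segalNerve (C : Type u) [Bicategory.{u, u} C] [SimplicialBicategory C] :
    SimplexCategoryᵒᵖ × SimplexCategoryᵒᵖ ⥤ Cat.{u, u} where
  obj p := Cat.of (NorCat (Fin (p.1.unop.len + 1)) C p.2)
  map f := (restrictFunctor C f.1.unop.toOrderHom f.2).toCatHom
  map_id p := congrArg Functor.toCatHom (restrictFunctor_id p.2)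
  map_comp f g := congrArg Functor.toCatHom (restrictFunctor_comp _ _ f.2 g.2)

/-- The Segal nerve, as a functor on bicategories and normal pseudofunctors. -/
def segalNerveFunctor :
    NormalBicat.{u} ⥤ (SimplexCategoryᵒᵖ × SimplexCategoryᵒᵖ ⥤ Cat.{u, u}) where
  obj C := segalNerve C.obj.carrier
  map F :=
    { app := fun p => (postcompFunctor _ (Bicat.toPseudo F.hom) F.property p.2).toCatHom
      naturality := fun _ _ f => congrArg Functor.toCatHom
        (restrictFunctor_postcompFunctor (Bicat.toPseudo F.hom) F.property _ f.2) }
  map_id C := by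
    ext p : 2
    exact congrArg Functor.toCatHom (postcompFunctor_id p.2)
  map_comp F G := by
    ext p : 2
    exact congrArg Functor.toCatHom (postcompFunctor_comp _ F.property _ G.property p.2)

/-- The diagonal of a trisimplicial set. -/
def diagonal : (SimplexCategoryᵒᵖ × SimplexCategoryᵒᵖ ⥤ SSet.{u}) ⥤ SSet.{u} :=
  Functor.uncurry ⋙ (Functor.whiskeringLeft _ _ _).obj
    (Functor.prod' (Functor.diag SimplexCategoryᵒᵖ) (𝟭 SimplexCategoryᵒᵖ))

/-- The classifying space of bicategories, as a functor on normal pseudofunctors: the geometric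
realization of the Segal nerve, that is of the trisimplicial set whose `(n, k, p)`-simplices are the
`p`-simplices of the nerve of the category of normal pseudofunctors `[n] → C` and `k`-simplices of
icons. -/
noncomputable def classifyingSpace : NormalBicat.{u} ⥤ TopCat.{u} :=
  segalNerveFunctor ⋙ (Functor.whiskeringRight _ _ _).obj nerveFunctor ⋙ diagonal ⋙ SSet.toTop

/-! ### Weak homotopy equivalences -/

section WeakEquivalence

variable {X Y : Type u} [TopologicalSpace X] [TopologicalSpace Y]

/-- The map induced on sets of path components. -/
def pi₀Map (f : C(X, Y)) : ZerothHomotopy X → ZerothHomotopy Y :=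
  Quotient.map' f fun _ _ h => h.map f.continuous

/-- The map induced on homotopy groups. -/
def piMap (f : C(X, Y)) (n : ℕ) (x : X) :
    HomotopyGroup (Fin n) X x → HomotopyGroup (Fin n) Y (f x) :=
  Quotient.map' (fun γ => ⟨f.comp γ.1, fun y hy => congrArg f (γ.2 y hy)⟩)
    fun _ _ h => h.comp_continuousMap f

/-- Weak homotopy equivalences: bijections on path components and on all homotopy groups for all
base points. -/
def IsWeakEquivalence (f : C(X, Y)) : Prop :=
  Function.Bijective (pi₀Map f) ∧ ∀ (n : ℕ) (x : X), 1 ≤ n → Function.Bijective (piMap f n x)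

end WeakEquivalence

/-! ### Γ-spaces and Γ-bicategories -/

/-- The skeletal category of finite pointed sets: the object `n` is the set `{0, 1, …, n}` pointed
by `0`. -/
structure FinStar : Type where
  /-- the number of points different from the base point -/
  n : ℕ

instance : Category FinStar where
  Hom m n := {f : Fin (m.n + 1) → Fin (n.n + 1) // f 0 = 0}
  id _ := ⟨fun x => x, rfl⟩
  comp f g := ⟨fun x => g.1 (f.1 x), (congrArg g.1 f.2).trans g.2⟩

/-- The pointed map `i_k` sending `k` to `1` and all other elements to `0`; here `k : Fin n`
stands for the element `k + 1` of `{1, …, n}`. -/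
def proj (n : ℕ) (k : Fin n) : FinStar.mk n ⟶ FinStar.mk 1 :=
  ⟨fun j => if j = k.succ then 1 else 0, if_neg (Fin.succ_ne_zero k).symm⟩

/-- The map `P_n : X(n) → X(1)^n` of a Γ-space. -/
def segalMap (X : FinStar ⥤ TopCat.{u}) (n : ℕ) :
    C(X.obj ⟨n⟩, Fin n → X.obj ⟨1⟩) :=
  ContinuousMap.pi fun k => (X.map (proj n k)).hom

/-- Special Γ-spaces. -/
def IsSpecialΓSpace (X : FinStar ⥤ TopCat.{u}) : Prop :=
  ∀ n : ℕ, IsWeakEquivalence (segalMap X n)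

/-- The pseudofunctor `P_n : A(n) → A(1)^n` of a Γ-bicategory. -/
def segalPseudofunctor (A : FinStar ⥤ Bicat.{u}) (n : ℕ) :
    SPseudofunctor (A.obj ⟨n⟩).carrier (Fin n → (A.obj ⟨1⟩).carrier) :=
  piLift fun k => Bicat.toPseudo (A.map (proj n k))

/-- Special Γ-bicategories. -/
def IsSpecialΓBicategory (A : FinStar ⥤ Bicat.{u}) : Prop :=
  ∀ n : ℕ, IsBiequivalence (segalPseudofunctor A n)

/-- The classifying space of a bicategory. -/
noncomputable abbrev classifyingSpaceObj (B : Bicat.{u}) : TopCat.{u} :=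
  classifyingSpace.obj ⟨B⟩

/-- The map of classifying spaces induced by a normal pseudofunctor. -/
noncomputable def classifyingSpaceMap {B C : Bicat.{u}}
    (F : SPseudofunctor B.carrier C.carrier) (hF : F.IsNormal) :
    C(classifyingSpaceObj B, classifyingSpaceObj C) :=
  (classifyingSpace.map (X := ⟨B⟩) (Y := ⟨C⟩) ⟨F, hF⟩).hom

/-- A Γ-space `X` is a model of the classifying space `|N A|` of a Γ-bicategory `A` whose
pseudofunctors `A(f)` need not be normal: its values are homotopy equivalent to the classifying
spaces `|N A(s)|`, in such a way that, up to homotopy, `X(f)` corresponds to `|N F|` for every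
normalization `F` of the pseudofunctor `A(f)` (and `A(f)` has a normalization). -/
def IsClassifyingΓSpace (A : FinStar ⥤ Bicat.{u}) (X : FinStar ⥤ TopCat.{u}) : Prop :=
  ∃ e : ∀ s : FinStar, ContinuousMap.HomotopyEquiv (classifyingSpaceObj (A.obj s)) (X.obj s),
    ∀ ⦃s t : FinStar⦄ (f : s ⟶ t),
      (∃ F : SPseudofunctor (A.obj s).carrier (A.obj t).carrier,
        F.IsNormal ∧ NatEquivalent F (Bicat.toPseudo (A.map f))) ∧
      ∀ (F : SPseudofunctor (A.obj s).carrier (A.obj t).carrier) (hF : F.IsNormal),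
        NatEquivalent F (Bicat.toPseudo (A.map f)) →
          ContinuousMap.Homotopic ((X.map f).hom.comp (e s).toFun)
            ((e t).toFun.comp (classifyingSpaceMap F hF))

end SegalGamma

/-!
A transformation `F ⟶ G` of normal pseudofunctors `B → C` induces a homotopy `|N F| ∼ |N G|`: for a
normal pseudofunctor `X : [n] → B` it extends `F ∘ X` and `G ∘ X` to a normal pseudofunctor
`{0 < 1} × [n] → C`, whose restrictions along the graphs of the monotone maps `[n] → {0 < 1}`
are the values of a simplicial homotopy. No invertibility is needed, so a pseudofunctor that is
invertible only up to zigzags of transformations induces a homotopy equivalence as soon as the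
pseudofunctors involved are normal.

To remove the normality assumption, adjoin a new identity to every object. This produces a
bicategory equivalent to `B` by normal pseudofunctors, and every pseudofunctor `F` extends to a
normal one by sending new identities to new identities; the extension is strictly functorial in
`F`. This provides both a model of `|N A|` and the invariance of classifying spaces for normal
pseudofunctors with a non-normal inverse.

Finally the Segal nerve preserves products levelwise, and geometric realization, formed in all
topological spaces, preserves them up to weak equivalence: the comparison map `|K × L| → |K| × |L|`
is a bijection through which every map from a compact space lifts.
-/

namespace SegalGamma

/-! ### Homotopy equivalences are weak equivalences -/

section CubeRetraction

open unitInterval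

variable {n : ℕ}

/-- The sup-norm distance of a point of the cube to the centre, normalized to be `1` on the
boundary. -/
noncomputable def cubeRadius (y : Fin n → I) : ℝ :=
  ‖fun i => 2 * (y i : ℝ) - 1‖

theorem continuous_cubeRadius : Continuous (cubeRadius (n := n)) := by
  unfold cubeRadius
  fun_prop

theorem abs_le_cubeRadius (y : Fin n → I) (i : Fin n) : |2 * (y i : ℝ) - 1| ≤ cubeRadius y :=
  norm_le_pi_norm (fun i => 2 * (y i : ℝ) - 1) i

theorem cubeRadius_le_one (y : Fin n → I) : cubeRadius y ≤ 1 := by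
  refine (pi_norm_le_iff_of_nonneg zero_le_one).2 fun i => ?_
  rw [Real.norm_eq_abs, abs_le]
  constructor <;> linarith [(y i).2.1, (y i).2.2]

theorem cubeRadius_eq_one {y : Fin n → I} (hy : y ∈ Cube.boundary (Fin n)) :
    cubeRadius y = 1 := by
  obtain ⟨i, hi⟩ := hy
  refine (cubeRadius_le_one y).antisymm (le_trans ?_ (abs_le_cubeRadius y i))
  rcases hi with hi | hi <;> rw [hi] <;> norm_num

theorem exists_abs_eq_cubeRadius {y : Fin n → I} (h : 0 < cubeRadius y) :
    ∃ i, |2 * (y i : ℝ) - 1| = cubeRadius y := by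
  by_contra! hne
  exact lt_irrefl _ <| (pi_norm_lt_iff h).2 fun i => (abs_le_cubeRadius y i).lt_of_ne (hne i)

variable (n) in
/-- The union of the bottom and the sides of the cylinder over a cube. -/
def cubeShell : Set (I × (Fin n → I)) :=
  {z | z.1 = 0 ∨ z.2 ∈ Cube.boundary (Fin n)}

/-- The factor by which a point of the cylinder over a cube has to be moved away from the centre
of projection, which is the point at height `2` over the centre of the cube. -/
noncomputable def cubeScale (z : I × (Fin n → I)) : ℝ :=
  max ((2 - (z.1 : ℝ)) / 2) (cubeRadius z.2)

theorem cubeScale_pos (z : I × (Fin n → I)) : 0 < cubeScale z :=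
  lt_of_lt_of_le (by linarith [z.1.2.2]) (le_max_left _ _)

theorem continuous_cubeScale : Continuous (cubeScale (n := n)) := by
  have := continuous_cubeRadius (n := n)
  unfold cubeScale
  fun_prop

theorem cubeScale_eq_one {z : I × (Fin n → I)} (hz : z ∈ cubeShell n) : cubeScale z = 1 := by
  rcases hz with hz | hz
  · rw [cubeScale, hz, max_eq_left] <;> simp [cubeRadius_le_one]
  · rw [cubeScale, cubeRadius_eq_one hz, max_eq_right]
    linarith [z.1.2.1]

/-- The radial projection of the cylinder over a cube onto its shell, a retraction. -/
noncomputable def cubeRetraction : C(I × (Fin n → I), I × (Fin n → I)) where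
  toFun z := (Set.projIcc 0 1 zero_le_one (2 - (2 - (z.1 : ℝ)) / cubeScale z),
    fun i => Set.projIcc 0 1 zero_le_one ((1 + (2 * (z.2 i : ℝ) - 1) / cubeScale z) / 2))
  continuous_toFun := by
    have h := continuous_cubeScale (n := n)
    have h₀ : ∀ z : I × (Fin n → I), cubeScale z ≠ 0 := fun z => (cubeScale_pos z).ne'
    refine Continuous.prodMk ?_ (continuous_pi fun i => ?_)
    · exact continuous_projIcc.comp (continuous_const.sub (Continuous.div (by fun_prop) h h₀))
    · exact continuous_projIcc.comp
        ((continuous_const.add (Continuous.div (by fun_prop) h h₀)).div_const 2)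

theorem cubeRetraction_fst_eq_zero {z : I × (Fin n → I)}
    (h : cubeRadius z.2 ≤ (2 - (z.1 : ℝ)) / 2) : (cubeRetraction z).1 = 0 := by
  refine Set.projIcc_of_le_left zero_le_one ?_
  have hz : (2 - (z.1 : ℝ)) / cubeScale z = 2 := by
    rw [div_eq_iff (cubeScale_pos z).ne', cubeScale, max_eq_left h]
    ring
  rw [hz, sub_self]

theorem cubeRetraction_snd_mem_boundary {z : I × (Fin n → I)}
    (h : (2 - (z.1 : ℝ)) / 2 ≤ cubeRadius z.2) :
    (cubeRetraction z).2 ∈ Cube.boundary (Fin n) := by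
  have hz : cubeScale z = cubeRadius z.2 := max_eq_right h
  have hpos := cubeScale_pos z
  obtain ⟨i, hi⟩ := exists_abs_eq_cubeRadius (hz ▸ hpos)
  rw [← hz] at hi
  refine ⟨i, ?_⟩
  rcases (abs_eq hpos.le).1 hi with hi | hi
  · refine .inr (Set.projIcc_of_right_le zero_le_one ?_)
    rw [hi, div_self hpos.ne']
    norm_num
  · refine .inl (Set.projIcc_of_le_left zero_le_one ?_)
    rw [hi, neg_div, div_self hpos.ne']
    norm_num

theorem cubeRetraction_mem_cubeShell (z : I × (Fin n → I)) : cubeRetraction z ∈ cubeShell n :=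
  (le_total _ _).imp cubeRetraction_fst_eq_zero cubeRetraction_snd_mem_boundary

theorem cubeRetraction_eq_self {z : I × (Fin n → I)} (hz : z ∈ cubeShell n) :
    cubeRetraction z = z := by
  refine Prod.ext ?_ (funext fun i => ?_)
  · change Set.projIcc 0 1 zero_le_one (2 - (2 - (z.1 : ℝ)) / cubeScale z) = z.1
    rw [cubeScale_eq_one hz, div_one, sub_sub_cancel, Set.projIcc_val]
  · change Set.projIcc 0 1 zero_le_one ((1 + (2 * (z.2 i : ℝ) - 1) / cubeScale z) / 2) = z.2 i
    rw [cubeScale_eq_one hz, div_one, add_sub_cancel, mul_div_cancel_left₀ _ two_ne_zero,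
      Set.projIcc_val]

theorem id_homotopicRel_cubeRetraction :
    (ContinuousMap.id _).HomotopicRel (cubeRetraction (n := n)) (cubeShell n) := by
  have hr := (cubeRetraction (n := n)).continuous
  exact ⟨{
    toFun w := (Set.Icc.convexComb w.2.1 (cubeRetraction w.2).1 w.1,
      fun i => Set.Icc.convexComb (w.2.2 i) ((cubeRetraction w.2).2 i) w.1)
    continuous_toFun := by
      refine Continuous.prodMk ?_ (continuous_pi fun i => ?_)
      · exact Set.Icc.continuous_convexComb_prod.comp (continuous_snd.fst.prodMk
          ((hr.comp continuous_snd).fst.prodMk continuous_fst))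
      · exact Set.Icc.continuous_convexComb_prod.comp
          (((continuous_apply i).comp continuous_snd.snd).prodMk
            (((continuous_apply i).comp (hr.comp continuous_snd).snd).prodMk continuous_fst))
    map_zero_left z := by simp
    map_one_left z := by simp
    prop' t z hz := by simp [cubeRetraction_eq_self hz] }⟩

theorem homotopicRel_of_eqOn_cubeShell {X : Type*} [TopologicalSpace X]
    {K L : C(I × (Fin n → I), X)} (h : Set.EqOn K L (cubeShell n)) :
    K.HomotopicRel L (cubeShell n) := by
  have hr : K.comp cubeRetraction = L.comp cubeRetraction :=
    ContinuousMap.ext fun z => h (cubeRetraction_mem_cubeShell z)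
  exact (id_homotopicRel_cubeRetraction.comp_continuousMap K).trans
    (hr ▸ (id_homotopicRel_cubeRetraction.comp_continuousMap L).symm)

theorem homotopicRel_boundary_of_eqOn_cubeShell {X : Type*} [TopologicalSpace X]
    {f g f' g' : C(Fin n → I, X)} (K : f.Homotopy g) (L : f'.Homotopy g')
    (h : Set.EqOn K L (cubeShell n)) : g.HomotopicRel g' (Cube.boundary (Fin n)) := by
  obtain ⟨H⟩ := homotopicRel_of_eqOn_cubeShell
    (K := K.toContinuousMap) (L := L.toContinuousMap) h
  exact ⟨{
    toFun w := H (w.1, (1, w.2))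
    map_zero_left z := (H.apply_zero _).trans (K.apply_one z)
    map_one_left z := (H.apply_one _).trans (L.apply_one z)
    prop' t z hz := (H.eq_fst t (.inr hz)).trans (K.apply_one z) }⟩

end CubeRetraction

section FreelyHomotopic

open unitInterval

variable {X : Type*} [TopologicalSpace X] {n : ℕ} {x y : X} {p : Path x y}

/-- Two generalized loops are freely homotopic along a path if there is a homotopy between them
which follows the path on the boundary of the cube. -/
def FreelyHomotopic (p : Path x y) (γ : GenLoop (Fin n) X x) (δ : GenLoop (Fin n) X y) : Prop :=
  ∃ K : ContinuousMap.Homotopy γ.1 δ.1, ∀ s, ∀ z ∈ Cube.boundary (Fin n), K (s, z) = p s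

theorem FreelyHomotopic.symm {γ : GenLoop (Fin n) X x} {δ : GenLoop (Fin n) X y}
    (h : FreelyHomotopic p γ δ) : FreelyHomotopic p.symm δ γ := by
  obtain ⟨K, hK⟩ := h
  exact ⟨K.symm, fun s => hK (σ s)⟩

theorem exists_freelyHomotopic (p : Path x y) (γ : GenLoop (Fin n) X x) :
    ∃ δ : GenLoop (Fin n) X y, FreelyHomotopic p γ δ := by
  classical
  let K : I × (Fin n → I) → X := fun z =>
    if cubeRadius z.2 ≤ (2 - (z.1 : ℝ)) / 2 then γ (cubeRetraction z).2
    else p (cubeRetraction z).1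
  have K_continuous : Continuous K := by
    have := continuous_cubeRadius (n := n)
    have hr := (cubeRetraction (n := n)).continuous
    refine Continuous.if_le (γ.1.continuous.comp hr.snd) (p.continuous.comp hr.fst)
      (by fun_prop) (by fun_prop) fun z hz => ?_
    rw [cubeRetraction_fst_eq_zero hz.le, p.source]
    exact γ.2 _ (cubeRetraction_snd_mem_boundary hz.ge)
  have K_zero (z : Fin n → I) : K (0, z) = γ z := by
    have hz : cubeRetraction (0, z) = (0, z) := cubeRetraction_eq_self (.inl rfl)
    dsimp only [K]
    rw [if_pos (by simp [cubeRadius_le_one]), hz]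
  have K_boundary (s : I) (z : Fin n → I) (hz : z ∈ Cube.boundary (Fin n)) : K (s, z) = p s := by
    have hsz : cubeRetraction (s, z) = (s, z) := cubeRetraction_eq_self (.inr hz)
    dsimp only [K]
    rw [hsz]
    split_ifs with h
    · obtain rfl : s = 0 := (Prod.ext_iff.1 hsz).1.symm.trans (cubeRetraction_fst_eq_zero h)
      rw [p.source]
      exact γ.2 _ hz
    · rfl
  exact ⟨⟨⟨fun z => K (1, z), by fun_prop⟩, fun z hz => (K_boundary 1 z hz).trans p.target⟩,
    { toFun := K, map_zero_left := K_zero, map_one_left := fun _ => rfl }, K_boundary⟩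

theorem FreelyHomotopic.homotopic {γ γ' : GenLoop (Fin n) X x} {δ δ' : GenLoop (Fin n) X y}
    (h : FreelyHomotopic p γ δ) (h' : FreelyHomotopic p γ' δ') (hγ : GenLoop.Homotopic γ γ') :
    GenLoop.Homotopic δ δ' := by
  obtain ⟨K, hK⟩ := h
  obtain ⟨K', hK'⟩ := h'
  obtain ⟨G⟩ := hγ
  refine homotopicRel_boundary_of_eqOn_cubeShell
    ((ContinuousMap.Homotopy.refl γ.1).trans K) (G.toHomotopy.trans K') ?_
  rintro ⟨s, z⟩ (rfl | hz)
  · simp only [ContinuousMap.Homotopy.apply_zero]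
  · simp only [ContinuousMap.Homotopy.trans_apply]
    split_ifs with hs
    · exact (G.eq_fst _ hz).symm
    · rw [hK _ _ hz, hK' _ _ hz]

end FreelyHomotopic

section WeakEquivalence

open unitInterval

variable {X Y Z : Type u} [TopologicalSpace X] [TopologicalSpace Y] [TopologicalSpace Z]

theorem pi₀Map_injective_iff (f : C(X, Y)) :
    Function.Injective (pi₀Map f) ↔ ∀ x y : X, Joined (f x) (f y) → Joined x y := by
  refine ⟨fun h x y hxy => Quotient.exact (h (a₁ := ⟦x⟧) (a₂ := ⟦y⟧) (Quotient.sound hxy)), ?_⟩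
  rintro h ⟨x⟩ ⟨y⟩ hxy
  exact Quotient.sound (h x y (Quotient.exact hxy))

theorem pi₀Map_surjective_iff (f : C(X, Y)) :
    Function.Surjective (pi₀Map f) ↔ ∀ y : Y, ∃ x : X, Joined (f x) y := by
  refine ⟨fun h y => ?_, ?_⟩
  · obtain ⟨⟨x⟩, hx⟩ := h ⟦y⟧
    exact ⟨x, Quotient.exact hx⟩
  · rintro h ⟨y⟩
    obtain ⟨x, hx⟩ := h y
    exact ⟨⟦x⟧, Quotient.sound hx⟩

theorem pi₀Map_id : pi₀Map (ContinuousMap.id X) = id :=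
  funext <| Quotient.ind fun _ => rfl

theorem pi₀Map_comp (g : C(Y, Z)) (f : C(X, Y)) : pi₀Map (g.comp f) = pi₀Map g ∘ pi₀Map f :=
  funext <| Quotient.ind fun _ => rfl

/-- The image of a generalized loop under a continuous map. -/
def mapGenLoop (f : C(X, Y)) {n : ℕ} {x : X} (γ : GenLoop (Fin n) X x) :
    GenLoop (Fin n) Y (f x) :=
  ⟨f.comp γ.1, fun y hy => congrArg f (γ.2 y hy)⟩

theorem piMap_injective_iff (f : C(X, Y)) (n : ℕ) (x : X) :
    Function.Injective (piMap f n x) ↔ ∀ γ γ' : GenLoop (Fin n) X x,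
      GenLoop.Homotopic (mapGenLoop f γ) (mapGenLoop f γ') → GenLoop.Homotopic γ γ' := by
  refine ⟨fun h γ γ' hγ => Quotient.exact (h (a₁ := ⟦γ⟧) (a₂ := ⟦γ'⟧) (Quotient.sound hγ)), ?_⟩
  rintro h ⟨γ⟩ ⟨γ'⟩ hγ
  exact Quotient.sound (h γ γ' (Quotient.exact hγ))

theorem piMap_surjective_iff (f : C(X, Y)) (n : ℕ) (x : X) :
    Function.Surjective (piMap f n x) ↔ ∀ δ : GenLoop (Fin n) Y (f x),
      ∃ γ : GenLoop (Fin n) X x, GenLoop.Homotopic (mapGenLoop f γ) δ := by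
  refine ⟨fun h δ => ?_, ?_⟩
  · obtain ⟨⟨γ⟩, hγ⟩ := h ⟦δ⟧
    exact ⟨γ, Quotient.exact hγ⟩
  · rintro h ⟨δ⟩
    obtain ⟨γ, hγ⟩ := h δ
    exact ⟨⟦γ⟧, Quotient.sound hγ⟩

theorem piMap_id (n : ℕ) (x : X) : piMap (ContinuousMap.id X) n x = id :=
  funext <| Quotient.ind fun _ => rfl

theorem piMap_comp (g : C(Y, Z)) (f : C(X, Y)) (n : ℕ) (x : X) :
    piMap (g.comp f) n x = piMap g n (f x) ∘ piMap f n x :=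
  funext <| Quotient.ind fun _ => rfl

theorem IsWeakEquivalence.id : IsWeakEquivalence (ContinuousMap.id X) :=
  ⟨pi₀Map_id (X := X) ▸ Function.bijective_id,
    fun n x _ => piMap_id n x ▸ Function.bijective_id⟩

theorem IsWeakEquivalence.comp {g : C(Y, Z)} {f : C(X, Y)} (hg : IsWeakEquivalence g)
    (hf : IsWeakEquivalence f) : IsWeakEquivalence (g.comp f) :=
  ⟨pi₀Map_comp g f ▸ hg.1.comp hf.1,
    fun n x hn => piMap_comp g f n x ▸ (hg.2 n _ hn).comp (hf.2 n x hn)⟩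

theorem freelyHomotopic_mapGenLoop {f g : C(X, Y)} (H : f.Homotopy g) {n : ℕ} {x : X}
    (γ : GenLoop (Fin n) X x) :
    FreelyHomotopic (H.evalAt x) (mapGenLoop f γ) (mapGenLoop g γ) :=
  ⟨H.compContinuousMap γ.1, fun s z hz => congrArg (fun w => H (s, w)) (γ.2 z hz)⟩

theorem IsWeakEquivalence.of_homotopic {f g : C(X, Y)} (h : f.Homotopic g)
    (hf : IsWeakEquivalence f) : IsWeakEquivalence g := by
  obtain ⟨H⟩ := h
  have joined (x : X) : Joined (f x) (g x) := ⟨H.evalAt x⟩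
  refine ⟨⟨(pi₀Map_injective_iff g).2 fun x y hxy => ?_, (pi₀Map_surjective_iff g).2 fun y => ?_⟩,
    fun n x hn => ⟨(piMap_injective_iff g n x).2 fun γ γ' hγ => ?_,
      (piMap_surjective_iff g n x).2 fun δ => ?_⟩⟩
  · exact (pi₀Map_injective_iff f).1 hf.1.1 x y ((joined x).trans (hxy.trans (joined y).symm))
  · obtain ⟨x, hx⟩ := (pi₀Map_surjective_iff f).1 hf.1.2 y
    exact ⟨x, (joined x).symm.trans hx⟩
  · exact (piMap_injective_iff f n x).1 (hf.2 n x hn).1 γ γ' <|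
      (freelyHomotopic_mapGenLoop H γ).symm.homotopic (freelyHomotopic_mapGenLoop H γ').symm hγ
  · obtain ⟨δ', hδ⟩ := exists_freelyHomotopic (H.evalAt x).symm δ
    obtain ⟨γ, hγ⟩ := (piMap_surjective_iff f n x).1 (hf.2 n x hn).2 δ'
    have hδ' := Path.symm_symm (H.evalAt x) ▸ hδ.symm
    exact ⟨γ, (freelyHomotopic_mapGenLoop H γ).homotopic hδ' hγ⟩

theorem isWeakEquivalence_of_homotopy_inverse {f : C(X, Y)} {g : C(Y, X)}
    (hgf : (g.comp f).Homotopic (ContinuousMap.id X))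
    (hfg : (f.comp g).Homotopic (ContinuousMap.id Y)) : IsWeakEquivalence f := by
  obtain ⟨hgf₀, hgfn⟩ := IsWeakEquivalence.id.of_homotopic hgf.symm
  obtain ⟨hfg₀, hfgn⟩ := IsWeakEquivalence.id.of_homotopic hfg.symm
  simp only [pi₀Map_comp, piMap_comp] at hgf₀ hgfn hfg₀ hfgn
  refine ⟨⟨hgf₀.1.of_comp, hfg₀.2.of_comp⟩, fun n x hn => ?_⟩
  have hg : Function.Bijective (piMap g n (f x)) :=
    ⟨(hfgn n (f x) hn).1.of_comp, (hgfn n x hn).2.of_comp⟩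
  exact (Function.Bijective.of_comp_iff' hg _).1 (hgfn n x hn)

theorem isWeakEquivalence_of_homotopyEquiv (e : ContinuousMap.HomotopyEquiv X Y) :
    IsWeakEquivalence e.toFun :=
  isWeakEquivalence_of_homotopy_inverse e.left_inv e.right_inv

theorem isWeakEquivalence_of_injective_of_compact_lift {f : C(X, Y)} (hf : Function.Injective f)
    (lift : ∀ (S : Type) [TopologicalSpace S] [CompactSpace S] (g : C(S, Y)),
      ∃ g' : C(S, X), f.comp g' = g) : IsWeakEquivalence f := by
  refine ⟨⟨(pi₀Map_injective_iff f).2 ?_, (pi₀Map_surjective_iff f).2 fun y => ?_⟩,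
    fun n x _ => ⟨(piMap_injective_iff f n x).2 ?_, (piMap_surjective_iff f n x).2 fun δ => ?_⟩⟩
  · rintro x y ⟨p⟩
    obtain ⟨q, hq⟩ := lift I p.toContinuousMap
    exact ⟨⟨q, hf ((DFunLike.congr_fun hq 0).trans p.source),
      hf ((DFunLike.congr_fun hq 1).trans p.target)⟩⟩
  · obtain ⟨q, hq⟩ := lift Unit (ContinuousMap.const _ y)
    exact ⟨q (), DFunLike.congr_fun hq () ▸ Joined.refl _⟩
  · rintro γ γ' ⟨H⟩
    obtain ⟨q, hq⟩ := lift (I × (Fin n → I)) H.toContinuousMap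
    exact ⟨{
      toContinuousMap := q
      map_zero_left := fun z => hf ((DFunLike.congr_fun hq _).trans (H.apply_zero z))
      map_one_left := fun z => hf ((DFunLike.congr_fun hq _).trans (H.apply_one z))
      prop' := fun t z hz => hf ((DFunLike.congr_fun hq _).trans (H.eq_fst t hz)) }⟩
  · obtain ⟨q, hq⟩ := lift (Fin n → I) δ.1
    obtain ⟨γ, rfl⟩ : ∃ γ, mapGenLoop f γ = δ :=
      ⟨⟨q, fun z hz => hf ((DFunLike.congr_fun hq z).trans (δ.2 z hz))⟩, Subtype.ext hq⟩
    exact ⟨γ, GenLoop.Homotopic.refl _⟩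

end WeakEquivalence

/-! ### Points of geometric realizations -/

section Subdivision

/-- The partial sums `f 0 + ⋯ + f j`. The partial sums of the barycentric coordinates of a point of
a simplex are breakpoints of a subdivision of `[0, 1]`, on which monotone maps act by merging
intervals. -/
def partialSum {n : ℕ} (f : Fin (n + 1) → ℝ) (j : Fin (n + 1)) : ℝ :=
  ∑ k ∈ Finset.Iic j, f k

theorem partialSum_zero {n : ℕ} (f : Fin (n + 1) → ℝ) : partialSum f 0 = f 0 := by
  rw [partialSum, ← bot_eq_zero, Finset.Iic_bot, Finset.sum_singleton]

theorem partialSum_succ {n : ℕ} (f : Fin (n + 1) → ℝ) (j : Fin n) :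
    partialSum f j.succ = partialSum f j.castSucc + f j.succ := by
  have h : Finset.Iic j.succ = insert j.succ (Finset.Iic j.castSucc) := by
    ext k
    simp only [Finset.mem_insert, Finset.mem_Iic, Fin.le_def, Fin.ext_iff, Fin.val_succ,
      Fin.val_castSucc]
    lia
  rw [partialSum, h, Finset.sum_insert (by simp [Fin.le_def]), add_comm, partialSum]

theorem partialSum_injective {n : ℕ} :
    Function.Injective (partialSum : (Fin (n + 1) → ℝ) → Fin (n + 1) → ℝ) := by
  intro f g h
  funext j
  induction j using Fin.cases with
  | zero => rw [← partialSum_zero f, h, partialSum_zero]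
  | succ j =>
    have hj := congrFun h j.succ
    rwa [partialSum_succ, partialSum_succ, h, add_right_inj] at hj

theorem partialSum_surjective {n : ℕ} :
    Function.Surjective (partialSum : (Fin (n + 1) → ℝ) → Fin (n + 1) → ℝ) := by
  intro s
  refine ⟨Fin.cases (s 0) fun a => s a.succ - s a.castSucc, funext fun j => ?_⟩
  induction j using Fin.induction with
  | zero => rw [partialSum_zero, Fin.cases_zero]
  | succ j hj => rw [partialSum_succ, hj, Fin.cases_succ, add_sub_cancel]

theorem partialSum_last {n : ℕ} (t : stdSimplex ℝ (Fin (n + 1))) :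
    partialSum t (Fin.last n) = 1 := by
  rw [partialSum, ← Fin.top_eq_last, Finset.Iic_top]
  exact stdSimplex.sum_eq_one t

theorem partialSum_mono {n : ℕ} (t : stdSimplex ℝ (Fin (n + 1))) : Monotone (partialSum t) :=
  fun _ _ h => Finset.sum_le_sum_of_subset_of_nonneg (Finset.Iic_subset_Iic.2 h)
    fun k _ _ => stdSimplex.zero_le t k

theorem partialSum_strictMono {n : ℕ} {t : stdSimplex ℝ (Fin (n + 1))} (ht : ∀ a, 0 < t a) :
    StrictMono (partialSum t) :=
  fun _ b h => Finset.sum_lt_sum_of_subset (Finset.Iic_subset_Iic.2 h.le) (Finset.mem_Iic.2 le_rfl)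
    (by simpa only [Finset.mem_Iic, not_le] using h) (ht b) fun k _ _ => (ht k).le

theorem partialSum_map {l n : ℕ} (f : Fin (l + 1) → Fin (n + 1))
    (r : stdSimplex ℝ (Fin (l + 1))) (j : Fin (n + 1)) :
    partialSum (stdSimplex.map f r) j = ∑ a with f a ≤ j, r a := by
  classical
  simp only [partialSum, stdSimplex.map_coe, FunOnFinite.linearMap_apply_apply,
    Finset.sum_fiberwise_eq_sum_filter, Finset.mem_Iic]

theorem exists_partialSum_eq {l : ℕ} {s : Fin (l + 1) → ℝ} (hs : StrictMono s) (h₀ : 0 < s 0)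
    (h₁ : s (Fin.last l) = 1) :
    ∃ r : stdSimplex ℝ (Fin (l + 1)), (∀ a, 0 < r a) ∧ partialSum r = s := by
  obtain ⟨d, rfl⟩ := partialSum_surjective s
  have d_pos (a : Fin (l + 1)) : 0 < d a := by
    induction a using Fin.cases with
    | zero => rwa [← partialSum_zero d]
    | succ a => simpa only [partialSum_succ, lt_add_iff_pos_right] using hs a.castSucc_lt_succ
  rw [partialSum, ← Fin.top_eq_last, Finset.Iic_top] at h₁
  exact ⟨⟨d, fun a => (d_pos a).le, h₁⟩, d_pos, rfl⟩

theorem exists_range_partialSum_eq {S : Finset ℝ} (hS : ↑S ⊆ Set.Ioc (0 : ℝ) 1) (h₁ : 1 ∈ S) :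
    ∃ (l : ℕ) (r : stdSimplex ℝ (Fin (l + 1))),
      S.card = l + 1 ∧ (∀ a, 0 < r a) ∧ Set.range (partialSum r) = S := by
  obtain ⟨l, hl⟩ := Nat.exists_eq_succ_of_ne_zero (Finset.card_pos.2 ⟨1, h₁⟩).ne'
  let s := S.orderEmbOfFin hl
  have range_s : Set.range s = S := Finset.range_orderEmbOfFin S hl
  have s_mem (a) : s a ∈ Set.Ioc (0 : ℝ) 1 := hS (Finset.orderEmbOfFin_mem S hl a)
  have s_last : s (Fin.last l) = 1 := by
    obtain ⟨a, ha⟩ := range_s.ge h₁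
    exact (s_mem _).2.antisymm (ha ▸ s.monotone (Fin.le_last a))
  obtain ⟨r, r_pos, hr⟩ := exists_partialSum_eq s.strictMono (s_mem 0).1 s_last
  exact ⟨l, r, hl, r_pos, hr ▸ range_s⟩

theorem exists_map_eq_of_partialSum_mem_range {l m : ℕ} {r : stdSimplex ℝ (Fin (l + 1))}
    (hr : ∀ a, 0 < r a) (t : stdSimplex ℝ (Fin (m + 1)))
    (ht : ∀ j, 0 < partialSum t j → partialSum t j ∈ Set.range (partialSum r)) :
    ∃ θ : Fin (l + 1) →o Fin (m + 1), stdSimplex.map θ r = t := by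
  have exists_le (a) : ∃ j, partialSum r a ≤ partialSum t j :=
    ⟨Fin.last _, by
      rw [partialSum_last, ← partialSum_last r]
      exact partialSum_mono r (Fin.le_last a)⟩
  let θ (a : Fin (l + 1)) : Fin (m + 1) := Fin.find _ (exists_le a)
  have θ_le_iff (a j) : θ a ≤ j ↔ partialSum r a ≤ partialSum t j :=
    ⟨fun h => (Fin.find_spec (exists_le a)).trans (partialSum_mono t h),
      fun h => Fin.find_le_of_pos (exists_le a) h⟩
  have θ_mono : Monotone θ := fun a b hab =>
    (θ_le_iff a _).2 ((partialSum_mono r hab).trans ((θ_le_iff b _).1 le_rfl))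
  refine ⟨⟨θ, θ_mono⟩, stdSimplex.ext (partialSum_injective (funext fun j => ?_))⟩
  rw [partialSum_map]
  simp only [OrderHom.coe_mk, θ_le_iff]
  have zero_le : 0 ≤ partialSum t j := Finset.sum_nonneg fun k _ => stdSimplex.zero_le t k
  obtain hj | hj := zero_le.eq_or_lt
  · have r_zero_le (a) : r 0 ≤ partialSum r a :=
      partialSum_zero r ▸ partialSum_mono r (Fin.zero_le a)
    rw [← hj, Finset.sum_eq_zero]
    intro a ha
    exact absurd ((hr 0).trans_le (r_zero_le a)) (not_lt.2 (Finset.mem_filter.1 ha).2)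
  · obtain ⟨b, hb⟩ := ht j hj
    simp only [← hb, (partialSum_strictMono hr).le_iff_le]
    exact Finset.sum_congr (by ext; simp) fun _ _ => rfl

theorem exists_common_subdivision {ι : Type*} [Fintype ι] (m : ι → ℕ)
    (t : ∀ i, stdSimplex ℝ (Fin (m i + 1))) :
    ∃ (l : ℕ) (r : stdSimplex ℝ (Fin (l + 1))) (θ : ∀ i, Fin (l + 1) →o Fin (m i + 1)),
      l ≤ ∑ i, (m i + 1) ∧ (∀ a, 0 < r a) ∧ ∀ i, stdSimplex.map (θ i) r = t i := by
  classical
  let T : Finset ℝ := Finset.univ.image fun x : Σ i, Fin (m i + 1) => partialSum (t x.1) x.2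
  let S : Finset ℝ := insert 1 {c ∈ T | 0 < c}
  have mem_T (i j) : partialSum (t i) j ∈ T :=
    Finset.mem_image.2 ⟨⟨i, j⟩, Finset.mem_univ _, rfl⟩
  have T_le_one : ∀ c ∈ T, c ≤ 1 := by
    intro c hc
    obtain ⟨⟨i, j⟩, -, rfl⟩ := Finset.mem_image.1 hc
    exact (partialSum_mono _ (Fin.le_last j)).trans (partialSum_last _).le
  have S_subset : ↑S ⊆ Set.Ioc (0 : ℝ) 1 := by
    intro c hc
    obtain rfl | hc := Finset.mem_insert.1 hc
    · exact ⟨one_pos, le_rfl⟩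
    · exact ⟨(Finset.mem_filter.1 hc).2, T_le_one c (Finset.mem_filter.1 hc).1⟩
  have S_card : S.card ≤ ∑ i, (m i + 1) + 1 :=
    calc S.card ≤ T.card + 1 :=
          (Finset.card_insert_le _ _).trans (Nat.succ_le_succ (Finset.card_filter_le _ _))
      _ ≤ Fintype.card (Σ i, Fin (m i + 1)) + 1 := Nat.succ_le_succ Finset.card_image_le
      _ = ∑ i, (m i + 1) + 1 := by simp only [Fintype.card_sigma, Fintype.card_fin]
  obtain ⟨l, r, hl, r_pos, range_r⟩ :=
    exists_range_partialSum_eq S_subset (Finset.mem_insert_self _ _)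
  choose θ hθ using fun i => exists_map_eq_of_partialSum_mem_range r_pos (t i) fun j hj =>
    range_r.ge (Finset.mem_insert_of_mem (Finset.mem_filter.2 ⟨mem_T i j, hj⟩))
  exact ⟨l, r, θ, by lia, r_pos, hθ⟩

theorem stdSimplex_map_le_of_map_eq {l m : ℕ} {r : stdSimplex ℝ (Fin (l + 1))}
    (hr : ∀ a, 0 < r a) {θ φ : Fin (l + 1) →o Fin (m + 1)}
    (h : stdSimplex.map θ r = stdSimplex.map φ r) : θ ≤ φ := by
  classical
  intro a
  by_contra hlt
  have hsum := congrArg (fun t : stdSimplex ℝ (Fin (m + 1)) => partialSum t (φ a)) h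
  simp only [partialSum_map] at hsum
  refine ne_of_lt ?_ hsum
  refine Finset.sum_lt_sum_of_subset (i := a) ?_ (by simp) (by simpa using hlt) (hr a)
    fun b _ _ => (hr b).le
  intro b hb
  simp only [Finset.mem_filter, Finset.mem_univ, true_and] at hb ⊢
  rcases le_total a b with hab | hab
  · exact absurd ((θ.monotone hab).trans hb) hlt
  · exact φ.monotone hab

end Subdivision

section TopSimplex

/-- The standard topological simplex. -/
abbrev TopSimplex (n : SimplexCategory) : Type := stdSimplex ℝ (Fin (n.len + 1))

instance (n : SimplexCategory) : CompactSpace (TopSimplex n) :=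
  isCompact_iff_compactSpace.1 (isCompact_stdSimplex ℝ _)

/-- The effect of simplicial operators on standard topological simplices. -/
noncomputable def push {n m : SimplexCategory} (f : n ⟶ m) : C(TopSimplex n, TopSimplex m) :=
  ⟨stdSimplex.map f, stdSimplex.continuous_map f⟩

theorem push_comp {n m l : SimplexCategory} (f : n ⟶ m) (g : m ⟶ l) (t : TopSimplex n) :
    push (f ≫ g) t = push g (push f t) :=
  (stdSimplex.map_comp_apply f g t).symm

theorem push_id {n : SimplexCategory} (t : TopSimplex n) : push (𝟙 n) t = t :=
  stdSimplex.map_id_apply t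

theorem eq_of_push_eq {n m : SimplexCategory} {r : TopSimplex n} (hr : ∀ a, 0 < r a)
    {θ φ : n ⟶ m} (h : push θ r = push φ r) : θ = φ :=
  SimplexCategory.Hom.ext _ _
    ((stdSimplex_map_le_of_map_eq hr h).antisymm (stdSimplex_map_le_of_map_eq hr h.symm))

theorem epi_of_push_pos {n m : SimplexCategory} {t : TopSimplex n} {f : n ⟶ m}
    (h : ∀ b, 0 < push f t b) : Epi f := by
  classical
  refine SimplexCategory.epi_iff_surjective.2 fun b => ?_
  have hsum : push f t b = ∑ a with f a = b, t a := FunOnFinite.linearMap_apply_apply ..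
  obtain ⟨a, ha, -⟩ := Finset.exists_ne_zero_of_sum_ne_zero (hsum ▸ (h b).ne')
  exact ⟨a, (Finset.mem_filter.1 ha).2⟩

theorem exists_common_push {ι : Type*} [Fintype ι] {n : ι → SimplexCategory}
    (t : ∀ i, TopSimplex (n i)) :
    ∃ (l : SimplexCategory) (r : TopSimplex l) (θ : ∀ i, l ⟶ n i),
      l.len ≤ ∑ i, ((n i).len + 1) ∧ (∀ a, 0 < r a) ∧ ∀ i, push (θ i) r = t i := by
  obtain ⟨l, r, θ, hl, hr, hθ⟩ := exists_common_subdivision (fun i => (n i).len) t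
  exact ⟨SimplexCategory.mk l, r, fun i => SimplexCategory.Hom.mk (θ i), hl, hr, hθ⟩

theorem exists_common_push₂ {n m : SimplexCategory} (t : TopSimplex n) (s : TopSimplex m) :
    ∃ (l : SimplexCategory) (r : TopSimplex l) (θ : l ⟶ n) (φ : l ⟶ m),
      l.len ≤ n.len + 1 + (m.len + 1) ∧ (∀ a, 0 < r a) ∧ push θ r = t ∧ push φ r = s := by
  obtain ⟨l, r, θ, hl, hr, h⟩ := exists_common_push (n := fun b => bif b then n else m)
    fun | true => t | false => s
  rw [Fintype.sum_bool] at hl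
  exact ⟨l, r, θ true, θ false, hl, hr, h true, h false⟩

theorem exists_push_eq {n : SimplexCategory} (t : TopSimplex n) :
    ∃ (l : SimplexCategory) (r : TopSimplex l) (θ : l ⟶ n),
      l.len ≤ n.len + 1 ∧ (∀ a, 0 < r a) ∧ push θ r = t := by
  obtain ⟨l, r, θ, hl, hr, h⟩ := exists_common_push fun _ : Unit => t
  rw [Fintype.sum_unique] at hl
  exact ⟨l, r, θ (), hl, hr, h ()⟩

end TopSimplex

section Realization

variable {K : SSet.{u}}

theorem map_op_comp {n m l : SimplexCategory} (f : n ⟶ m) (g : m ⟶ l) (x : K.obj (op l)) :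
    K.map (f ≫ g).op x = K.map f.op (K.map g.op x) :=
  K.map_comp_apply g.op f.op x

theorem map_op_id {n : SimplexCategory} (x : K.obj (op n)) : K.map (𝟙 n).op x = x :=
  K.map_id_apply _ x

/-- The characteristic map of a simplex of a geometric realization. -/
noncomputable def charMap {n : SimplexCategory} (x : K.obj (op n)) :
    C(TopSimplex n, SSet.toTop.obj K) :=
  (SSet.toTop.map (SSet.yonedaEquiv.symm x)).hom.comp
    (⟨n.toTopHomeo.symm, n.toTopHomeo.symm.continuous⟩ :
      C(TopSimplex n, SSet.toTop.obj (SSet.stdSimplex.obj n)))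

theorem toTop_map_charMap {L : SSet.{u}} (f : K ⟶ L) {n : SimplexCategory} (x : K.obj (op n))
    (t : TopSimplex n) : SSet.toTop.map f (charMap x t) = charMap (f.app _ x) t := by
  have hx : SSet.yonedaEquiv.symm x ≫ f = SSet.yonedaEquiv.symm (f.app _ x) := by
    apply SSet.yonedaEquiv.injective
    rw [SSet.yonedaEquiv_comp, Equiv.apply_symm_apply, Equiv.apply_symm_apply]
  change _ = SSet.toTop.map (SSet.yonedaEquiv.symm (f.app _ x)) _
  rw [← hx, Functor.map_comp]
  rfl

theorem charMap_map {n m : SimplexCategory} (f : n ⟶ m) (x : K.obj (op m)) (t : TopSimplex n) :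
    charMap (K.map f.op x) t = charMap x (push f t) := by
  have hx : SSet.yonedaEquiv.symm (K.map f.op x) =
      SSet.stdSimplex.map f ≫ SSet.yonedaEquiv.symm x := by
    apply SSet.yonedaEquiv.injective
    rw [SSet.yonedaEquiv_comp, Equiv.apply_symm_apply, SSet.yonedaEquiv_map]
    exact (SSet.yonedaEquiv_symm_app_objEquiv_symm x f).symm
  change SSet.toTop.map (SSet.yonedaEquiv.symm (K.map f.op x)) _ = _
  rw [hx, Functor.map_comp]
  exact congrArg (SSet.toTop.map (SSet.yonedaEquiv.symm x))
    (SimplexCategory.toTopHomeo_symm_naturality_apply f t).symm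

theorem homEquiv_app_apply {Z : TopCat.{u}} (g : SSet.toTop.obj K ⟶ Z) {n : SimplexCategory}
    (x : K.obj (op n)) (t : TopSimplex n) :
    TopCat.toSSetObjEquiv Z (op n) ((sSetTopAdj.homEquiv K Z g).app (op n) x) t =
      g (charMap x t) := by
  have hx := sSetTopAdj_unit_app_app_down K (op n) x
  rw [Adjunction.homEquiv_unit]
  change (((sSetTopAdj.unit.app K).app (op n) x).down ≫ g) _ = _
  rw [hx]
  rfl

theorem toTop_hom_ext {Z : TopCat.{u}} {g g' : SSet.toTop.obj K ⟶ Z}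
    (h : ∀ {n : SimplexCategory} (x : K.obj (op n)) (t : TopSimplex n),
      g (charMap x t) = g' (charMap x t)) : g = g' := by
  apply (sSetTopAdj.homEquiv K Z).injective
  ext ⟨n⟩ x
  apply (TopCat.toSSetObjEquiv Z (op n)).injective
  ext t
  exact (homEquiv_app_apply g x t).trans ((h x t).trans (homEquiv_app_apply g' x t).symm)

/-- The map from a geometric realization defined by a compatible family of maps from standard
simplices. -/
noncomputable def toTopDesc {Z : TopCat.{u}}
    (c : ∀ {n : SimplexCategory}, K.obj (op n) → C(TopSimplex n, Z))
    (hc : ∀ {n m : SimplexCategory} (f : n ⟶ m) (x : K.obj (op m)) (t : TopSimplex n),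
      c (K.map f.op x) t = c x (push f t)) : SSet.toTop.obj K ⟶ Z :=
  (sSetTopAdj.homEquiv K Z).symm
    { app := fun n => TypeCat.ofHom fun x => (TopCat.toSSetObjEquiv Z n).symm (c x)
      naturality := fun ⟨_⟩ ⟨n⟩ f => by
        ext x
        apply (TopCat.toSSetObjEquiv Z (op n)).injective
        ext t
        exact hc f.unop x t }

theorem toTopDesc_charMap {Z : TopCat.{u}}
    (c : ∀ {n : SimplexCategory}, K.obj (op n) → C(TopSimplex n, Z))
    (hc : ∀ {n m : SimplexCategory} (f : n ⟶ m) (x : K.obj (op m)) (t : TopSimplex n),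
      c (K.map f.op x) t = c x (push f t)) {n : SimplexCategory} (x : K.obj (op n))
    (t : TopSimplex n) : toTopDesc c hc (charMap x t) = c x t := by
  rw [← homEquiv_app_apply, toTopDesc, Equiv.apply_symm_apply]
  rfl

variable (K)

/-- Pairs of a simplex and a point of the corresponding standard simplex. -/
abbrev RealizationPoint : Type u := Σ n : SimplexCategory, K.obj (op n) × TopSimplex n

variable {K}

/-- The relation describing equality in the geometric realization: both points are obtained from a
point of one simplex by applying simplicial operators. -/
def RealizationRel (p q : RealizationPoint K) : Prop :=
  ∃ (l : SimplexCategory) (r : TopSimplex l) (θ : l ⟶ p.1) (φ : l ⟶ q.1),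
    K.map θ.op p.2.1 = K.map φ.op q.2.1 ∧ push θ r = p.2.2 ∧ push φ r = q.2.2

theorem RealizationRel.trans {p q s : RealizationPoint K} (hpq : RealizationRel p q)
    (hqs : RealizationRel q s) : RealizationRel p s := by
  obtain ⟨l, r, θ, φ, hθφ, hθ, hφ⟩ := hpq
  obtain ⟨l', r', θ', φ', hθφ', hθ', hφ'⟩ := hqs
  obtain ⟨k, v, α, β, -, hv, hα, hβ⟩ := exists_common_push₂ r r'
  have e : α ≫ φ = β ≫ θ' := eq_of_push_eq hv (by
    rw [push_comp, push_comp, hα, hβ, hφ, hθ'])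
  refine ⟨k, v, α ≫ θ, β ≫ φ', ?_, ?_, ?_⟩
  · rw [map_op_comp, hθφ, ← map_op_comp, e, map_op_comp, hθφ', ← map_op_comp]
  · rw [push_comp, hα, hθ]
  · rw [push_comp, hβ, hφ']

variable (K) in
/-- The setoid whose quotient is the geometric realization. -/
def realizationSetoid : Setoid (RealizationPoint K) where
  r := RealizationRel
  iseqv :=
    { refl := fun p => ⟨p.1, p.2.2, 𝟙 _, 𝟙 _, rfl, push_id _, push_id _⟩
      symm := fun ⟨l, r, θ, φ, hθφ, hθ, hφ⟩ => ⟨l, r, φ, θ, hθφ.symm, hφ, hθ⟩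
      trans := RealizationRel.trans }

-- The sets of simplices are discrete.
instance : TopologicalSpace (Quotient (realizationSetoid K)) :=
  letI (n : SimplexCategory) : TopologicalSpace (K.obj (op n)) := ⊥
  inferInstanceAs (TopologicalSpace (Quotient (realizationSetoid K)))

theorem continuous_realizationSetoid_mk {n : SimplexCategory} (x : K.obj (op n)) :
    Continuous fun t : TopSimplex n => Quotient.mk (realizationSetoid K) ⟨n, x, t⟩ := by
  let (n : SimplexCategory) : TopologicalSpace (K.obj (op n)) := ⊥
  exact continuous_quotient_mk'.comp (continuous_sigmaMk.comp (Continuous.prodMk_right x))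

theorem continuous_of_comp_realizationSetoid_mk {Z : Type*} [TopologicalSpace Z]
    {f : Quotient (realizationSetoid K) → Z}
    (hf : ∀ {n : SimplexCategory} (x : K.obj (op n)),
      Continuous fun t : TopSimplex n => f (Quotient.mk (realizationSetoid K) ⟨n, x, t⟩)) :
    Continuous f := by
  let (n : SimplexCategory) : TopologicalSpace (K.obj (op n)) := ⊥
  have (n : SimplexCategory) : DiscreteTopology (K.obj (op n)) := ⟨rfl⟩
  exact isQuotientMap_quotient_mk'.continuous_iff.2 <|
    continuous_sigma fun n => continuous_prod_of_discrete_left.2 hf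

variable (K) in
/-- The comparison map from the geometric realization to the space of equivalence classes of pairs
of a simplex and a point of the corresponding standard simplex. -/
noncomputable def toRealizationQuotient :
    SSet.toTop.obj K ⟶ TopCat.of (Quotient (realizationSetoid K)) :=
  toTopDesc (fun {n} x => ⟨fun t => ⟦⟨n, x, t⟩⟧, continuous_realizationSetoid_mk x⟩)
    fun {n _} f x t => Quotient.sound ⟨n, t, 𝟙 n, f, by rw [map_op_id], push_id _, rfl⟩

theorem toRealizationQuotient_charMap {n : SimplexCategory} (x : K.obj (op n))
    (t : TopSimplex n) :
    toRealizationQuotient K (charMap x t) = Quotient.mk (realizationSetoid K) ⟨n, x, t⟩ :=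
  toTopDesc_charMap (Z := TopCat.of (Quotient (realizationSetoid K)))
    (fun x => ⟨_, continuous_realizationSetoid_mk x⟩)
    (fun f x t => Quotient.sound ⟨_, t, 𝟙 _, f, by rw [map_op_id], push_id _, rfl⟩) x t

variable (K) in
/-- The inverse of `toRealizationQuotient`. -/
noncomputable def ofRealizationQuotient :
    C(Quotient (realizationSetoid K), SSet.toTop.obj K) where
  toFun := Quotient.lift (fun p => charMap p.2.1 p.2.2) (by
    rintro ⟨n, x, t⟩ ⟨m, y, s⟩ ⟨l, r, θ, φ, hθφ, hθ, hφ⟩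
    dsimp only at hθφ hθ hφ ⊢
    rw [← hθ, ← hφ, ← charMap_map, ← charMap_map, hθφ])
  continuous_toFun := continuous_of_comp_realizationSetoid_mk fun x => (charMap x).continuous

variable (K) in
/-- The geometric realization as a space of equivalence classes of pairs of a simplex and a point
of the corresponding standard simplex. -/
noncomputable def realizationHomeo : SSet.toTop.obj K ≃ₜ Quotient (realizationSetoid K) where
  toFun := toRealizationQuotient K
  invFun := ofRealizationQuotient K
  left_inv := fun z => by
    have h : toRealizationQuotient K ≫ TopCat.ofHom (ofRealizationQuotient K) = 𝟙 _ :=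
      toTop_hom_ext fun x t =>
        congrArg (ofRealizationQuotient K) (toRealizationQuotient_charMap x t)
    exact ConcreteCategory.congr_hom h z
  right_inv := Quotient.ind fun ⟨_, x, t⟩ => toRealizationQuotient_charMap x t
  continuous_toFun := (toRealizationQuotient K).hom.continuous
  continuous_invFun := (ofRealizationQuotient K).continuous

theorem realizationHomeo_charMap {n : SimplexCategory} (x : K.obj (op n)) (t : TopSimplex n) :
    realizationHomeo K (charMap x t) = Quotient.mk (realizationSetoid K) ⟨n, x, t⟩ :=
  toRealizationQuotient_charMap x t

theorem charMap_eq_iff {n m : SimplexCategory} {x : K.obj (op n)} {y : K.obj (op m)}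
    {t : TopSimplex n} {s : TopSimplex m} :
    charMap x t = charMap y s ↔
      RealizationRel (⟨n, x, t⟩ : RealizationPoint K) ⟨m, y, s⟩ := by
  rw [← (realizationHomeo K).injective.eq_iff, realizationHomeo_charMap, realizationHomeo_charMap]
  exact Quotient.eq (r := realizationSetoid K)

theorem exists_charMap_eq (z : SSet.toTop.obj K) :
    ∃ (n : SimplexCategory) (x : K.obj (op n)) (t : TopSimplex n),
      (∀ a, 0 < t a) ∧ charMap x t = z := by
  obtain ⟨⟨n, x, t⟩, hz⟩ := Quotient.exists_rep (realizationHomeo K z)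
  obtain ⟨l, r, θ, -, hr, rfl⟩ := exists_push_eq t
  refine ⟨l, K.map θ.op x, r, hr, (realizationHomeo K).injective ?_⟩
  rw [charMap_map, realizationHomeo_charMap, hz]

theorem continuous_toTop_iff {Z : Type*} [TopologicalSpace Z] {f : SSet.toTop.obj K → Z} :
    Continuous f ↔ ∀ {n : SimplexCategory} (x : K.obj (op n)), Continuous (f ∘ charMap x) := by
  refine ⟨fun hf n x => hf.comp (charMap x).continuous, fun hf => ?_⟩
  rw [← (realizationHomeo K).symm.comp_continuous_iff']
  refine continuous_of_comp_realizationSetoid_mk fun {n} x => (hf x).congr fun t => ?_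
  rw [← realizationHomeo_charMap]
  exact congrArg f ((realizationHomeo K).symm_apply_apply _).symm

theorem isClosed_toTop_iff {C : Set (SSet.toTop.obj K)} :
    IsClosed C ↔ ∀ {n : SimplexCategory} (x : K.obj (op n)), IsClosed (charMap x ⁻¹' C) := by
  rw [← isOpen_compl_iff]
  refine continuous_Prop.symm.trans (continuous_toTop_iff (K := K) (f := (· ∉ C)) |>.trans ?_)
  exact forall₂_congr fun n x => continuous_Prop.trans isOpen_compl_iff

end Realization

/-! ### The topology of geometric realizations -/

section RealizationTopology

variable {K : SSet.{u}}

theorem map_eq_of_charMap_push_eq {n m k : SimplexCategory} {x : K.obj (op n)} {y : K.obj (op m)}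
    {v : TopSimplex k} (hv : ∀ a, 0 < v a) {θ : k ⟶ n} {φ : k ⟶ m}
    (h : charMap x (push θ v) = charMap y (push φ v)) : K.map θ.op x = K.map φ.op y := by
  obtain ⟨l, r, θ', φ', hxy, hθ', hφ'⟩ := charMap_eq_iff.1 h
  dsimp only at θ' φ' hxy hθ' hφ'
  obtain ⟨j, w, α, β, -, hw, hα, hβ⟩ := exists_common_push₂ r v
  have hθ : β ≫ θ = α ≫ θ' := eq_of_push_eq hw (by rw [push_comp, push_comp, hα, hβ, hθ'])
  have hφ : β ≫ φ = α ≫ φ' := eq_of_push_eq hw (by rw [push_comp, push_comp, hα, hβ, hφ'])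
  have : Epi β := epi_of_push_pos (t := w) (by rwa [hβ])
  have : IsSplitEpi β := isSplitEpi_of_epi β
  have hβ_section : section_ β ≫ β = 𝟙 k := IsSplitEpi.id β
  calc K.map θ.op x = K.map (section_ β).op (K.map (β ≫ θ).op x) := by
        rw [← map_op_comp, ← Category.assoc, hβ_section, Category.id_comp]
    _ = K.map (section_ β).op (K.map (β ≫ φ).op y) := by
        rw [hθ, hφ, map_op_comp, map_op_comp, hxy]
    _ = K.map φ.op y := by rw [← map_op_comp, ← Category.assoc, hβ_section, Category.id_comp]

theorem isClosedMap_charMap {n : SimplexCategory} (x : K.obj (op n)) :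
    IsClosedMap (charMap x) := by
  intro C hC
  refine isClosed_toTop_iff.2 fun {m} y => ?_
  let Span := Σ l : Fin (n.len + 1 + (m.len + 1) + 1),
    (SimplexCategory.mk l ⟶ n) × (SimplexCategory.mk l ⟶ m)
  have preimage_image : charMap y ⁻¹' (charMap x '' C) =
      ⋃ i : {i : Span // K.map i.2.1.op x = K.map i.2.2.op y},
        push i.1.2.2 '' (push i.1.2.1 ⁻¹' C) := by
    ext s
    simp only [Set.mem_preimage, Set.mem_image, Set.mem_iUnion]
    constructor
    · rintro ⟨t, ht, hts⟩
      obtain ⟨l, v, θ, φ, hl, hv, rfl, rfl⟩ := exists_common_push₂ t s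
      exact ⟨⟨⟨⟨l.len, Nat.lt_succ_of_le hl⟩, θ, φ⟩, map_eq_of_charMap_push_eq hv hts⟩, v, ht, rfl⟩
    · rintro ⟨⟨⟨l, θ, φ⟩, h⟩, v, hv, rfl⟩
      exact ⟨push θ v, hv, by rw [← charMap_map, ← charMap_map, h]⟩
  rw [preimage_image]
  exact isClosed_iUnion_of_finite fun i =>
    ((hC.preimage (push i.1.2.1).continuous).isCompact.image (push i.1.2.2).continuous).isClosed

instance (K : SSet.{u}) : T1Space (SSet.toTop.obj K) where
  t1 z := by
    obtain ⟨n, x, t, -, rfl⟩ := exists_charMap_eq z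
    rw [← Set.image_singleton]
    exact isClosedMap_charMap x _ isClosed_singleton

theorem isProperMap_charMap {n : SimplexCategory} (x : K.obj (op n)) :
    IsProperMap (charMap x) :=
  isProperMap_iff_isClosedMap_and_compact_fibers.2 ⟨(charMap x).continuous,
    isClosedMap_charMap x, fun _ => (isClosed_singleton.preimage (charMap x).continuous).isCompact⟩

open SSet.Subcomplex in
theorem ofSimplex_eq_of_charMap_eq {n m : SimplexCategory} {x : K.obj (op n)} {y : K.obj (op m)}
    {t : TopSimplex n} {s : TopSimplex m} (ht : ∀ a, 0 < t a) (hs : ∀ a, 0 < s a)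
    (h : charMap x t = charMap y s) : ofSimplex (n := n.len) x = ofSimplex (n := m.len) y := by
  obtain ⟨l, v, θ, φ, -, hv, rfl, rfl⟩ := exists_common_push₂ t s
  have : Epi θ := epi_of_push_pos ht
  have : Epi φ := epi_of_push_pos hs
  calc ofSimplex (n := n.len) x = ofSimplex (n := l.len) (K.map θ.op x) :=
        (ofSimplex_map_of_epi (n := l.len) (m := n.len) θ x).symm
    _ = ofSimplex (n := l.len) (K.map φ.op y) := by rw [map_eq_of_charMap_push_eq hv h]
    _ = ofSimplex (n := m.len) y := ofSimplex_map_of_epi (n := l.len) (m := m.len) φ y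

/-- The subcomplex generated by the simplices having a given point of the geometric realization in
their interior. -/
noncomputable def carrier (z : SSet.toTop.obj K) : K.Subcomplex :=
  SSet.Subcomplex.ofSimplex (exists_charMap_eq z).choose_spec.choose

theorem carrier_charMap {n : SimplexCategory} (x : K.obj (op n)) {t : TopSimplex n}
    (ht : ∀ a, 0 < t a) :
    carrier (charMap x t) = SSet.Subcomplex.ofSimplex (n := n.len) x := by
  obtain ⟨hs, h⟩ := (exists_charMap_eq (charMap x t)).choose_spec.choose_spec.choose_spec
  exact ofSimplex_eq_of_charMap_eq hs ht h

theorem mem_range_charMap_of_carrier_le {n : SimplexCategory} {x : K.obj (op n)}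
    {z : SSet.toTop.obj K} (h : carrier z ≤ SSet.Subcomplex.ofSimplex (n := n.len) x) :
    z ∈ Set.range (charMap x) := by
  obtain ⟨m, y, t, ht, rfl⟩ := exists_charMap_eq z
  rw [carrier_charMap y ht] at h
  obtain ⟨f, rfl⟩ := h _ (SSet.Subcomplex.mem_ofSimplex_obj (n := m.len) y)
  exact ⟨push f.unop t, (charMap_map f.unop x t).symm⟩

theorem finite_image_carrier_range_charMap {n : SimplexCategory} (x : K.obj (op n)) :
    (carrier '' Set.range (charMap x)).Finite := by
  let Operator := Σ l : Fin (n.len + 1 + 1), (SimplexCategory.mk l ⟶ n)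
  refine (Set.finite_range fun i : Operator =>
    SSet.Subcomplex.ofSimplex (K.map i.2.op x)).subset ?_
  rintro _ ⟨_, ⟨t, rfl⟩, rfl⟩
  obtain ⟨l, r, δ, hl, hr, rfl⟩ := exists_push_eq t
  exact ⟨⟨⟨l.len, Nat.lt_succ_of_le hl⟩, δ⟩, by rw [← charMap_map, carrier_charMap _ hr]⟩

theorem finite_image_carrier_of_isCompact {C : Set (SSet.toTop.obj K)} (hC : IsCompact C) :
    (carrier '' C).Finite := by
  by_contra hinf
  obtain ⟨T, hTC, hT⟩ := Set.SurjOn.exists_bijOn_subset (Set.surjOn_image carrier C)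
  have hT_inf : T.Infinite := fun h => hinf (hT.image_eq ▸ h.image carrier)
  obtain ⟨a, -, ha⟩ := hT_inf.exists_accPt_of_subset_isCompact hC hTC
  -- `T` meets every simplex in a finite set, so that all its subsets are closed.
  have hT_closed : IsClosed (T \ {a}) := by
    refine isClosed_toTop_iff.2 fun {n} x => ?_
    rw [← Set.preimage_inter_range]
    refine IsClosed.preimage (charMap x).continuous (Set.Finite.isClosed ?_)
    refine Set.Finite.of_finite_image ((finite_image_carrier_range_charMap x).subset
      (Set.image_mono Set.inter_subset_right)) (hT.injOn.mono ?_)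
    exact fun z hz => hz.1.1
  rw [accPt_principal_iff_clusterPt, ← mem_closure_iff_clusterPt, hT_closed.closure_eq] at ha
  exact ha.2 rfl

theorem exists_finite_cover_of_isCompact {C : Set (SSet.toTop.obj K)} (hC : IsCompact C) :
    ∃ F : Set (Σ n : SimplexCategory, K.obj (op n)), F.Finite ∧
      ∀ z ∈ C, ∃ p ∈ F, z ∈ Set.range (charMap p.2) := by
  have exists_ofSimplex_eq : ∀ A ∈ carrier '' C, ∃ p : Σ n : SimplexCategory, K.obj (op n),
      SSet.Subcomplex.ofSimplex (n := p.1.len) p.2 = A := by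
    rintro _ ⟨z, -, rfl⟩
    exact ⟨⟨_, (exists_charMap_eq z).choose_spec.choose⟩, rfl⟩
  choose p hp using exists_ofSimplex_eq
  have := (finite_image_carrier_of_isCompact hC).to_subtype
  exact ⟨Set.range fun A : carrier '' C => p A.1 A.2, Set.finite_range _,
    fun z hz => ⟨_, ⟨⟨_, z, hz, rfl⟩, rfl⟩,
      mem_range_charMap_of_carrier_le (hp _ ⟨z, hz, rfl⟩).ge⟩⟩

end RealizationTopology

section RealizationProduct

variable {ι : Type} {K : SSet.{u}} {L : ι → SSet.{u}} (π : ∀ i, K ⟶ L i)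

/-- The map from a geometric realization to a product of geometric realizations induced by a family
of morphisms. -/
noncomputable def realizationPi : C(SSet.toTop.obj K, ∀ i, SSet.toTop.obj (L i)) :=
  ContinuousMap.pi fun i => (SSet.toTop.map (π i)).hom

/-- The morphisms `π i` exhibit `K` as a product. -/
def IsLevelwiseProduct : Prop :=
  ∀ n : SimplexCategory, Function.Bijective fun (x : K.obj (op n)) i => (π i).app (op n) x

variable {π}

theorem realizationPi_charMap {n : SimplexCategory} (x : K.obj (op n)) (t : TopSimplex n) (i : ι) :
    realizationPi π (charMap x t) i = charMap ((π i).app _ x) t :=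
  toTop_map_charMap (π i) x t

theorem realizationPi_injective (hπ : IsLevelwiseProduct π) :
    Function.Injective (realizationPi π) := by
  intro z z' h
  obtain ⟨n, x, t, -, rfl⟩ := exists_charMap_eq z
  obtain ⟨n', x', t', -, rfl⟩ := exists_charMap_eq z'
  obtain ⟨l, v, θ, φ, -, hv, rfl, rfl⟩ := exists_common_push₂ t t'
  have hxx' : K.map θ.op x = K.map φ.op x' := by
    refine (hπ l).1 (funext fun i => ?_)
    have hi := congrFun h i
    rw [realizationPi_charMap, realizationPi_charMap] at hi
    exact (NatTrans.naturality_apply (π i) θ.op x).trans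
      ((map_eq_of_charMap_push_eq hv hi).trans (NatTrans.naturality_apply (π i) φ.op x').symm)
  rw [← charMap_map, ← charMap_map, hxx']

theorem exists_realizationPi_charMap (hπ : IsLevelwiseProduct π) {n : ι → SimplexCategory}
    (x : ∀ i, (L i).obj (op (n i))) {l : SimplexCategory} (θ : ∀ i, l ⟶ n i) :
    ∃ y : K.obj (op l),
      ∀ r, realizationPi π (charMap y r) = fun i => charMap (x i) (push (θ i) r) := by
  obtain ⟨y, hy⟩ := (hπ l).2 fun i => (L i).map (θ i).op (x i)
  refine ⟨y, fun r => funext fun i => ?_⟩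
  rw [realizationPi_charMap, ← charMap_map]
  exact congrArg (charMap · r) (congrFun hy i)

variable [Finite ι]

theorem realizationPi_surjective (hπ : IsLevelwiseProduct π) :
    Function.Surjective (realizationPi π) := by
  cases nonempty_fintype ι
  intro z
  choose n x t _ h using fun i => exists_charMap_eq (z i)
  obtain ⟨l, r, θ, -, -, hr⟩ := exists_common_push t
  obtain ⟨y, hy⟩ := exists_realizationPi_charMap hπ x θ
  exact ⟨charMap y r, by simp only [hy, hr, h]⟩

theorem isClosed_image_realizationPi_inter_range (hπ : IsLevelwiseProduct π)
    {C : Set (SSet.toTop.obj K)} (hC : IsClosed C) {n : ι → SimplexCategory}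
    (x : ∀ i, (L i).obj (op (n i))) :
    IsClosed (realizationPi π '' C ∩
      Set.range fun (t : ∀ i, TopSimplex (n i)) i => charMap (x i) (t i)) := by
  cases nonempty_fintype ι
  let Cone := Σ l : Fin (∑ i, ((n i).len + 1) + 1), ∀ i, SimplexCategory.mk l ⟶ n i
  choose y hy using fun o : Cone => exists_realizationPi_charMap hπ x o.2
  have image_inter_range : realizationPi π '' C ∩
      (Set.range fun (t : ∀ i, TopSimplex (n i)) i => charMap (x i) (t i)) =
      ⋃ o : Cone, (fun r => realizationPi π (charMap (y o) r)) '' (charMap (y o) ⁻¹' C) := by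
    ext w
    simp only [Set.mem_inter_iff, Set.mem_image, Set.mem_range, Set.mem_iUnion, Set.mem_preimage]
    constructor
    · rintro ⟨⟨z, hz, rfl⟩, t, ht⟩
      obtain ⟨l, r, θ, hl, -, hr⟩ := exists_common_push t
      let o : Cone := ⟨⟨l.len, Nat.lt_succ_of_le hl⟩, θ⟩
      have hz' : charMap (y o) r = z := realizationPi_injective hπ (by
        rw [← ht, hy o]
        exact funext fun i => congrArg (charMap (x i)) (hr i))
      exact ⟨o, r, hz'.symm ▸ hz, congrArg _ hz'⟩
    · rintro ⟨o, r, hr, rfl⟩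
      exact ⟨⟨_, hr, rfl⟩, fun i => push (o.2 i) r, (hy o r).symm⟩
  have proper := IsProperMap.pi_map fun i => isProperMap_charMap (x i)
  rw [image_inter_range]
  refine isClosed_iUnion_of_finite fun o => ?_
  simp only [hy, ← Set.image_image (fun (t : ∀ i, TopSimplex (n i)) i => charMap (x i) (t i))
    (fun r i => push (o.2 i) r)]
  refine proper.isClosedMap _ (IsCompact.isClosed (IsCompact.image ?_ ?_))
  · exact (hC.preimage (charMap (y o)).continuous).isCompact
  · exact continuous_pi fun i => (push (o.2 i)).continuous

theorem continuous_of_realizationPi_comp_eq (hπ : IsLevelwiseProduct π) {S : Type*}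
    [TopologicalSpace S] [CompactSpace S] (g : C(S, ∀ i, SSet.toTop.obj (L i)))
    {g' : S → SSet.toTop.obj K} (hg' : ∀ s, realizationPi π (g' s) = g s) : Continuous g' := by
  have isCompact_range_apply (i : ι) : IsCompact (Set.range fun s => g s i) :=
    isCompact_range ((continuous_apply i).comp g.continuous)
  choose F hF hcov using fun i =>
    exists_finite_cover_of_isCompact (isCompact_range_apply i)
  have (i : ι) : Finite (F i) := (hF i).to_subtype
  refine continuous_iff_isClosed.2 fun C hC => ?_
  have preimage_eq : g' ⁻¹' C = ⋃ p : ∀ i, F i, g ⁻¹' (realizationPi π '' C ∩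
      Set.range fun (t : ∀ i, TopSimplex (p i).1.1) i => charMap (p i).1.2 (t i)) := by
    ext s
    simp only [Set.mem_preimage, Set.mem_iUnion, Set.mem_inter_iff]
    have mem_image : g' s ∈ C ↔ g s ∈ realizationPi π '' C := by
      rw [← hg', (realizationPi_injective hπ).mem_set_image]
    choose p hp t ht using fun i => hcov i _ ⟨s, rfl⟩
    exact mem_image.trans
      ⟨fun h => ⟨fun i => ⟨p i, hp i⟩, h, t, funext ht⟩, fun ⟨_, h, _⟩ => h⟩
  rw [preimage_eq]
  exact isClosed_iUnion_of_finite fun p =>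
    (isClosed_image_realizationPi_inter_range hπ hC _).preimage g.continuous

theorem isWeakEquivalence_realizationPi (hπ : IsLevelwiseProduct π) :
    IsWeakEquivalence (realizationPi π) := by
  refine isWeakEquivalence_of_injective_of_compact_lift (realizationPi_injective hπ) ?_
  intro S _ _ g
  choose g' hg' using fun s => realizationPi_surjective hπ (g s)
  exact ⟨⟨g', continuous_of_realizationPi_comp_eq hπ g hg'⟩, ContinuousMap.ext hg'⟩

end RealizationProduct

section RealizationPair

open MonoidalCategory SemiCartesianMonoidalCategory

variable {X Y : SSet.{u}}

variable (X Y) in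
/-- The projections of a binary product, as a family indexed by `Bool`. -/
noncomputable def tensorProj : ∀ b : Bool, X ⊗ Y ⟶ bif b then X else Y
  | true => fst X Y
  | false => snd X Y

theorem isLevelwiseProduct_tensorProj : IsLevelwiseProduct (tensorProj X Y) := by
  refine fun n => ⟨fun x y h => Prod.ext (congrFun h true) (congrFun h false), fun y => ?_⟩
  exact ⟨(y true, y false), funext fun b => by cases b <;> rfl⟩

theorem exists_toTop_fst_snd_eq (z : SSet.toTop.obj X) (w : SSet.toTop.obj Y) :
    ∃ p : SSet.toTop.obj (X ⊗ Y),
      SSet.toTop.map (fst X Y) p = z ∧ SSet.toTop.map (snd X Y) p = w := by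
  obtain ⟨p, hp⟩ := realizationPi_surjective (isLevelwiseProduct_tensorProj (X := X) (Y := Y))
    fun | true => z | false => w
  exact ⟨p, congrFun hp true, congrFun hp false⟩

/-- The point of the geometric realization of a product with the given projections. As a function of
both variables, it is continuous on compact spaces only. -/
noncomputable def realizationPair (z : SSet.toTop.obj X) (w : SSet.toTop.obj Y) :
    SSet.toTop.obj (X ⊗ Y) :=
  (exists_toTop_fst_snd_eq z w).choose

theorem toTop_fst_realizationPair (z : SSet.toTop.obj X) (w : SSet.toTop.obj Y) :
    SSet.toTop.map (fst X Y) (realizationPair z w) = z :=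
  (exists_toTop_fst_snd_eq z w).choose_spec.1

theorem toTop_snd_realizationPair (z : SSet.toTop.obj X) (w : SSet.toTop.obj Y) :
    SSet.toTop.map (snd X Y) (realizationPair z w) = w :=
  (exists_toTop_fst_snd_eq z w).choose_spec.2

theorem realizationPair_toTop_map {Z : SSet.{u}} (f : Z ⟶ X) (g : Z ⟶ Y) (z : SSet.toTop.obj Z) :
    realizationPair (SSet.toTop.map f z) (SSet.toTop.map g z) =
      SSet.toTop.map (CartesianMonoidalCategory.lift f g) z := by
  refine realizationPi_injective isLevelwiseProduct_tensorProj (funext fun b => ?_)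
  have hfst := toTop_fst_realizationPair (SSet.toTop.map f z) (SSet.toTop.map g z)
  have hsnd := toTop_snd_realizationPair (SSet.toTop.map f z) (SSet.toTop.map g z)
  cases b
  · refine hsnd.trans ?_
    change _ = (SSet.toTop.map _ ≫ SSet.toTop.map (snd X Y)) z
    rw [← Functor.map_comp, CartesianMonoidalCategory.lift_snd]
  · refine hfst.trans ?_
    change _ = (SSet.toTop.map _ ≫ SSet.toTop.map (fst X Y)) z
    rw [← Functor.map_comp, CartesianMonoidalCategory.lift_fst]

theorem continuous_realizationPair_comp {S : Type*} [TopologicalSpace S] [CompactSpace S]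
    (a : C(S, SSet.toTop.obj X)) (b : C(S, SSet.toTop.obj Y)) :
    Continuous fun s => realizationPair (a s) (b s) := by
  let g : C(S, ∀ i : Bool, SSet.toTop.obj (bif i then X else Y)) :=
    ContinuousMap.pi fun | true => a | false => b
  refine continuous_of_realizationPi_comp_eq isLevelwiseProduct_tensorProj g fun s => ?_
  funext i
  cases i
  · exact toTop_snd_realizationPair _ _
  · exact toTop_fst_realizationPair _ _

end RealizationPair

section RealizationHomotopy

open MonoidalCategory Simplicial

theorem toTop_map_const {X Y : SSet.{u}} (y : Y.obj (op ⦋0⦌)) (z : SSet.toTop.obj X) :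
    SSet.toTop.map (SSet.const y : X ⟶ Y) z = charMap y default := by
  obtain ⟨n, x, t, -, rfl⟩ := exists_charMap_eq z
  rw [toTop_map_charMap]
  change charMap (Y.map (SimplexCategory.const n ⦋0⦌ 0).op y) t = _
  rw [charMap_map]
  exact congrArg (charMap y) (Subsingleton.elim (α := stdSimplex ℝ (Fin 1)) _ _)

/-- A vertex of the geometric realization of the simplicial interval. -/
noncomputable def intervalVertex (i : Fin 2) : SSet.toTop.obj (Δ[1] : SSet.{u}) :=
  charMap (n := ⦋0⦌) (SSet.stdSimplex.obj₀Equiv.symm i) default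

theorem joined_intervalVertex (i j : Fin 2) :
    Joined (intervalVertex.{u} i) (intervalVertex j) := by
  have intervalVertex_eq (i : Fin 2) : intervalVertex.{u} i =
      charMap (n := ⦋1⦌) (SSet.stdSimplex.objEquiv.symm (𝟙 _))
        (push (SimplexCategory.const ⦋0⦌ ⦋1⦌ i) default) := by
    rw [← charMap_map]
    rfl
  have : PathConnectedSpace (TopSimplex ⦋1⦌) :=
    inferInstanceAs (PathConnectedSpace (stdSimplex ℝ (Fin 2)))
  rw [intervalVertex_eq, intervalVertex_eq]
  exact (PathConnectedSpace.joined _ _).map (charMap _).continuous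

theorem realizationPair_intervalVertex_zero {X : SSet.{u}} (z : SSet.toTop.obj X) :
    realizationPair z (intervalVertex 0) = SSet.toTop.map SSet.ι₀ z := by
  have h := realizationPair_toTop_map (Y := Δ[1]) (𝟙 X)
    (SSet.const (SSet.stdSimplex.obj₀Equiv.{u}.symm 0)) z
  rwa [toTop_map_const, CategoryTheory.Functor.map_id] at h

theorem realizationPair_intervalVertex_one {X : SSet.{u}} (z : SSet.toTop.obj X) :
    realizationPair z (intervalVertex 1) = SSet.toTop.map SSet.ι₁ z := by
  have h := realizationPair_toTop_map (Y := Δ[1]) (𝟙 X)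
    (SSet.const (SSet.stdSimplex.obj₀Equiv.{u}.symm 1)) z
  rwa [toTop_map_const, CategoryTheory.Functor.map_id] at h

theorem homotopic_of_simplicialHomotopy {X Y : SSet.{u}} (h : X ⊗ Δ[1] ⟶ Y) :
    ContinuousMap.Homotopic (SSet.toTop.map (SSet.ι₀ ≫ h)).hom
      (SSet.toTop.map (SSet.ι₁ ≫ h)).hom := by
  obtain ⟨p⟩ := joined_intervalVertex.{u} 0 1
  have continuous_pair {S : Type} [TopologicalSpace S] [CompactSpace S]
      (a : C(S, SSet.toTop.obj X)) :
      Continuous fun w : S × unitInterval =>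
        SSet.toTop.map h (realizationPair (a w.1) (p w.2)) :=
    (SSet.toTop.map h).hom.continuous.comp
      (continuous_realizationPair_comp (a.comp .fst) (p.toContinuousMap.comp .snd))
  let f (z : SSet.toTop.obj X) : C(unitInterval, SSet.toTop.obj Y) :=
    ⟨fun s => SSet.toTop.map h (realizationPair z (p s)),
      (continuous_pair (ContinuousMap.const Unit z)).comp (Continuous.prodMk_right ())⟩
  have hf : Continuous f := continuous_toTop_iff.2 fun x =>
    (ContinuousMap.curry ⟨_, continuous_pair (charMap x)⟩).continuous
  refine ⟨{ toFun := fun w => f w.2 w.1, continuous_toFun := by fun_prop,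
            map_zero_left := fun z => ?_, map_one_left := fun z => ?_ }⟩
  · change SSet.toTop.map h (realizationPair z (p 0)) = _
    rw [p.source, realizationPair_intervalVertex_zero, Functor.map_comp]
    rfl
  · change SSet.toTop.map h (realizationPair z (p 1)) = _
    rw [p.target, realizationPair_intervalVertex_one, Functor.map_comp]
    rfl

end RealizationHomotopy

/-! ### Transport of pseudofunctors along invertible 2-morphisms -/

section Cells

open SimplicialCells

variable {C : Type u} [Bicategory.{u, u} C] [SimplicialBicategory C] {a b c : C}
  {k : SimplexCategoryᵒᵖ}

theorem vertex_eq_deg {f g : a ⟶ b} (η : f ⟶ g) :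
    vertex η = deg (op (SimplexCategory.mk 0)) η := by
  unfold deg
  rw [Subsingleton.elim (SimplexCategory.const _ (SimplexCategory.mk 0) 0) (𝟙 _)]
  exact ((cell f g).map_id_apply _ _).symm

theorem comp_comp_congr {f g h i g' : a ⟶ b} {x : (cell f g).obj k} {y : (cell g h).obj k}
    {x' : (cell f g').obj k} {y' : (cell g' h).obj k} (e : comp x y = comp x' y')
    (z : (cell h i).obj k) : comp x (comp y z) = comp x' (comp y' z) := by
  rw [← SimplicialBicategory.assoc, e, SimplicialBicategory.assoc]

theorem deg_inv_comp_deg_hom_comp {f g h : a ⟶ b} (e : f ≅ g) (x : (cell g h).obj k) :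
    comp (deg k e.inv) (comp (deg k e.hom) x) = x := by
  rw [← SimplicialBicategory.assoc, ← deg_comp, e.inv_hom_id, SimplicialBicategory.id_comp]

theorem comp_deg_inv_eq_deg_inv_comp {f g f' g' : a ⟶ b} {e : f ≅ f'} {e' : g ≅ g'}
    {x : (cell f g).obj k} {x' : (cell f' g').obj k}
    (h : comp x (deg k e'.hom) = comp (deg k e.hom) x') :
    comp x' (deg k e'.inv) = comp (deg k e.inv) x := by
  rw [← deg_inv_comp_deg_hom_comp e (comp x' (deg k e'.inv)), comp_comp_congr h.symm, ← deg_comp,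
    e'.hom_inv_id, SimplicialBicategory.comp_id]

theorem whiskerLeft_deg_inv_comp_whiskerLeft_deg_hom_comp (f : a ⟶ b) {g h : b ⟶ c} {i : a ⟶ c}
    (e : g ≅ h) (x : (cell (f ≫ h) i).obj k) :
    comp (whiskerLeft f (deg k e.inv)) (comp (whiskerLeft f (deg k e.hom)) x) = x := by
  rw [← deg_whiskerLeft, ← deg_whiskerLeft]
  exact deg_inv_comp_deg_hom_comp (Bicategory.whiskerLeftIso f e) x

theorem whiskerRight_deg_inv_comp_whiskerRight_deg_hom_comp {f g : a ⟶ b} {i : a ⟶ c}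
    (e : f ≅ g) (h : b ⟶ c) (x : (cell (g ≫ h) i).obj k) :
    comp (whiskerRight (deg k e.inv) h) (comp (whiskerRight (deg k e.hom) h) x) = x := by
  rw [← deg_whiskerRight, ← deg_whiskerRight]
  exact deg_inv_comp_deg_hom_comp (Bicategory.whiskerRightIso e h) x

end Cells

section Transport

variable {B C : Type u} [Bicategory.{u, u} B] [SimplicialBicategory B]
  [Bicategory.{u, u} C] [SimplicialBicategory C]

open Bicategory

/-- Transport of a pseudofunctor `F` along invertible 2-morphisms `θ f : M f ≅ F f`, which replaces
its action on 1-morphisms by `M` (without enrichment). -/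
def transport₀ (F : Pseudofunctor B C) (M : ∀ {a b : B}, (a ⟶ b) → (F.obj a ⟶ F.obj b))
    (θ : ∀ {a b : B} (f : a ⟶ b), M f ≅ F.map f) : Pseudofunctor B C where
  obj := F.obj
  map f := M f
  map₂ {a b f g} η := (θ f).hom ≫ F.map₂ η ≫ (θ g).inv
  mapId a := θ (𝟙 a) ≪≫ F.mapId a
  mapComp f g := θ (f ≫ g) ≪≫ F.mapComp f g ≪≫ whiskerRightIso (θ f).symm (F.map g) ≪≫
    whiskerLeftIso (M f) (θ g).symm
  map₂_whisker_left f g h η := by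
    simp only [Pseudofunctor.map₂_whisker_left, Category.assoc, Iso.trans_hom, whiskerRightIso_hom,
      Iso.symm_hom, whiskerLeftIso_hom, whiskerLeft_comp, Iso.trans_inv, whiskerLeftIso_inv,
      Iso.symm_inv, whiskerRightIso_inv, whiskerLeft_inv_hom_assoc, Iso.cancel_iso_hom_left]
    rw [← whisker_exchange_assoc]
    simp
  map₂_whisker_right η h := by
    simp only [Pseudofunctor.map₂_whisker_right, Category.assoc, Iso.trans_hom, whiskerRightIso_hom,
      Iso.symm_hom, whiskerLeftIso_hom, comp_whiskerRight, Iso.trans_inv, whiskerLeftIso_inv,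
      Iso.symm_inv, whiskerRightIso_inv, Iso.cancel_iso_hom_left]
    rw [whisker_exchange_assoc, whisker_exchange_assoc, whisker_exchange_assoc]
    simp
  map₂_associator f g h := by
    simp only [Pseudofunctor.map₂_associator, Category.assoc, Iso.trans_hom, whiskerRightIso_hom,
      Iso.symm_hom, whiskerLeftIso_hom, comp_whiskerRight, whisker_assoc, Iso.trans_inv,
      whiskerLeftIso_inv, Iso.symm_inv, whiskerRightIso_inv, whiskerLeft_comp,
      whiskerLeft_inv_hom_assoc, Iso.inv_hom_id_assoc, Iso.cancel_iso_hom_left]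
    rw [whisker_exchange_assoc, whisker_exchange_assoc, whisker_exchange_assoc,
      associator_naturality_right_assoc, ← whiskerLeft_comp_assoc (M f) (F.map g ◁ _),
      whisker_exchange, whiskerLeft_comp_assoc, whisker_exchange_assoc]
    simp
  map₂_left_unitor f := by
    simp only [Pseudofunctor.map₂_left_unitor, Category.assoc, Iso.trans_hom, whiskerRightIso_hom,
      Iso.symm_hom, whiskerLeftIso_hom, comp_whiskerRight, Iso.cancel_iso_hom_left]
    rw [whisker_exchange_assoc, whisker_exchange_assoc]
    simp
  map₂_right_unitor f := by
    simp only [Pseudofunctor.map₂_right_unitor, Category.assoc, Iso.trans_hom, whiskerRightIso_hom,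
      Iso.symm_hom, whiskerLeftIso_hom, whiskerLeft_comp, whiskerLeft_inv_hom_assoc,
      Iso.cancel_iso_hom_left]
    rw [← whisker_exchange_assoc]
    simp

variable (F : SPseudofunctor B C) (M : ∀ {a b : B}, (a ⟶ b) → (F.obj a ⟶ F.obj b))
  (θ : ∀ {a b : B} (f : a ⟶ b), M f ≅ F.map f)

open SimplicialCells (cell vertex comp deg)

/-- The action of a transported pseudofunctor on simplices of 2-cells. -/
def transportCell {a b : B} (f g : a ⟶ b) : cell f g ⟶ cell (M f) (M g) where
  app k := TypeCat.ofHom fun x =>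
    comp (deg k (θ f).hom) (comp ((F.mapCell f g).app k x) (deg k (θ g).inv))
  naturality k l φ := by
    ext x
    change comp _ (comp ((F.mapCell f g).app l ((cell f g).map φ x)) _) =
      (cell _ _).map φ (comp _ (comp ((F.mapCell f g).app k x) _))
    rw [SimplicialBicategory.map_comp, SimplicialBicategory.map_comp, map_deg, map_deg,
      F.mapCell_map]

theorem transportCell_apply {a b : B} (f g : a ⟶ b) {k : SimplexCategoryᵒᵖ}
    (x : (cell f g).obj k) : (transportCell F M θ f g).app k x =
      comp (deg k (θ f).hom) (comp ((F.mapCell f g).app k x) (deg k (θ g).inv)) := rfl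

theorem transportCell_comp {a b : B} {f g h : a ⟶ b} {k : SimplexCategoryᵒᵖ}
    (x : (cell f g).obj k) (y : (cell g h).obj k) :
    (transportCell F M θ f h).app k (comp x y) =
      comp ((transportCell F M θ f g).app k x) ((transportCell F M θ g h).app k y) := by
  simp only [transportCell_apply, F.mapCell_comp, SimplicialBicategory.assoc,
    deg_inv_comp_deg_hom_comp]

theorem transportCell_whiskerLeft {a b c : B} (f : a ⟶ b) {g h : b ⟶ c} {k : SimplexCategoryᵒᵖ}
    (x : (cell g h).obj k) :
    comp ((transportCell F M θ (f ≫ g) (f ≫ h)).app k (SimplicialCells.whiskerLeft f x))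
        (deg k ((transport₀ F.toPseudofunctor M θ).mapComp f h).hom) =
      comp (deg k ((transport₀ F.toPseudofunctor M θ).mapComp f g).hom)
        (SimplicialCells.whiskerLeft (M f) ((transportCell F M θ g h).app k x)) := by
  change comp _ (deg k ((θ (f ≫ h)).hom ≫ (F.mapComp f h).hom ≫ (θ f).inv ▷ F.map h ≫
      M f ◁ (θ h).inv)) =
    comp (deg k ((θ (f ≫ g)).hom ≫ (F.mapComp f g).hom ≫ (θ f).inv ▷ F.map g ≫
      M f ◁ (θ g).inv)) (SimplicialCells.whiskerLeft (M f) ((transportCell F M θ g h).app k x))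
  simp only [transportCell_apply, deg_comp, SimplicialBicategory.assoc,
    SimplicialBicategory.whiskerLeft_comp, deg_inv_comp_deg_hom_comp, deg_whiskerLeft,
    deg_whiskerRight, whiskerLeft_deg_inv_comp_whiskerLeft_deg_hom_comp]
  rw [comp_comp_congr (F.mapCell_whiskerLeft f x),
    comp_comp_congr (SimplicialBicategory.whisker_exchange (deg k (θ f).inv) _)]

theorem transportCell_whiskerRight {a b c : B} {f g : a ⟶ b} {k : SimplexCategoryᵒᵖ}
    (x : (cell f g).obj k) (h : b ⟶ c) :
    comp ((transportCell F M θ (f ≫ h) (g ≫ h)).app k (SimplicialCells.whiskerRight x h))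
        (deg k ((transport₀ F.toPseudofunctor M θ).mapComp g h).hom) =
      comp (deg k ((transport₀ F.toPseudofunctor M θ).mapComp f h).hom)
        (SimplicialCells.whiskerRight ((transportCell F M θ f g).app k x) (M h)) := by
  change comp _ (deg k ((θ (g ≫ h)).hom ≫ (F.mapComp g h).hom ≫ (θ g).inv ▷ F.map h ≫
      M g ◁ (θ h).inv)) =
    comp (deg k ((θ (f ≫ h)).hom ≫ (F.mapComp f h).hom ≫ (θ f).inv ▷ F.map h ≫
      M f ◁ (θ h).inv)) (SimplicialCells.whiskerRight ((transportCell F M θ f g).app k x) (M h))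
  simp only [transportCell_apply, deg_comp, SimplicialBicategory.assoc,
    SimplicialBicategory.whiskerRight_comp, deg_inv_comp_deg_hom_comp, deg_whiskerLeft,
    deg_whiskerRight]
  rw [comp_comp_congr (F.mapCell_whiskerRight x h),
    comp_comp_congr (SimplicialBicategory.whisker_exchange (deg k (θ f).hom) (deg k (θ h).inv)),
    comp_comp_congr (SimplicialBicategory.whisker_exchange ((F.mapCell f g).app k x)
      (deg k (θ h).inv)),
    SimplicialBicategory.whisker_exchange (deg k (θ g).inv) (deg k (θ h).inv),
    whiskerRight_deg_inv_comp_whiskerRight_deg_hom_comp]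

/-- Transport of a pseudofunctor `F` along invertible 2-morphisms `θ f : M f ≅ F f`. -/
def transport : SPseudofunctor B C where
  toPseudofunctor := transport₀ F.toPseudofunctor M θ
  mapCell := transportCell F M θ
  mapCell_vertex {a b f g} η := by
    change comp _ (comp ((F.mapCell f g).app _ (vertex η)) _) =
      vertex ((θ f).hom ≫ F.map₂ η ≫ (θ g).inv)
    rw [F.mapCell_vertex, vertex_eq_deg, vertex_eq_deg, deg_comp, deg_comp]
  mapCell_comp := transportCell_comp F M θ
  mapCell_whiskerLeft := transportCell_whiskerLeft F M θ
  mapCell_whiskerRight := transportCell_whiskerRight F M θ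

/-- The comparison of a transported pseudofunctor with the original one; its components are
identities. -/
def ofTransport : STrans (transport F M θ) F where
  app a := 𝟙 (F.obj a)
  naturality f := ρ_ (M f) ≪≫ θ f ≪≫ (λ_ (F.map f)).symm
  naturality_naturality {a b f g} η := by
    change ((θ f).hom ≫ F.map₂ η ≫ (θ g).inv) ▷ 𝟙 (F.obj b) ≫ (ρ_ (M g)).hom ≫ (θ g).hom ≫
        (λ_ (F.map g)).inv =
      ((ρ_ (M f)).hom ≫ (θ f).hom ≫ (λ_ (F.map f)).inv) ≫ 𝟙 (F.obj a) ◁ F.map₂ η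
    simp
  naturality_id a := by
    change ((ρ_ (M (𝟙 a))).hom ≫ (θ (𝟙 a)).hom ≫ (λ_ (F.map (𝟙 a))).inv) ≫
      𝟙 (F.obj a) ◁ (F.mapId a).hom = ((θ (𝟙 a)).hom ≫ (F.mapId a).hom) ▷ 𝟙 (F.obj a) ≫
        (λ_ (𝟙 (F.obj a))).hom ≫ (ρ_ (𝟙 (F.obj a))).inv
    simp [unitors_equal]
  naturality_comp {a b c} f g := by
    change ((ρ_ (M (f ≫ g))).hom ≫ (θ (f ≫ g)).hom ≫ (λ_ (F.map (f ≫ g))).inv) ≫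
      𝟙 (F.obj a) ◁ (F.mapComp f g).hom = ((θ (f ≫ g)).hom ≫ (F.mapComp f g).hom ≫
        (θ f).inv ▷ (F.map g) ≫ (M f) ◁ (θ g).inv) ▷ 𝟙 (F.obj c) ≫
        (α_ (M f) (M g) (𝟙 (F.obj c))).hom ≫
        M f ◁ ((ρ_ (M g)).hom ≫ (θ g).hom ≫ (λ_ (F.map g)).inv) ≫
        (α_ (M f) (𝟙 (F.obj b)) (F.map g)).inv ≫
        ((ρ_ (M f)).hom ≫ (θ f).hom ≫ (λ_ (F.map f)).inv) ▷ F.map g ≫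
        (α_ (𝟙 (F.obj a)) (F.map f) (F.map g)).hom
    simp
  naturality_cell {a b f g k} x := by
    change comp (SimplicialCells.whiskerRight (comp (deg k (θ f).hom)
        (comp ((F.mapCell f g).app k x) (deg k (θ g).inv))) (𝟙 (F.obj b)))
        (deg k ((ρ_ (M g)).hom ≫ (θ g).hom ≫ (λ_ (F.map g)).inv)) =
      comp (deg k ((ρ_ (M f)).hom ≫ (θ f).hom ≫ (λ_ (F.map f)).inv))
        (SimplicialCells.whiskerLeft (𝟙 (F.obj a)) ((F.mapCell f g).app k x))
    simp only [deg_comp, SimplicialBicategory.assoc]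
    rw [comp_comp_congr (SimplicialBicategory.rightUnitor_naturality _)]
    simp only [SimplicialBicategory.assoc, deg_inv_comp_deg_hom_comp]
    rw [comp_deg_inv_eq_deg_inv_comp (SimplicialBicategory.leftUnitor_naturality _)]

/-- The comparison of a pseudofunctor with a transported one; its components are identities. -/
def toTransport : STrans F (transport F M θ) where
  app a := 𝟙 (F.obj a)
  naturality f := ρ_ (F.map f) ≪≫ (θ f).symm ≪≫ (λ_ (M f)).symm
  naturality_naturality {a b f g} η := by
    change F.map₂ η ▷ _ ≫ (ρ_ (F.map g)).hom ≫ (θ g).inv ≫ (λ_ (M g)).inv =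
      ((ρ_ (F.map f)).hom ≫ (θ f).inv ≫ (λ_ (M f)).inv) ≫
        _ ◁ ((θ f).hom ≫ F.map₂ η ≫ (θ g).inv)
    simp
  naturality_id a := by
    change ((ρ_ (F.map (𝟙 a))).hom ≫ (θ (𝟙 a)).inv ≫ (λ_ (M (𝟙 a))).inv) ≫
      𝟙 (F.obj a) ◁ ((θ (𝟙 a)).hom ≫ (F.mapId a).hom) = (F.mapId a).hom ▷ 𝟙 (F.obj a) ≫
        (λ_ (𝟙 (F.obj a))).hom ≫ (ρ_ (𝟙 (F.obj a))).inv
    simp [unitors_equal]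
  naturality_comp {a b c} f g := by
    change ((ρ_ (F.map (f ≫ g))).hom ≫ (θ (f ≫ g)).inv ≫ (λ_ (M (f ≫ g))).inv) ≫
      𝟙 (F.obj a) ◁ ((θ (f ≫ g)).hom ≫ (F.mapComp f g).hom ≫
        (θ f).inv ▷ (F.map g) ≫ (M f) ◁ (θ g).inv) = (F.mapComp f g).hom ▷ 𝟙 (F.obj c) ≫
        (α_ (F.map f) (F.map g) (𝟙 (F.obj c))).hom ≫
        F.map f ◁ ((ρ_ (F.map g)).hom ≫ (θ g).inv ≫ (λ_ (M g)).inv) ≫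
        (α_ (F.map f) (𝟙 (F.obj b)) (M g)).inv ≫
        ((ρ_ (F.map f)).hom ≫ (θ f).inv ≫ (λ_ (M f)).inv) ▷ M g ≫
        (α_ (𝟙 (F.obj a)) (M f) (M g)).hom
    simp [whisker_exchange]
  naturality_cell {a b f g k} x := by
    change comp (SimplicialCells.whiskerRight ((F.mapCell f g).app k x) (𝟙 (F.obj b)))
        (deg k ((ρ_ (F.map g)).hom ≫ (θ g).inv ≫ (λ_ (M g)).inv)) =
      comp (deg k ((ρ_ (F.map f)).hom ≫ (θ f).inv ≫ (λ_ (M f)).inv))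
        (SimplicialCells.whiskerLeft (𝟙 (F.obj a)) (comp (deg k (θ f).hom)
        (comp ((F.mapCell f g).app k x) (deg k (θ g).inv))))
    simp only [deg_comp, SimplicialBicategory.assoc]
    rw [comp_comp_congr (SimplicialBicategory.rightUnitor_naturality _),
      ← comp_deg_inv_eq_deg_inv_comp (SimplicialBicategory.leftUnitor_naturality _)]
    simp only [SimplicialBicategory.assoc, deg_inv_comp_deg_hom_comp]

end Transport

/-! ### Adjoining new identities to a bicategory -/

open SimplicialCells

section Strict

open Bicategory

variable {C : Type u} [Bicategory.{u, u} C]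

-- These identities are the axioms of a pseudofunctor all of whose constraints are identities.

theorem eq_id_comp_comp_id {a b : C} {f g : a ⟶ b} (η : f ⟶ g) : η = 𝟙 f ≫ η ≫ 𝟙 g := by
  rw [Category.id_comp, Category.comp_id]

theorem associator_hom_eq_id_comp {a b c d : C} (f : a ⟶ b) (g : b ⟶ c) (h : c ⟶ d) :
    (α_ f g h).hom = 𝟙 _ ≫ 𝟙 (f ≫ g) ▷ h ≫ (α_ f g h).hom ≫ f ◁ 𝟙 (g ≫ h) ≫ 𝟙 _ := by
  simp

theorem leftUnitor_hom_eq_id_comp {a b : C} (f : a ⟶ b) :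
    (λ_ f).hom = 𝟙 _ ≫ 𝟙 _ ▷ f ≫ (λ_ f).hom := by
  simp

theorem rightUnitor_hom_eq_id_comp {a b : C} (f : a ⟶ b) :
    (ρ_ f).hom = 𝟙 _ ≫ f ◁ 𝟙 _ ≫ (ρ_ f).hom := by
  simp

theorem comp_deg_id_eq_deg_id_comp {k : SimplexCategoryᵒᵖ} [SimplicialBicategory C] {a b : C}
    {f g : a ⟶ b} (x : (cell f g).obj k) : comp x (deg k (𝟙 g)) = comp (deg k (𝟙 f)) x :=
  (SimplicialBicategory.comp_id x).trans (SimplicialBicategory.id_comp x).symm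

end Strict

section Augmentation

variable {C : Type u} [Bicategory.{u, u} C]

/-- The 1-morphisms of a bicategory together with new identities. -/
inductive AugHom : C → C → Type u
  | old {a b : C} (f : a ⟶ b) : AugHom a b
  | new (a : C) : AugHom a a

/-- The underlying 1-morphism. -/
def AugHom.toHom : ∀ {a b : C}, AugHom a b → (a ⟶ b)
  | _, _, .old f => f
  | _, _, .new a => 𝟙 a

/-- The 2-morphisms between augmented 1-morphisms are those of the underlying 1-morphisms. -/
instance augCategory (a b : C) : Category.{u} (AugHom a b) where
  Hom m n := m.toHom ⟶ n.toHom
  id m := 𝟙 m.toHom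
  comp η θ := CategoryStruct.comp (obj := a ⟶ b) η θ
  id_comp _ := Category.id_comp (obj := a ⟶ b) _
  comp_id _ := Category.comp_id (obj := a ⟶ b) _
  assoc _ _ _ := Category.assoc (obj := a ⟶ b) _ _ _

/-- Invertible 2-morphisms between augmented 1-morphisms. -/
def augIso {a b : C} {m n : AugHom a b} (e : m.toHom ≅ n.toHom) : m ≅ n :=
  ⟨e.hom, e.inv, e.hom_inv_id, e.inv_hom_id⟩

/-- The bicategory obtained by adjoining new identity 1-morphisms. -/
def Augmentation (C : Type u) : Type u := C

instance augBicategory : Bicategory.{u, u} (Augmentation C) where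
  Hom a b := AugHom (C := C) a b
  id a := .new (C := C) a
  comp m n := .old (m.toHom ≫ n.toHom)
  homCategory a b := augCategory (C := C) a b
  whiskerLeft m _ _ η := Bicategory.whiskerLeft (B := C) m.toHom η
  whiskerRight η n := Bicategory.whiskerRight (B := C) η n.toHom
  associator m n p := augIso (Bicategory.associator m.toHom n.toHom p.toHom)
  leftUnitor m := augIso (Bicategory.leftUnitor m.toHom)
  rightUnitor m := augIso (Bicategory.rightUnitor m.toHom)
  whiskerLeft_id _ _ := Bicategory.whiskerLeft_id (B := C) _ _
  whiskerLeft_comp _ _ _ _ _ _ := Bicategory.whiskerLeft_comp (B := C) _ _ _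
  id_whiskerLeft _ := Bicategory.id_whiskerLeft (B := C) _
  comp_whiskerLeft _ _ _ _ _ := Bicategory.comp_whiskerLeft (B := C) _ _ _
  id_whiskerRight _ _ := Bicategory.id_whiskerRight (B := C) _ _
  comp_whiskerRight _ _ _ := Bicategory.comp_whiskerRight (B := C) _ _ _
  whiskerRight_id _ := Bicategory.whiskerRight_id (B := C) _
  whiskerRight_comp _ _ _ := Bicategory.whiskerRight_comp (B := C) _ _ _
  whisker_assoc _ _ _ _ _ := Bicategory.whisker_assoc (B := C) _ _ _
  whisker_exchange _ _ := Bicategory.whisker_exchange (B := C) _ _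
  pentagon _ _ _ _ := Bicategory.pentagon (B := C) _ _ _ _
  triangle _ _ := Bicategory.triangle (B := C) _ _

section Simplicial

variable [SimplicialBicategory C]

instance augSimplicialCells : SimplicialCells (Augmentation C) where
  cell m n := cell (B := C) m.toHom n.toHom
  vertex := vertex (B := C)
  comp x y := comp (B := C) x y
  whiskerLeft m _ _ _ x := whiskerLeft (B := C) m.toHom x
  whiskerRight x n := whiskerRight (B := C) x n.toHom

instance augSimplicialBicategory : SimplicialBicategory (Augmentation C) where
  map_comp _ _ _ := SimplicialBicategory.map_comp (B := C) _ _ _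
  vertex_comp _ _ := SimplicialBicategory.vertex_comp (B := C) _ _
  id_comp _ := SimplicialBicategory.id_comp (B := C) _
  comp_id _ := SimplicialBicategory.comp_id (B := C) _
  assoc _ _ _ := SimplicialBicategory.assoc (B := C) _ _ _
  map_whiskerLeft _ _ _ _ _ _ _ := SimplicialBicategory.map_whiskerLeft (B := C) _ _ _
  vertex_whiskerLeft _ _ _ _ := SimplicialBicategory.vertex_whiskerLeft (B := C) _ _
  whiskerLeft_comp _ _ _ _ _ _ _ := SimplicialBicategory.whiskerLeft_comp (B := C) _ _ _
  map_whiskerRight _ _ _ := SimplicialBicategory.map_whiskerRight (B := C) _ _ _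
  vertex_whiskerRight _ _ := SimplicialBicategory.vertex_whiskerRight (B := C) _ _
  whiskerRight_comp _ _ _ := SimplicialBicategory.whiskerRight_comp (B := C) _ _ _
  whisker_exchange _ _ := SimplicialBicategory.whisker_exchange (B := C) _ _
  leftUnitor_naturality _ := SimplicialBicategory.leftUnitor_naturality (B := C) _
  rightUnitor_naturality _ := SimplicialBicategory.rightUnitor_naturality (B := C) _
  associator_naturality_left _ _ _ :=
    SimplicialBicategory.associator_naturality_left (B := C) _ _ _
  associator_naturality_middle _ _ _ _ _ _ :=
    SimplicialBicategory.associator_naturality_middle (B := C) _ _ _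
  associator_naturality_right _ _ _ _ _ _ :=
    SimplicialBicategory.associator_naturality_right (B := C) _ _ _

end Simplicial

/-- The projection forgetting the distinction between new and old identities (without
enrichment). -/
def augProj₀ (C : Type u) [Bicategory.{u, u} C] : Pseudofunctor (Augmentation C) C where
  obj a := a
  map m := AugHom.toHom m
  map₂ η := η
  mapId a := Iso.refl (𝟙 (show C from a))
  mapComp {a _ c} _ _ := Iso.refl (C := (show C from a) ⟶ (show C from c)) _
  map₂_id _ := rfl
  map₂_comp _ _ := rfl
  map₂_whisker_left m _ _ η := eq_id_comp_comp_id (C := C) (Bicategory.whiskerLeft m.toHom η)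
  map₂_whisker_right {_ _ _ m m'} η n :=
    eq_id_comp_comp_id (C := C) (Bicategory.whiskerRight (f := m.toHom) (g := m'.toHom) η n.toHom)
  map₂_associator m n p := associator_hom_eq_id_comp (C := C) m.toHom n.toHom p.toHom
  map₂_left_unitor m := leftUnitor_hom_eq_id_comp (C := C) m.toHom
  map₂_right_unitor m := rightUnitor_hom_eq_id_comp (C := C) m.toHom

/-- The projection forgetting the distinction between new and old identities. -/
def augProj (C : Type u) [Bicategory.{u, u} C] [SimplicialBicategory C] :
    SPseudofunctor (Augmentation C) C where
  toPseudofunctor := augProj₀ C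
  mapCell m n := 𝟙 (cell (AugHom.toHom m) (AugHom.toHom n))
  mapCell_vertex _ := rfl
  mapCell_comp _ _ := rfl
  mapCell_whiskerLeft m _ _ _ x := comp_deg_id_eq_deg_id_comp (C := C) (whiskerLeft m.toHom x)
  mapCell_whiskerRight {_ _ _ m m' _} x n :=
    comp_deg_id_eq_deg_id_comp (C := C) (whiskerRight (f := m.toHom) (g := m'.toHom) x n.toHom)

variable [SimplicialBicategory C]

theorem augProj_isNormal : (augProj C).IsNormal :=
  ⟨fun a => rfl, fun a => by ext; rfl⟩

variable {B : Type u} [Bicategory.{u, u} B] [SimplicialBicategory B]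

section Lift

variable (F : SPseudofunctor B C) (m : ∀ {a b : B}, (a ⟶ b) → AugHom (F.obj a) (F.obj b))
    (θ : ∀ {a b : B} (f : a ⟶ b), (m f).toHom ≅ F.map f)

/-- The lift of a pseudofunctor to augmented 1-morphisms (without enrichment). -/
def augLift₀ : Pseudofunctor B (Augmentation C) where
  obj := F.obj
  map f := m f
  map₂ η := (transport F (fun f => (m f).toHom) θ).map₂ η
  mapId a := augIso ((transport F (fun f => (m f).toHom) θ).mapId a)
  mapComp f g := augIso ((transport F (fun f => (m f).toHom) θ).mapComp f g)
  map₂_id f := (transport F (fun f => (m f).toHom) θ).map₂_id f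
  map₂_comp η ζ := (transport F (fun f => (m f).toHom) θ).map₂_comp η ζ
  map₂_whisker_left f _ _ η := (transport F (fun f => (m f).toHom) θ).map₂_whisker_left f η
  map₂_whisker_right η h := (transport F (fun f => (m f).toHom) θ).map₂_whisker_right η h
  map₂_associator f g h := (transport F (fun f => (m f).toHom) θ).map₂_associator f g h
  map₂_left_unitor f := (transport F (fun f => (m f).toHom) θ).map₂_left_unitor f
  map₂_right_unitor f := (transport F (fun f => (m f).toHom) θ).map₂_right_unitor f

/-- The lift of a pseudofunctor to augmented 1-morphisms. -/
def augLift : SPseudofunctor B (Augmentation C) where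
  toPseudofunctor := augLift₀ F m θ
  mapCell f g := (transport F (fun f => (m f).toHom) θ).mapCell f g
  mapCell_vertex η := (transport F (fun f => (m f).toHom) θ).mapCell_vertex η
  mapCell_comp x y := (transport F (fun f => (m f).toHom) θ).mapCell_comp x y
  mapCell_whiskerLeft f _ _ _ x :=
    (transport F (fun f => (m f).toHom) θ).mapCell_whiskerLeft f x
  mapCell_whiskerRight x h := (transport F (fun f => (m f).toHom) θ).mapCell_whiskerRight x h

theorem augLift_comp_augProj :
    (augLift F m θ).comp (augProj C) = transport F (fun f => (m f).toHom) θ := by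
  refine SPseudofunctor.ext' (SPseudofunctor.pseudo_ext rfl (fun a => heq_of_eq ?_)
    (fun f g => heq_of_eq ?_)) (fun f g => HEq.rfl)
  · ext
    exact Category.comp_id _
  · ext
    exact Category.comp_id _

end Lift

end Augmentation

/-! ### Operations on transformations -/

section Operations

open Bicategory

variable {A B C : Type u} [Bicategory.{u, u} A] [SimplicialBicategory A] [Bicategory.{u, u} B]
  [SimplicialBicategory B] [Bicategory.{u, u} C] [SimplicialBicategory C]

theorem naturality_cell_vcomp {a a' a'' b b' b'' : C} {k : SimplexCategoryᵒᵖ} {f g : a ⟶ b}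
    {f' g' : a' ⟶ b'} {f'' g'' : a'' ⟶ b''} {p : a ⟶ a'} {p' : a' ⟶ a''} {q : b ⟶ b'}
    {q' : b' ⟶ b''} {x : (cell f g).obj k} {y : (cell f' g').obj k} {z : (cell f'' g'').obj k}
    {σ : f ≫ q ⟶ p ≫ f'} {τ : g ≫ q ⟶ p ≫ g'} {σ' : f' ≫ q' ⟶ p' ≫ f''}
    {τ' : g' ≫ q' ⟶ p' ≫ g''}
    (h : comp (SimplicialCells.whiskerRight x q) (deg k τ) =
      comp (deg k σ) (SimplicialCells.whiskerLeft p y))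
    (h' : comp (SimplicialCells.whiskerRight y q') (deg k τ') =
      comp (deg k σ') (SimplicialCells.whiskerLeft p' z)) :
    comp (SimplicialCells.whiskerRight x (q ≫ q')) (deg k ((α_ _ _ _).inv ≫ τ ▷ q' ≫
        (α_ _ _ _).hom ≫ p ◁ τ' ≫ (α_ _ _ _).inv)) =
      comp (deg k ((α_ _ _ _).inv ≫ σ ▷ q' ≫ (α_ _ _ _).hom ≫ p ◁ σ' ≫ (α_ _ _ _).inv))
        (SimplicialCells.whiskerLeft (p ≫ p') z) := by
  simp only [deg_comp, deg_whiskerLeft, deg_whiskerRight, SimplicialBicategory.assoc]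
  have associator_naturality_left :=
    comp_deg_inv_eq_deg_inv_comp (SimplicialBicategory.associator_naturality_left x q q')
  have associator_naturality_right :=
    comp_deg_inv_eq_deg_inv_comp (SimplicialBicategory.associator_naturality_right p p' z)
  rw [comp_comp_congr associator_naturality_left,
    ← SimplicialBicategory.assoc (SimplicialCells.whiskerRight (SimplicialCells.whiskerRight x q)
      q'), ← SimplicialBicategory.whiskerRight_comp, h, SimplicialBicategory.whiskerRight_comp,
    SimplicialBicategory.assoc,
    comp_comp_congr (SimplicialBicategory.associator_naturality_middle p y q'),
    ← SimplicialBicategory.assoc (SimplicialCells.whiskerLeft p _),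
    ← SimplicialBicategory.whiskerLeft_comp, h', SimplicialBicategory.whiskerLeft_comp,
    SimplicialBicategory.assoc, associator_naturality_right]

theorem naturality_hom_comp_mapId {F G : SPseudofunctor B C} (η : STrans F G) {b : B} {f : b ⟶ b}
    (ζ : f ⟶ 𝟙 b) : (η.naturality f).hom ≫ η.app b ◁ (G.map₂ ζ ≫ (G.mapId b).hom) =
      (F.map₂ ζ ≫ (F.mapId b).hom) ▷ η.app b ≫ (λ_ (η.app b)).hom ≫ (ρ_ (η.app b)).inv := by
  rw [Bicategory.whiskerLeft_comp, comp_whiskerRight, Category.assoc, ← η.naturality_id,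
    ← Category.assoc, ← η.naturality_naturality, Category.assoc]

theorem naturality_hom_comp_mapComp {F G : SPseudofunctor B C} (η : STrans F G) {a b c : B}
    {h : a ⟶ c} {f : a ⟶ b} {g : b ⟶ c} (ζ : h ⟶ f ≫ g) :
    (η.naturality h).hom ≫ η.app a ◁ (G.map₂ ζ ≫ (G.mapComp f g).hom) =
      (F.map₂ ζ ≫ (F.mapComp f g).hom) ▷ η.app c ≫ (α_ _ _ _).hom ≫
        F.map f ◁ (η.naturality g).hom ≫ (α_ _ _ _).inv ≫ (η.naturality f).hom ▷ G.map g ≫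
          (α_ _ _ _).hom := by
  rw [Bicategory.whiskerLeft_comp, comp_whiskerRight, Category.assoc, ← η.naturality_comp,
    ← Category.assoc, ← η.naturality_naturality, Category.assoc]

/-- The identity transformation. -/
def STrans.id (F : SPseudofunctor B C) : STrans F F where
  toStrongTrans := Pseudofunctor.StrongTrans.id F.toPseudofunctor
  naturality_cell {a b f g k} x := by
    change comp (SimplicialCells.whiskerRight ((F.mapCell f g).app k x) (𝟙 (F.obj b)))
        (deg k ((ρ_ (F.map g)).hom ≫ (λ_ (F.map g)).inv)) =
      comp (deg k ((ρ_ (F.map f)).hom ≫ (λ_ (F.map f)).inv))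
        (SimplicialCells.whiskerLeft (𝟙 (F.obj a)) ((F.mapCell f g).app k x))
    rw [deg_comp, deg_comp, comp_comp_congr (SimplicialBicategory.rightUnitor_naturality _),
      comp_deg_inv_eq_deg_inv_comp (SimplicialBicategory.leftUnitor_naturality _),
      SimplicialBicategory.assoc]

/-- Vertical composition of transformations. -/
def STrans.vcomp {F G H : SPseudofunctor B C} (η : STrans F G) (θ : STrans G H) :
    STrans F H where
  toStrongTrans := Pseudofunctor.StrongTrans.vcomp η.toStrongTrans θ.toStrongTrans
  naturality_cell {a b f g k} x := by
    exact naturality_cell_vcomp (η.naturality_cell x) (θ.naturality_cell x)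

/-- Composition of a transformation with a pseudofunctor on the source side. -/
def STrans.precomp (H : SPseudofunctor A B) {F G : SPseudofunctor B C} (η : STrans F G) :
    STrans (H.comp F) (H.comp G) where
  app a := η.app (H.obj a)
  naturality f := η.naturality (H.map f)
  naturality_naturality ζ := η.naturality_naturality (H.map₂ ζ)
  naturality_id a := naturality_hom_comp_mapId η (H.mapId a).hom
  naturality_comp f g := naturality_hom_comp_mapComp η (H.mapComp f g).hom
  naturality_cell x := η.naturality_cell ((H.mapCell _ _).app _ x)

/-- Transformations into a product. -/
def STrans.pi {ι : Type} {D : ι → Type u} [∀ i, Bicategory.{u, u} (D i)]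
    [∀ i, SimplicialBicategory (D i)] {F G : ∀ i, SPseudofunctor B (D i)}
    (η : ∀ i, STrans (F i) (G i)) : STrans (piLift F) (piLift G) where
  app a := fun i => (η i).app a
  naturality f := Pi.isoMk fun i => (η i).naturality f
  naturality_naturality ζ := funext fun i => (η i).naturality_naturality ζ
  naturality_id a := funext fun i => (η i).naturality_id a
  naturality_comp f g := funext fun i => (η i).naturality_comp f g
  naturality_cell x := funext fun i => (η i).naturality_cell x

/-- Transformations of pseudofunctors to an augmentation are the transformations of the underlying
pseudofunctors. -/
def STrans.reflect {F G : SPseudofunctor B (Augmentation C)}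
    (η : STrans (F.comp (augProj C)) (G.comp (augProj C))) : STrans F G where
  app a := AugHom.old (η.app a)
  naturality f := augIso (C := C) (η.naturality f)
  naturality_naturality ζ := η.naturality_naturality ζ
  naturality_id a := by
    have mapId_hom (H : SPseudofunctor B (Augmentation C)) :
        ((H.comp (augProj C)).mapId a).hom = (H.mapId a).hom := Category.comp_id (H.mapId a).hom
    have h := η.naturality_id a
    rw [mapId_hom, mapId_hom] at h
    exact h
  naturality_comp f g := by
    have mapComp_hom (H : SPseudofunctor B (Augmentation C)) :
        ((H.comp (augProj C)).mapComp f g).hom = (H.mapComp f g).hom :=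
      Category.comp_id (H.mapComp f g).hom
    have h := η.naturality_comp f g
    rw [mapComp_hom, mapComp_hom] at h
    exact h
  naturality_cell x := η.naturality_cell x

end Operations

/-! ### Normalization of pseudofunctors -/

section Homotopic

variable {B C D : Type u} [Bicategory.{u, u} B] [SimplicialBicategory B] [Bicategory.{u, u} C]
  [SimplicialBicategory C] [Bicategory.{u, u} D] [SimplicialBicategory D]

/-- Homotopy of pseudofunctors: the equivalence relation generated by the existence of a
transformation. -/
def SPseudofunctor.Homotopic (F G : SPseudofunctor B C) : Prop :=
  Relation.EqvGen (fun F G : SPseudofunctor B C => Nonempty (STrans F G)) F G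

theorem STrans.homotopic {F G : SPseudofunctor B C} (η : STrans F G) : F.Homotopic G :=
  .rel _ _ ⟨η⟩

theorem SPseudofunctor.Homotopic.induction {F G : SPseudofunctor B C} (h : F.Homotopic G)
    {r : SPseudofunctor B C → SPseudofunctor B C → Prop} (hr : Equivalence r)
    (h_of : ∀ {F G}, STrans F G → r F G) : r F G :=
  hr.eqvGen_iff.mp (h.mono fun _ _ ⟨η⟩ => h_of η)

end Homotopic

section Normalization

variable {B C D : Type u} [Bicategory.{u, u} B] [SimplicialBicategory B] [Bicategory.{u, u} C]
  [SimplicialBicategory C] [Bicategory.{u, u} D] [SimplicialBicategory D]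

theorem augLift_congr {F F' : SPseudofunctor B C} (hF : F = F')
    {m : ∀ {a b : B}, (a ⟶ b) → AugHom (F.obj a) (F.obj b)}
    {θ : ∀ {a b : B} (f : a ⟶ b), (m f).toHom ≅ F.map f}
    {m' : ∀ {a b : B}, (a ⟶ b) → AugHom (F'.obj a) (F'.obj b)}
    {θ' : ∀ {a b : B} (f : a ⟶ b), (m' f).toHom ≅ F'.map f}
    (hm : ∀ {a b : B} (f : a ⟶ b), HEq (m f) (m' f))
    (hθ : ∀ {a b : B} (f : a ⟶ b), HEq (θ f) (θ' f)) :
    augLift F m θ = augLift F' m' θ' := by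
  subst hF
  obtain rfl : @m = @m' := by
    funext a b f
    exact eq_of_heq (hm f)
  obtain rfl : @θ = @θ' := by
    funext a b f
    exact eq_of_heq (hθ f)
  rfl

theorem prelaxFunctor_ext {B C : Type u} [Bicategory.{u, u} B] [Bicategory.{u, u} C]
    {F G : PrelaxFunctor B C} (h : F.toPrefunctor = G.toPrefunctor)
    (h₂ : ∀ {a b : B} {f g : a ⟶ b} (η : f ⟶ g), HEq (F.map₂ η) (G.map₂ η)) : F = G := by
  obtain ⟨⟨F, m⟩, _, _⟩ := F
  obtain ⟨⟨G, m'⟩, _, _⟩ := G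
  obtain rfl : F = G := h
  obtain rfl : @m = @m' := by
    funext a b f g η
    exact eq_of_heq (h₂ η)
  rfl

open Bicategory

theorem augLift_augProj : augLift (augProj C) (fun m => m)
    (fun {a b} m => Iso.refl (C := (show C from a) ⟶ (show C from b)) (AugHom.toHom m)) =
    SPseudofunctor.id (Augmentation C) := by
  have id_comp_comp_id {a b : C} {f g : a ⟶ b} (η : f ⟶ g) :
      (Iso.refl f).hom ≫ η ≫ (Iso.refl g).inv = η := (eq_id_comp_comp_id η).symm
  have id_comp_whisker {a b c : C} (f : a ⟶ b) (g : b ⟶ c) :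
      𝟙 (f ≫ g) ≫ 𝟙 (f ≫ g) ≫ 𝟙 f ▷ g ≫ f ◁ 𝟙 g = 𝟙 (f ≫ g) := by
    simp
  have deg_id_comp_comp_deg_id {a b : C} {f g : a ⟶ b} {k : SimplexCategoryᵒᵖ}
      (x : (cell f g).obj k) : comp (deg k (𝟙 f)) (comp x (deg k (𝟙 g))) = x := by
    rw [SimplicialBicategory.comp_id, SimplicialBicategory.id_comp]
  refine SPseudofunctor.ext' (SPseudofunctor.pseudo_ext (prelaxFunctor_ext rfl fun {a b f g} η =>
    heq_of_eq ?_) (fun a => heq_of_eq ?_) (fun f g => heq_of_eq ?_)) (fun f g => heq_of_eq ?_)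
  · exact id_comp_comp_id (f := AugHom.toHom f) (g := AugHom.toHom g) η
  · ext
    exact Category.id_comp (obj := (show C from a) ⟶ (show C from a)) (𝟙 (𝟙 (show C from a)))
  · ext
    exact id_comp_whisker (AugHom.toHom f) (AugHom.toHom g)
  · ext k x
    exact deg_id_comp_comp_deg_id (f := AugHom.toHom f) (g := AugHom.toHom g) x

theorem comp_map₂_comp_inv_comp_hom (G : SPseudofunctor C D) {a b : C} {f g h : a ⟶ b}
    {p r q : G.obj a ⟶ G.obj b} (x : p ⟶ G.map f) (θ : f ⟶ g) (ι : g ⟶ h) (e : r ≅ G.map h)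
    (w : G.map h ⟶ q) : (x ≫ G.map₂ (θ ≫ ι) ≫ e.inv) ≫ e.hom ≫ G.map₂ (𝟙 h) ≫ w =
      (x ≫ G.map₂ θ) ≫ G.map₂ ι ≫ w := by
  simp only [PrelaxFunctor.map₂_comp, PrelaxFunctor.map₂_id, Category.assoc, Category.id_comp,
    Iso.inv_hom_id_assoc]

theorem map₂_whisker_comp_mapComp_comp_whisker (G : SPseudofunctor C D) {a b c : C}
    {f f' : a ⟶ b} {g g' : b ⟶ c} (θ : f' ≅ f) (θ' : g' ≅ g) {p : G.obj a ⟶ G.obj b}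
    {q : G.obj b ⟶ G.obj c} (φ : p ≅ G.map f') (φ' : q ≅ G.map g') :
    G.map₂ (θ.inv ▷ g ≫ f' ◁ θ'.inv) ≫ (G.mapComp f' g').hom ≫ φ.inv ▷ G.map g' ≫ p ◁ φ'.inv =
      (G.mapComp f g).hom ≫ (G.map₂ θ.inv ≫ φ.inv) ▷ G.map g ≫
        p ◁ (G.map₂ θ'.inv ≫ φ'.inv) := by
  simp only [PrelaxFunctor.map₂_comp, Pseudofunctor.map₂_whisker_left,
    Pseudofunctor.map₂_whisker_right, Category.assoc, Iso.inv_hom_id_assoc, comp_whiskerRight,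
    Bicategory.whiskerLeft_comp]
  rw [whisker_exchange_assoc]

theorem augLift_comp_augLift (F : SPseudofunctor B C) (G : SPseudofunctor C D)
    (m : ∀ {a b : B}, (a ⟶ b) → AugHom (F.obj a) (F.obj b))
    (θ : ∀ {a b : B} (f : a ⟶ b), (m f).toHom ≅ F.map f)
    (n : ∀ {a b : C}, AugHom a b → AugHom (G.obj a) (G.obj b))
    (φ : ∀ {a b : C} (f : AugHom a b), (n f).toHom ≅ G.map f.toHom) :
    (augLift F m θ).comp (augLift ((augProj C).comp G) (fun f => n f) (fun f => φ f)) =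
      augLift (F.comp G) (fun f => n (m f)) (fun f => φ (m f) ≪≫ G.map₂Iso (θ f)) := by
  refine SPseudofunctor.ext' (SPseudofunctor.pseudo_ext (prelaxFunctor_ext rfl fun {a b f g} η =>
    heq_of_eq ?_) (fun a => heq_of_eq ?_) (fun f g => heq_of_eq ?_)) (fun f g => heq_of_eq ?_)
  · change (φ (m f)).hom ≫ G.map₂ ((θ f).hom ≫ F.map₂ η ≫ (θ g).inv) ≫ (φ (m g)).inv =
      ((φ (m f)).hom ≫ G.map₂ (θ f).hom) ≫ G.map₂ (F.map₂ η) ≫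
        (G.map₂ (θ g).inv ≫ (φ (m g)).inv)
    simp only [PrelaxFunctor.map₂_comp, Category.assoc]
  · ext
    exact comp_map₂_comp_inv_comp_hom G _ (θ (𝟙 a)).hom (F.mapId a).hom (φ (.new (F.obj a))) _
  · ext
    change ((φ (m (f ≫ g))).hom ≫ G.map₂ ((θ (f ≫ g)).hom ≫ (F.mapComp f g).hom ≫
        (θ f).inv ▷ F.map g ≫ (m f).toHom ◁ (θ g).inv) ≫
          (φ (.old ((m f).toHom ≫ (m g).toHom))).inv) ≫
        (φ (.old ((m f).toHom ≫ (m g).toHom))).hom ≫ (G.map₂ (𝟙 ((m f).toHom ≫ (m g).toHom)) ≫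
        (G.mapComp (m f).toHom (m g).toHom).hom) ≫ (φ (m f)).inv ▷ G.map (m g).toHom ≫
          (n (m f)).toHom ◁ (φ (m g)).inv =
      ((φ (m (f ≫ g))).hom ≫ G.map₂ (θ (f ≫ g)).hom) ≫ (G.map₂ (F.mapComp f g).hom ≫
        (G.mapComp (F.map f) (F.map g)).hom) ≫ (G.map₂ (θ f).inv ≫ (φ (m f)).inv) ▷
          G.map (F.map g) ≫ (n (m f)).toHom ◁ (G.map₂ (θ g).inv ≫ (φ (m g)).inv)
    refine (congrArg (_ ≫ _ ≫ ·) (Category.assoc _ _ _)).trans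
      ((comp_map₂_comp_inv_comp_hom G _ _ _ _ _).trans ?_)
    rw [G.map₂_comp, Category.assoc (G.map₂ (F.mapComp f g).hom),
      Category.assoc (G.map₂ (F.mapComp f g).hom)]
    exact congrArg (_ ≫ _ ≫ ·) (map₂_whisker_comp_mapComp_comp_whisker G (θ f) (θ g) _ _)
  · ext k x
    change comp (deg k (φ (m f)).hom) (comp ((G.mapCell _ _).app k
        (comp (deg k (θ f).hom) (comp ((F.mapCell f g).app k x) (deg k (θ g).inv))))
        (deg k (φ (m g)).inv)) =
      comp (deg k ((φ (m f)).hom ≫ G.map₂ (θ f).hom)) (comp ((G.mapCell _ _).app k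
        ((F.mapCell f g).app k x)) (deg k (G.map₂ (θ g).inv ≫ (φ (m g)).inv)))
    simp only [G.mapCell_comp, deg_comp, SPseudofunctor.mapCell_deg, SimplicialBicategory.assoc]

/-- The action of a pseudofunctor on augmented 1-morphisms: new identities go to new identities. -/
def augMapHom (F : SPseudofunctor C D) : ∀ {a b : C}, AugHom a b → AugHom (F.obj a) (F.obj b)
  | _, _, .old f => .old (F.map f)
  | _, _, .new a => .new (F.obj a)

/-- The comparison of the actions of a pseudofunctor on 1-morphisms and augmented 1-morphisms. -/
def augMapIso (F : SPseudofunctor C D) : ∀ {a b : C} (m : AugHom a b),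
    (augMapHom F m).toHom ≅ F.map m.toHom
  | _, _, .old f => Iso.refl (F.map f)
  | _, _, .new a => (F.mapId a).symm

/-- The normal pseudofunctor between augmentations induced by a pseudofunctor. -/
def augMap (F : SPseudofunctor C D) : SPseudofunctor (Augmentation C) (Augmentation D) :=
  augLift ((augProj C).comp F) (fun m => augMapHom F m) fun m => augMapIso F m

theorem augMap_isNormal (F : SPseudofunctor C D) : (augMap F).IsNormal := by
  have mapId_inv_comp_map₂_id (a : C) :
      (F.mapId a).inv ≫ F.map₂ (𝟙 (𝟙 a)) ≫ (F.mapId a).hom = 𝟙 (𝟙 (F.obj a)) := by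
    rw [F.map₂_id, Category.id_comp, Iso.inv_hom_id]
  refine ⟨fun a => rfl, fun a => ?_⟩
  ext
  exact mapId_inv_comp_map₂_id a

theorem augMap_id : augMap (SPseudofunctor.id C) = SPseudofunctor.id (Augmentation C) := by
  refine Eq.trans (augLift_congr (SPseudofunctor.comp_id _) ?_ ?_) augLift_augProj
  · rintro _ _ (f | a) <;> rfl
  · rintro _ _ (f | a) <;> rfl

theorem augMap_comp (F : SPseudofunctor B C) (G : SPseudofunctor C D) :
    augMap (F.comp G) = (augMap F).comp (augMap G) := by
  refine Eq.trans (augLift_congr (SPseudofunctor.assoc _ _ _).symm ?_ ?_)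
    (augLift_comp_augLift _ G _ _ _ _).symm
  · rintro _ _ (f | a) <;> rfl
  · rintro a b (f | a)
    · refine heq_of_eq (Iso.ext ?_)
      change 𝟙 (G.map (F.map f)) = 𝟙 (G.map (F.map f)) ≫ G.map₂ (𝟙 (F.map f))
      rw [G.map₂_id, Category.id_comp]
    · rfl

/-- Adjoining new identities, as a functor from bicategories and pseudofunctors to bicategories and
normal pseudofunctors. -/
def normalization : Bicat.{u} ⥤ NormalBicat.{u} where
  obj C := ⟨@Bicat.mk (Augmentation C.carrier) augBicategory augSimplicialBicategory⟩
  map {C D} F := ⟨augMap (C := C.carrier) (D := D.carrier) (Bicat.toPseudo F),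
    augMap_isNormal (C := C.carrier) (D := D.carrier) (Bicat.toPseudo F)⟩
  map_id C := by
    ext
    exact augMap_id
  map_comp F G := by
    ext
    exact augMap_comp _ _

theorem nonempty_sTrans_augLift_comp_augProj (F : SPseudofunctor B C)
    (m : ∀ {a b : B}, (a ⟶ b) → AugHom (F.obj a) (F.obj b))
    (θ : ∀ {a b : B} (f : a ⟶ b), (m f).toHom ≅ F.map f) :
    Nonempty (STrans ((augLift F m θ).comp (augProj C)) F) := by
  rw [augLift_comp_augProj]
  exact ⟨ofTransport _ _ _⟩

theorem nonempty_sTrans_comp_augLift (F : SPseudofunctor B C)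
    (m : ∀ {a b : B}, (a ⟶ b) → AugHom (F.obj a) (F.obj b))
    (θ : ∀ {a b : B} (f : a ⟶ b), (m f).toHom ≅ F.map f) :
    Nonempty (STrans F ((augLift F m θ).comp (augProj C))) := by
  rw [augLift_comp_augProj]
  exact ⟨toTransport _ _ _⟩

theorem nonempty_sTrans_comp_augMap {F G : SPseudofunctor C D} (η : STrans F G) :
    Nonempty (STrans ((augProj C).comp F) ((augMap G).comp (augProj D))) := by
  obtain ⟨α⟩ := nonempty_sTrans_comp_augLift ((augProj C).comp G)
    (fun m => augMapHom G m) fun m => augMapIso G m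
  exact ⟨(η.precomp (augProj C)).vcomp α⟩

theorem nonempty_sTrans_augMap {F G : SPseudofunctor C D} (η : STrans F G) :
    Nonempty (STrans (augMap F) (augMap G)) := by
  obtain ⟨α⟩ := nonempty_sTrans_augLift_comp_augProj ((augProj C).comp F)
    (fun m => augMapHom F m) fun m => augMapIso F m
  obtain ⟨β⟩ := nonempty_sTrans_comp_augMap η
  exact ⟨STrans.reflect (α.vcomp β)⟩

end Normalization

section Inclusion

open Bicategory

variable {C : Type u} [Bicategory.{u, u} C]

/-- The property of being an identity 1-morphism; an inductive predicate, since the source and the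
target of a 1-morphism need not be the same term. -/
inductive IsIdentity : ∀ {a b : C}, (a ⟶ b) → Prop
  | id (a : C) : IsIdentity (𝟙 a)

open Classical in
/-- The augmented 1-morphism corresponding to a 1-morphism, which is a new identity in the case of
an identity. -/
noncomputable def AugHom.ofHom {a b : C} (f : a ⟶ b) : Σ m : AugHom a b, m.toHom ≅ f :=
  if h : IsIdentity f then
    match a, b, f, h with
    | _, _, _, .id a => ⟨.new a, Iso.refl (𝟙 a)⟩
  else ⟨.old f, Iso.refl f⟩

theorem AugHom.ofHom_id (a : C) : AugHom.ofHom (𝟙 a) = ⟨.new a, Iso.refl (𝟙 a)⟩ := by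
  rw [ofHom, dif_pos (.id a)]

variable [SimplicialBicategory C]

/-- The inclusion of a bicategory into its augmentation, a normal pseudofunctor. -/
noncomputable def augIncl (C : Type u) [Bicategory.{u, u} C] [SimplicialBicategory C] :
    SPseudofunctor C (Augmentation C) :=
  augLift (SPseudofunctor.id C) (fun f => (AugHom.ofHom f).1) (fun f => (AugHom.ofHom f).2)

theorem augIncl_isNormal : (augIncl C).IsNormal := by
  have ofHom_id_fst (a : C) : (AugHom.ofHom (𝟙 a)).1 = .new a :=
    congrArg Sigma.fst (AugHom.ofHom_id a)
  refine ⟨ofHom_id_fst, fun a => ?_⟩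
  have augIso_eq_eqToIso (p : Σ m : AugHom a a, m.toHom ≅ 𝟙 a)
      (hp : p = ⟨.new a, Iso.refl (𝟙 a)⟩) (hp₁ : p.1 = .new a) :
      augIso (n := .new a) (p.2 ≪≫ Iso.refl (𝟙 a)) = eqToIso hp₁ := by
    subst hp
    ext
    exact Category.comp_id (𝟙 (𝟙 a))
  exact augIso_eq_eqToIso _ (AugHom.ofHom_id a) (ofHom_id_fst a)

theorem nonempty_sTrans_augIncl_comp_augProj :
    Nonempty (STrans ((augIncl C).comp (augProj C)) (SPseudofunctor.id C)) :=
  nonempty_sTrans_augLift_comp_augProj _ _ _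

theorem nonempty_sTrans_augProj_comp_augIncl :
    Nonempty (STrans ((augProj C).comp (augIncl C)) (SPseudofunctor.id (Augmentation C))) := by
  obtain ⟨α⟩ := nonempty_sTrans_augIncl_comp_augProj (C := C)
  have β := α.precomp (augProj C)
  rw [SPseudofunctor.comp_id, ← SPseudofunctor.assoc] at β
  refine ⟨STrans.reflect ?_⟩
  rwa [SPseudofunctor.id_comp]

variable {D : Type u} [Bicategory.{u, u} D] [SimplicialBicategory D]

theorem exists_normalization (F : SPseudofunctor C D) :
    ∃ G : SPseudofunctor C D, G.IsNormal ∧ NatEquivalent G F := by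
  have isEquivalence₁_id (a : D) : IsEquivalence₁ (𝟙 a) := ⟨𝟙 a, ⟨leftUnitor _⟩, ⟨leftUnitor _⟩⟩
  refine ⟨transport F (fun f => (augMapHom F (AugHom.ofHom f).1).toHom)
    (fun f => augMapIso F (AugHom.ofHom f).1 ≪≫ F.map₂Iso (AugHom.ofHom f).2), ?_,
    ofTransport _ _ _, fun a => isEquivalence₁_id _⟩
  have map_id (a : C) : (augMapHom F (AugHom.ofHom (𝟙 a)).1).toHom = 𝟙 (F.obj a) := by
    rw [AugHom.ofHom_id]
    rfl
  refine ⟨map_id, fun a => ?_⟩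
  have mapId_eq_eqToIso (p : Σ m : AugHom a a, m.toHom ≅ 𝟙 a)
      (hp : p = ⟨.new a, Iso.refl (𝟙 a)⟩) (hp₁ : (augMapHom F p.1).toHom = 𝟙 (F.obj a)) :
      (augMapIso F p.1 ≪≫ F.map₂Iso p.2) ≪≫ F.mapId a = eqToIso hp₁ := by
    subst hp
    ext
    change ((F.mapId a).inv ≫ F.map₂ (𝟙 (𝟙 a))) ≫ (F.mapId a).hom = 𝟙 (𝟙 (F.obj a))
    rw [F.map₂_id, Category.comp_id, Iso.inv_hom_id]
  exact mapId_eq_eqToIso _ (AugHom.ofHom_id a) (map_id a)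

end Inclusion

/-! ### Cylinders of transformations -/

section NorTrans

open Bicategory

variable {D : Type u} [Bicategory.{u, u} D] {I : Type} [Preorder I] {c d : I → D}

theorem associator_inv_whiskerRight_associator_hom_whiskerLeft {a a' b b' e : D} {p : a ⟶ a'}
    {f : a' ⟶ b'} {g : a ⟶ b} {q : b ⟶ b'} (σ : p ≫ f ⟶ g ≫ q) {r r' : b' ⟶ e} (ζ : r ⟶ r') :
    (α_ p f r).inv ≫ σ ▷ r ≫ (α_ g q r).hom ≫ g ◁ q ◁ ζ =
      p ◁ f ◁ ζ ≫ (α_ p f r').inv ≫ σ ▷ r' ≫ (α_ g q r').hom := by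
  rw [← associator_naturality_right, ← whisker_exchange_assoc,
    associator_inv_naturality_right_assoc]

/-- The naturality constraints of a transformation between the normal pseudofunctors `Y` and `Z`
whose components are `α`. -/
structure NorTrans (Y : NorHom D c) (Z : NorHom D d) (α : ∀ i, c i ⟶ d i) where
  nat {i j : I} (h : i ≤ j) : Y.map h ≫ α j ≅ α i ≫ Z.map h
  nat_id (i : I) : (nat (le_refl i)).hom ≫ α i ◁ (Z.mapId i).hom =
    (Y.mapId i).hom ▷ α i ≫ (λ_ (α i)).hom ≫ (ρ_ (α i)).inv
  nat_comp {i j l : I} (hij : i ≤ j) (hjl : j ≤ l) :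
    (nat (hij.trans hjl)).hom ≫ α i ◁ (Z.mapComp hij hjl).hom =
      (Y.mapComp hij hjl).hom ▷ α l ≫ (α_ _ _ _).hom ≫ Y.map hij ◁ (nat hjl).hom ≫
        (α_ _ _ _).inv ≫ (nat hij).hom ▷ Z.map hjl ≫ (α_ _ _ _).hom

namespace NorTrans

variable {Y : NorHom D c} {Z : NorHom D d} {α : ∀ i, c i ⟶ d i} (T : NorTrans Y Z α)

theorem nat_inv_comp_mapId (i : I) : (T.nat (le_refl i)).inv ≫ (Y.mapId i).hom ▷ α i =
    α i ◁ (Z.mapId i).hom ≫ (ρ_ (α i)).hom ≫ (λ_ (α i)).inv := by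
  rw [Iso.inv_comp_eq, reassoc_of% T.nat_id i]
  simp

theorem nat_inv_comp_mapComp {i j l : I} (hij : i ≤ j) (hjl : j ≤ l) :
    (T.nat (hij.trans hjl)).inv ≫ (Y.mapComp hij hjl).hom ▷ α l =
      α i ◁ (Z.mapComp hij hjl).hom ≫ (α_ _ _ _).inv ≫ (T.nat hij).inv ▷ Z.map hjl ≫
        (α_ _ _ _).hom ≫ Y.map hij ◁ (T.nat hjl).inv ≫ (α_ _ _ _).inv := by
  rw [Iso.inv_comp_eq, reassoc_of% T.nat_comp hij hjl]
  simp

/-- The composition constraint of the cylinder of `T` at a 1-morphism of the source followed by one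
that crosses the cylinder. -/
def compSource {i j l : I} (hij : i ≤ j) (hjl : j ≤ l) :
    α i ≫ Z.map (hij.trans hjl) ≅ Y.map hij ≫ α j ≫ Z.map hjl :=
  whiskerLeftIso (α i) (Z.mapComp hij hjl) ≪≫ (α_ _ _ _).symm ≪≫
    whiskerRightIso (T.nat hij).symm (Z.map hjl) ≪≫ α_ _ _ _

/-- The composition constraint of the cylinder at a 1-morphism that crosses the cylinder followed by
one of the target. -/
def compTarget (α : ∀ i, c i ⟶ d i) (Z : NorHom D d) {i j l : I} (hij : i ≤ j) (hjl : j ≤ l) :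
    α i ≫ Z.map (hij.trans hjl) ≅ (α i ≫ Z.map hij) ≫ Z.map hjl :=
  whiskerLeftIso (α i) (Z.mapComp hij hjl) ≪≫ (α_ _ _ _).symm

theorem compSource_assoc {i j k l : I} (hij : i ≤ j) (hjk : j ≤ k) (hkl : k ≤ l) :
    (T.compSource (hij.trans hjk) hkl).hom ≫ (Y.mapComp hij hjk).hom ▷ (α k ≫ Z.map hkl) ≫
        (α_ _ _ _).hom =
      (T.compSource hij (hjk.trans hkl)).hom ≫ Y.map hij ◁ (T.compSource hjk hkl).hom := by
  have h₁ := congrArg (fun x => (α_ _ _ _).inv ≫ x ▷ Z.map hkl ≫ (α_ _ _ _).hom)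
    (T.nat_inv_comp_mapComp hij hjk)
  have h₂ := congrArg (fun x => α i ◁ x ≫ α i ◁ (α_ _ _ _).inv) (Z.map_assoc hij hjk hkl)
  simp only [compSource, comp_whiskerRight, whiskerLeft_comp, whisker_assoc, whiskerRight_comp,
    whiskerLeft_hom_inv, pentagon_inv_inv_hom_hom_inv, Category.assoc, Category.comp_id,
    Iso.inv_hom_id_assoc, Iso.hom_inv_id_assoc, Iso.trans_hom, Iso.symm_hom, whiskerLeftIso_hom,
    whiskerRightIso_hom] at h₁ h₂ ⊢
  rw [reassoc_of% h₁, reassoc_of% h₂, reassoc_of%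
    associator_inv_whiskerRight_associator_hom_whiskerLeft (T.nat hij).inv (Z.mapComp hjk hkl).hom]
  simp

theorem compSource_compTarget {i j k l : I} (hij : i ≤ j) (hjk : j ≤ k) (hkl : k ≤ l) :
    (compTarget α Z (hij.trans hjk) hkl).hom ≫ (T.compSource hij hjk).hom ▷ Z.map hkl ≫
        (α_ _ _ _).hom =
      (T.compSource hij (hjk.trans hkl)).hom ≫ Y.map hij ◁ (compTarget α Z hjk hkl).hom := by
  have h := congrArg (fun x => α i ◁ x ≫ α i ◁ (α_ _ _ _).inv) (Z.map_assoc hij hjk hkl)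
  simp only [compSource, compTarget, comp_whiskerRight, whiskerLeft_comp, whisker_assoc,
    whiskerLeft_hom_inv, Category.assoc, Category.comp_id, Iso.inv_hom_id_assoc, Iso.trans_hom,
    Iso.symm_hom, whiskerLeftIso_hom, whiskerRightIso_hom] at h ⊢
  rw [reassoc_of% h, reassoc_of%
    associator_inv_whiskerRight_associator_hom_whiskerLeft (T.nat hij).inv (Z.mapComp hjk hkl).hom]
  simp

theorem compTarget_assoc {i j k l : I} (hij : i ≤ j) (hjk : j ≤ k) (hkl : k ≤ l) :
    (compTarget α Z (hij.trans hjk) hkl).hom ≫ (compTarget α Z hij hjk).hom ▷ Z.map hkl ≫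
        (α_ _ _ _).hom =
      (compTarget α Z hij (hjk.trans hkl)).hom ≫
        (α i ≫ Z.map hij) ◁ (Z.mapComp hjk hkl).hom := by
  have h := congrArg (fun x => α i ◁ x) (Z.map_assoc hij hjk hkl)
  simp only [compTarget, comp_whiskerRight, comp_whiskerLeft, whiskerLeft_comp, whisker_assoc,
    pentagon_inv_inv_hom_hom_inv, Category.assoc, Iso.inv_hom_id_assoc, Iso.trans_hom, Iso.symm_hom,
    whiskerLeftIso_hom] at h ⊢
  rw [reassoc_of% h]

theorem compSource_left_unitor {i j : I} (h : i ≤ j) :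
    (T.compSource (le_refl i) h).hom ≫ (Y.mapId i).hom ▷ (α i ≫ Z.map h) ≫
      (λ_ (α i ≫ Z.map h)).hom = 𝟙 (α i ≫ Z.map h) := by
  have h₁ := congrArg (fun x => (α_ _ _ _).inv ≫ x ▷ Z.map h ≫ (α_ _ _ _).hom)
    (T.nat_inv_comp_mapId i)
  have h₂ := congrArg (fun x => α i ◁ x) (Z.map_left_unitor h)
  simp only [compSource, comp_whiskerRight, whiskerLeft_comp, whisker_assoc, whiskerRight_comp,
    whiskerLeft_id, leftUnitor_inv_whiskerRight, triangle_assoc_comp_right_assoc, Category.assoc,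
    Category.comp_id, Iso.inv_hom_id, Iso.inv_hom_id_assoc, Iso.hom_inv_id_assoc, Iso.trans_hom,
    Iso.symm_hom, whiskerLeftIso_hom, whiskerRightIso_hom] at h₁ h₂ ⊢
  rw [reassoc_of% h₁, Iso.inv_hom_id, Category.comp_id]
  exact h₂

theorem compTarget_right_unitor {i j : I} (h : i ≤ j) :
    (compTarget α Z h (le_refl j)).hom ≫ (α i ≫ Z.map h) ◁ (Z.mapId j).hom ≫
      (ρ_ (α i ≫ Z.map h)).hom = 𝟙 (α i ≫ Z.map h) := by
  simpa [compTarget] using congrArg (fun x => α i ◁ x) (Z.map_right_unitor h)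

end NorTrans

theorem not_true_le_false : ¬ true ≤ false := by decide

/-- The choice of one of two objects. The constructions of this section match on a Boolean alone,
rather than on an element of `Bool × I`, so that restriction along maps of `I` commutes with them
definitionally. -/
def select (x x' : D) : Bool → D
  | false => x
  | true => x'

/-- The choice of one of three 1-morphisms. -/
def selectHom {x x' y y' : D} (f : x ⟶ y) (g : x ⟶ y') (f' : x' ⟶ y') :
    ∀ {b b' : Bool}, b ≤ b' → (select x x' b ⟶ select y y' b')
  | false, false, _ => f
  | false, true, _ => g
  | true, true, _ => f'
  | true, false, h => absurd h not_true_le_false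

/-- The choice of one of two identity constraints. -/
def selectId {x x' : D} {f : x ⟶ x} (g : x ⟶ x') {f' : x' ⟶ x'} (e : f ≅ 𝟙 x) (e' : f' ≅ 𝟙 x') :
    ∀ b : Bool, selectHom f g f' (le_refl b) ≅ 𝟙 (select x x' b)
  | false => e
  | true => e'

/-- The choice of one of four composition constraints. -/
def selectComp {x x' y y' z z' : D} {f₁ : x ⟶ y} {g₁ : x ⟶ y'} {f₁' : x' ⟶ y'} {f₂ : y ⟶ z}
    {g₂ : y ⟶ z'} {f₂' : y' ⟶ z'} {f₃ : x ⟶ z} {g₃ : x ⟶ z'} {f₃' : x' ⟶ z'}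
    (e₁ : f₃ ≅ f₁ ≫ f₂) (e₂ : g₃ ≅ f₁ ≫ g₂) (e₃ : g₃ ≅ g₁ ≫ f₂') (e₄ : f₃' ≅ f₁' ≫ f₂') :
    ∀ {b b' b'' : Bool} (h : b ≤ b') (h' : b' ≤ b''),
      selectHom f₃ g₃ f₃' (h.trans h') ≅ selectHom f₁ g₁ f₁' h ≫ selectHom f₂ g₂ f₂' h'
  | false, false, false, _, _ => e₁
  | false, false, true, _, _ => e₂
  | false, true, true, _, _ => e₃
  | true, true, true, _, _ => e₄
  | true, false, _, h, _ => absurd h not_true_le_false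
  | _, true, false, _, h' => absurd h' not_true_le_false

/-- The choice of one of three simplices of 2-cells. -/
def selectCell [SimplicialBicategory D] {k : SimplexCategoryᵒᵖ} {x x' y y' : D} {f₁ f₂ : x ⟶ y}
    {g₁ g₂ : x ⟶ y'} {f₁' f₂' : x' ⟶ y'} (u : (cell f₁ f₂).obj k) (v : (cell g₁ g₂).obj k)
    (w : (cell f₁' f₂').obj k) : ∀ {b b' : Bool} (h : b ≤ b'),
      (cell (selectHom f₁ g₁ f₁' h) (selectHom f₂ g₂ f₂' h)).obj k
  | false, false, _ => u
  | false, true, _ => v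
  | true, true, _ => w
  | true, false, h => absurd h not_true_le_false

/-- The objects of a cylinder over `{false < true} × I`: `c` at one end and `d` at the other. -/
def cylinderObj (c d : I → D) (p : Bool × I) : D :=
  select (c p.2) (d p.2) p.1

namespace NorTrans

variable {Y : NorHom D c} {Z : NorHom D d} {α : ∀ i, c i ⟶ d i}

/-- The cylinder of a transformation from `Y` to `Z`: a normal pseudofunctor on
`{false < true} × I` that restricts to `Y` and `Z` at the ends. -/
def cylinder (T : NorTrans Y Z α) : NorHom D (cylinderObj c d) where
  map {p _} h := selectHom (Y.map h.2) (α p.2 ≫ Z.map h.2) (Z.map h.2) h.1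
  mapId p := selectId (α p.2 ≫ Z.map (le_refl p.2)) (Y.mapId p.2) (Z.mapId p.2) p.1
  mapComp h h' := selectComp (Y.mapComp h.2 h'.2) (T.compSource h.2 h'.2)
    (compTarget α Z h.2 h'.2) (Z.mapComp h.2 h'.2) h.1 h'.1
  map_assoc {p q r s} h h' h'' := match p, q, r, s, h, h', h'' with
    | (false, _), (false, _), (false, _), (false, _), h, h', h'' => Y.map_assoc h.2 h'.2 h''.2
    | (false, _), (false, _), (false, _), (true, _), h, h', h'' =>
      T.compSource_assoc h.2 h'.2 h''.2
    | (false, _), (false, _), (true, _), (true, _), h, h', h'' =>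
      T.compSource_compTarget h.2 h'.2 h''.2
    | (false, _), (true, _), (true, _), (true, _), h, h', h'' => compTarget_assoc h.2 h'.2 h''.2
    | (true, _), (true, _), (true, _), (true, _), h, h', h'' => Z.map_assoc h.2 h'.2 h''.2
    | (true, _), (false, _), _, _, h, _, _ => absurd h.1 not_true_le_false
    | _, (true, _), (false, _), _, _, h', _ => absurd h'.1 not_true_le_false
    | _, _, (true, _), (false, _), _, _, h'' => absurd h''.1 not_true_le_false
  map_left_unitor {p q} h := match p, q, h with
    | (false, _), (false, _), h => Y.map_left_unitor h.2
    | (false, _), (true, _), h => T.compSource_left_unitor h.2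
    | (true, _), (true, _), h => Z.map_left_unitor h.2
    | (true, _), (false, _), h => absurd h.1 not_true_le_false
  map_right_unitor {p q} h := match p, q, h with
    | (false, _), (false, _), h => Y.map_right_unitor h.2
    | (false, _), (true, _), h => compTarget_right_unitor h.2
    | (true, _), (true, _), h => Z.map_right_unitor h.2
    | (true, _), (false, _), h => absurd h.1 not_true_le_false
  normal :=
    ⟨fun | (false, i) => Y.normal.1 i
         | (true, i) => Z.normal.1 i,
     fun | (false, i) => Y.normal.2 i
         | (true, i) => Z.normal.2 i⟩

variable [SimplicialBicategory D] {k : SimplexCategoryᵒᵖ} {Y' : NorHom D c} {Z' : NorHom D d}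

theorem whiskerLeft_comp_compSource_hom (T : NorTrans Y Z α) (T' : NorTrans Y' Z' α) {i j l : I}
    (hij : i ≤ j) (hjl : j ≤ l) {y : (cell (Y.map hij) (Y'.map hij)).obj k}
    {z : (cell (Z.map hij) (Z'.map hij)).obj k} {z' : (cell (Z.map hjl) (Z'.map hjl)).obj k}
    {z'' : (cell (Z.map (hij.trans hjl)) (Z'.map (hij.trans hjl))).obj k}
    (hy : comp (SimplicialCells.whiskerRight y (α j)) (deg k (T'.nat hij).hom) =
      comp (deg k (T.nat hij).hom) (SimplicialCells.whiskerLeft (α i) z))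
    (hz : comp z'' (deg k (Z'.mapComp hij hjl).hom) = comp (deg k (Z.mapComp hij hjl).hom)
      (comp (SimplicialCells.whiskerRight z (Z.map hjl))
        (SimplicialCells.whiskerLeft (Z'.map hij) z'))) :
    comp (SimplicialCells.whiskerLeft (α i) z'') (deg k (T'.compSource hij hjl).hom) =
      comp (deg k (T.compSource hij hjl).hom)
        (comp (SimplicialCells.whiskerRight y (α j ≫ Z.map hjl))
          (SimplicialCells.whiskerLeft (Y'.map hij) (SimplicialCells.whiskerLeft (α j) z'))) := by
  have hz' := congrArg (SimplicialCells.whiskerLeft (α i)) hz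
  simp only [SimplicialBicategory.whiskerLeft_comp] at hz'
  simp only [compSource, Iso.trans_hom, Iso.symm_hom, whiskerLeftIso_hom, whiskerRightIso_hom,
    deg_comp, deg_whiskerLeft, deg_whiskerRight, SimplicialBicategory.assoc]
  rw [comp_comp_congr hz']
  simp only [SimplicialBicategory.assoc]
  rw [comp_comp_congr (comp_deg_inv_eq_deg_inv_comp
      (SimplicialBicategory.associator_naturality_right (α i) (Z'.map hij) z')),
    comp_comp_congr (SimplicialBicategory.whisker_exchange (deg k (T'.nat hij).inv) z'),
    SimplicialBicategory.associator_naturality_right,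
    comp_comp_congr (comp_deg_inv_eq_deg_inv_comp
      (SimplicialBicategory.associator_naturality_middle (α i) z (Z.map hjl))),
    ← SimplicialBicategory.assoc (SimplicialCells.whiskerRight
      (SimplicialCells.whiskerLeft (α i) z) (Z.map hjl)),
    ← SimplicialBicategory.whiskerRight_comp, comp_deg_inv_eq_deg_inv_comp hy,
    SimplicialBicategory.whiskerRight_comp, SimplicialBicategory.assoc,
    comp_comp_congr (SimplicialBicategory.associator_naturality_left y (α j) (Z.map hjl))]

theorem whiskerLeft_comp_compTarget_hom {i j l : I} (hij : i ≤ j) (hjl : j ≤ l)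
    {z : (cell (Z.map hij) (Z'.map hij)).obj k} {z' : (cell (Z.map hjl) (Z'.map hjl)).obj k}
    {z'' : (cell (Z.map (hij.trans hjl)) (Z'.map (hij.trans hjl))).obj k}
    (hz : comp z'' (deg k (Z'.mapComp hij hjl).hom) = comp (deg k (Z.mapComp hij hjl).hom)
      (comp (SimplicialCells.whiskerRight z (Z.map hjl))
        (SimplicialCells.whiskerLeft (Z'.map hij) z'))) :
    comp (SimplicialCells.whiskerLeft (α i) z'') (deg k (compTarget α Z' hij hjl).hom) =
      comp (deg k (compTarget α Z hij hjl).hom)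
        (comp (SimplicialCells.whiskerRight (SimplicialCells.whiskerLeft (α i) z) (Z.map hjl))
          (SimplicialCells.whiskerLeft (α i ≫ Z'.map hij) z')) := by
  have hz' := congrArg (SimplicialCells.whiskerLeft (α i)) hz
  simp only [SimplicialBicategory.whiskerLeft_comp] at hz'
  simp only [compTarget, Iso.trans_hom, Iso.symm_hom, whiskerLeftIso_hom,
    deg_comp, deg_whiskerLeft, SimplicialBicategory.assoc]
  rw [comp_comp_congr hz']
  simp only [SimplicialBicategory.assoc]
  rw [comp_deg_inv_eq_deg_inv_comp (SimplicialBicategory.associator_naturality_right _ _ z'),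
    comp_comp_congr (comp_deg_inv_eq_deg_inv_comp
      (SimplicialBicategory.associator_naturality_middle (α i) z (Z.map hjl)))]

/-- The cylinder of a pair of icons that commute with two transformations. -/
def cylinderIcon (T : NorTrans Y Z α) (T' : NorTrans Y' Z' α) (y : Icon k Y Y') (z : Icon k Z Z')
    (hyz : ∀ {i j : I} (h : i ≤ j),
      comp (SimplicialCells.whiskerRight (y.app h) (α j)) (deg k (T'.nat h).hom) =
        comp (deg k (T.nat h).hom) (SimplicialCells.whiskerLeft (α i) (z.app h))) :
    Icon k T.cylinder T'.cylinder where
  app {p _} h := selectCell (y.app h.2) (SimplicialCells.whiskerLeft (α p.2) (z.app h.2))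
    (z.app h.2) h.1
  app_id
    | (false, i) => y.app_id i
    | (true, i) => z.app_id i
  app_comp {p q r} h h' := match p, q, r, h, h' with
    | (false, _), (false, _), (false, _), h, h' => y.app_comp h.2 h'.2
    | (false, _), (false, _), (true, _), h, h' =>
      whiskerLeft_comp_compSource_hom T T' h.2 h'.2 (hyz h.2) (z.app_comp h.2 h'.2)
    | (false, _), (true, _), (true, _), h, h' =>
      whiskerLeft_comp_compTarget_hom h.2 h'.2 (z.app_comp h.2 h'.2)
    | (true, _), (true, _), (true, _), h, h' => z.app_comp h.2 h'.2
    | (true, _), (false, _), _, h, _ => absurd h.1 not_true_le_false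
    | _, (true, _), (false, _), _, h' => absurd h'.1 not_true_le_false

end NorTrans

end NorTrans

section CylinderFunctor

variable {C D : Type u} [Bicategory.{u, u} C] [SimplicialBicategory C] [Bicategory.{u, u} D]
  [SimplicialBicategory D] {I J : Type} [Preorder I] [Preorder J] {F G : SPseudofunctor C D}

/-- The restriction of a transformation along a normal pseudofunctor. -/
def STrans.norTrans (η : STrans F G) (hF : F.IsNormal) (hG : G.IsNormal) {c : I → C}
    (X : NorHom C c) :
    NorTrans (X.postcomp F hF) (X.postcomp G hG) (fun i => η.app (c i)) where
  nat h := η.naturality (X.map h)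
  nat_id i := naturality_hom_comp_mapId η (X.mapId i).hom
  nat_comp h h' := naturality_hom_comp_mapComp η (X.mapComp h h').hom

variable (η : STrans F G) (hF : F.IsNormal) (hG : G.IsNormal)

/-- The functor that sends a normal pseudofunctor `X` to the cylinder of `η` restricted
along `X`. -/
def cylinderFunctor (I : Type) [Preorder I] (k : SimplexCategoryᵒᵖ) :
    NorCat I C k ⥤ NorCat (Bool × I) D k :=
  Sigma.desc fun c =>
    { obj := fun X => ⟨cylinderObj (F.obj ∘ c) (G.obj ∘ c), (η.norTrans hF hG X).cylinder⟩
      map := fun {X Y} x => Sigma.SigmaHom.mk (NorTrans.cylinderIcon (η.norTrans hF hG X)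
        (η.norTrans hF hG Y) (Icon.postcomp F hF x) (Icon.postcomp G hG x)
        fun h => η.naturality_cell (x.app h))
      map_id := fun X => congrArg Sigma.SigmaHom.mk (Icon.ext (by
        have mapCell_deg_id (H : SPseudofunctor C D) {a b : C} (f : a ⟶ b) :
            (H.mapCell f f).app k (deg k (𝟙 f)) = deg k (𝟙 (H.map f)) :=
          (H.mapCell_deg k _).trans (congrArg (deg k) (H.map₂_id _))
        funext ⟨b, i⟩ ⟨b', j⟩ h
        match b, b', h with
        | false, false, _ => exact mapCell_deg_id F _
        | false, true, _ =>
          exact (congrArg (SimplicialCells.whiskerLeft (η.app (c i))) (mapCell_deg_id G _)).trans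
            ((deg_whiskerLeft k _ _).symm.trans (congrArg (deg k) (Bicategory.whiskerLeft_id _ _)))
        | true, true, _ => exact mapCell_deg_id G _
        | true, false, h => exact absurd h.1 not_true_le_false))
      map_comp := fun x y => congrArg Sigma.SigmaHom.mk (Icon.ext (by
        funext ⟨b, i⟩ ⟨b', j⟩ h
        match b, b', h with
        | false, false, _ => exact F.mapCell_comp _ _
        | false, true, _ =>
          exact (congrArg (SimplicialCells.whiskerLeft (η.app (c i))) (G.mapCell_comp _ _)).trans
            (SimplicialBicategory.whiskerLeft_comp _ _ _)
        | true, true, _ => exact G.mapCell_comp _ _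
        | true, false, h => exact absurd h.1 not_true_le_false)) }

end CylinderFunctor

/-! ### Transformations induce homotopies of classifying spaces -/

section NerveHomotopy

open MonoidalCategory Simplicial

section CylinderSection

variable {C D : Type u} [Bicategory.{u, u} C] [SimplicialBicategory C] [Bicategory.{u, u} D]
  [SimplicialBicategory D] {I J : Type} [Preorder I] [Preorder J] {F G : SPseudofunctor C D}
  (η : STrans F G) (hF : F.IsNormal) (hG : G.IsNormal)

/-- The product of a monotone map with the identity of `Bool`. -/
def boolProd (t : J →o I) : Bool × J →o Bool × I where
  toFun p := (p.1, t p.2)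
  monotone' _ _ h := ⟨h.1, t.monotone h.2⟩

theorem restrictFunctor_comp_cylinderFunctor (t : J →o I) {k l : SimplexCategoryᵒᵖ} (θ : k ⟶ l) :
    restrictFunctor C t θ ⋙ cylinderFunctor η hF hG J l =
      cylinderFunctor η hF hG I k ⋙ restrictFunctor D (boolProd t) θ := by
  refine norCat_functor_ext (fun _ _ => rfl) fun c X Y x => sigmaHom_hext rfl rfl _ _
    fun {p q} h => heq_of_eq ?_
  obtain ⟨b, i⟩ := p
  obtain ⟨b', j⟩ := q
  match b, b', h with
  | false, false, _ => exact F.mapCell_map _ _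
  | false, true, _ =>
    exact (congrArg (SimplicialCells.whiskerLeft _) (G.mapCell_map _ _)).trans
      (SimplicialBicategory.map_whiskerLeft _ _ _).symm
  | true, true, _ => exact G.mapCell_map _ _
  | true, false, h => exact absurd h.1 not_true_le_false

/-- The restriction of the cylinders of `η` along the graph of a monotone map `χ`: it interpolates
between composition with `F` (where `χ` is `false`) and with `G` (where `χ` is `true`). -/
def cylinderSection (χ : I →o Bool) (k : SimplexCategoryᵒᵖ) : NorCat I C k ⥤ NorCat I D k :=
  cylinderFunctor η hF hG I k ⋙ restrictFunctor D (χ.prod OrderHom.id) (𝟙 k)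

theorem restrictFunctor_comp_cylinderSection (χ : I →o Bool) (t : J →o I) {k l : SimplexCategoryᵒᵖ}
    (θ : k ⟶ l) : restrictFunctor C t θ ⋙ cylinderSection η hF hG (χ.comp t) l =
      cylinderSection η hF hG χ k ⋙ restrictFunctor D t θ := by
  rw [cylinderSection, cylinderSection, ← Functor.assoc, restrictFunctor_comp_cylinderFunctor,
    Functor.assoc, Functor.assoc, ← restrictFunctor_comp, ← restrictFunctor_comp, Category.comp_id,
    Category.id_comp]
  rfl

theorem cylinderSection_const_false (k : SimplexCategoryᵒᵖ) :
    cylinderSection η hF hG (OrderHom.const I false) k = postcompFunctor I F hF k :=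
  norCat_functor_ext (fun _ _ => rfl) fun _ _ _ _ => sigmaHom_hext rfl rfl _ _ fun _ =>
    heq_of_eq (Functor.map_id_apply _ _ _)

theorem cylinderSection_const_true (k : SimplexCategoryᵒᵖ) :
    cylinderSection η hF hG (OrderHom.const I true) k = postcompFunctor I G hG k :=
  norCat_functor_ext (fun _ _ => rfl) fun _ _ _ _ => sigmaHom_hext rfl rfl _ _ fun _ =>
    heq_of_eq (Functor.map_id_apply _ _ _)

end CylinderSection

section NerveHomotopy

/-- The diagonal of the nerve of the Segal nerve; the classifying space is its realization. -/
def nerveDiagonal : NormalBicat.{u} ⥤ SSet.{u} :=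
  segalNerveFunctor ⋙ (Functor.whiskeringRight _ _ _).obj nerveFunctor ⋙ diagonal

variable {B C : NormalBicat.{u}}

/-- The `n`-simplices of `nerveDiagonal.obj C`, unfolded. -/
abbrev NerveSimplex (C : NormalBicat.{u}) (n : SimplexCategoryᵒᵖ) : Type u :=
  Fin (n.unop.len + 1) ⥤ NorCat (Fin (n.unop.len + 1)) C.obj.carrier n

/-- The monotone map `[n] → {false < true}` that corresponds to an `n`-simplex of `Δ[1]`. -/
def boolOfSimplex {n : SimplexCategoryᵒᵖ} (s : (Δ[1] : SSet.{u}).obj n) :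
    Fin (n.unop.len + 1) →o Bool :=
  OrderHom.comp ⟨fun a : Fin 2 => decide (a = 1), by decide⟩
    (SSet.stdSimplex.objEquiv s).toOrderHom

variable {F G : SPseudofunctor B.obj.carrier C.obj.carrier} (η : STrans F G) (hF : F.IsNormal)
  (hG : G.IsNormal)

/-- The simplicial homotopy induced by a transformation. -/
def nerveHomotopy : nerveDiagonal.obj B ⊗ Δ[1] ⟶ nerveDiagonal.obj C where
  app n := TypeCat.ofHom fun x =>
    ((show NerveSimplex B n from x.1) ⋙ cylinderSection η hF hG (boolOfSimplex x.2) n :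
      NerveSimplex C n)
  naturality m n θ := by
    ext ⟨x, s⟩
    exact congrArg (fun K => (SimplexCategory.toCat.map θ.unop).toFunctor ⋙
        ((show NerveSimplex B m from x) ⋙ K))
      (restrictFunctor_comp_cylinderSection η hF hG (boolOfSimplex s) θ.unop.toOrderHom θ)

theorem ι₀_comp_nerveHomotopy : SSet.ι₀ ≫ nerveHomotopy η hF hG =
    nerveDiagonal.map (X := B) (Y := C) ⟨F, hF⟩ := by
  ext n x
  exact congrArg (fun K => (show NerveSimplex B _ from x) ⋙ K)
    (cylinderSection_const_false η hF hG _)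

theorem ι₁_comp_nerveHomotopy : SSet.ι₁ ≫ nerveHomotopy η hF hG =
    nerveDiagonal.map (X := B) (Y := C) ⟨G, hG⟩ := by
  ext n x
  exact congrArg (fun K => (show NerveSimplex B _ from x) ⋙ K)
    (cylinderSection_const_true η hF hG _)

end NerveHomotopy

theorem homotopic_classifyingSpaceMap {B C : Bicat.{u}} {F G : SPseudofunctor B.carrier C.carrier}
    (η : STrans F G) (hF : F.IsNormal) (hG : G.IsNormal) :
    (classifyingSpaceMap F hF).Homotopic (classifyingSpaceMap G hG) := by
  have h := homotopic_of_simplicialHomotopy (nerveHomotopy (B := ⟨B⟩) (C := ⟨C⟩) η hF hG)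
  rwa [ι₀_comp_nerveHomotopy, ι₁_comp_nerveHomotopy] at h

end NerveHomotopy

/-! ### The Segal nerve of a product -/

section FunctorBijective

theorem bijective_comp_of_bijective_obj {𝒯 𝒜 ℬ : Type*} [Category* 𝒯] [Category* 𝒜] [Category* ℬ]
    (R : 𝒜 ⥤ ℬ) [R.Full] [R.Faithful] (hR : Function.Bijective R.obj) :
    Function.Bijective fun x : 𝒯 ⥤ 𝒜 => x ⋙ R := by
  let e := Equiv.ofBijective R.obj hR
  have he : ∀ b, R.obj (e.symm b) = b := e.apply_symm_apply
  have he' : ∀ a, e.symm (R.obj a) = a := e.symm_apply_apply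
  let S : ℬ ⥤ 𝒜 :=
    { obj := fun b => e.symm b
      map := fun {b b'} f => R.preimage (eqToHom (he b) ≫ f ≫ eqToHom (he b').symm)
      map_id := fun b => R.map_injective (by simp)
      map_comp := fun f g => R.map_injective (by simp) }
  have comp_R : S ⋙ R = 𝟭 ℬ := CategoryTheory.Functor.ext he fun b b' f => by simp [S]
  have R_comp : R ⋙ S = 𝟭 𝒜 := CategoryTheory.Functor.ext he' fun a a' f =>
    R.map_injective (by simp [S, eqToHom_map])
  refine Function.bijective_iff_has_inverse.2 ⟨fun y => y ⋙ S, fun x => ?_, fun y => ?_⟩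
  · change (x ⋙ R) ⋙ S = x
    rw [Functor.assoc, R_comp, Functor.comp_id]
  · change (y ⋙ S) ⋙ R = y
    rw [Functor.assoc, comp_R, Functor.comp_id]

theorem bijective_comp_pi {𝒯 𝒜 : Type*} [Category* 𝒯] [Category* 𝒜] {ι : Type*}
    {ℬ : ι → Type*} [∀ i, Category* (ℬ i)] (R : ∀ i, 𝒜 ⥤ ℬ i)
    (h_obj : Function.Bijective fun a i => (R i).obj a)
    (h_map : ∀ a a' : 𝒜, Function.Bijective fun (f : a ⟶ a') i => (R i).map f) :
    Function.Bijective fun (x : 𝒯 ⥤ 𝒜) i => x ⋙ R i := by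
  have : (Functor.pi' R).Full := ⟨fun {a a'} => (h_map a a').2⟩
  have : (Functor.pi' R).Faithful := ⟨fun {a a' _ _} h => (h_map a a').1 h⟩
  obtain ⟨hi, hs⟩ := bijective_comp_of_bijective_obj (𝒯 := 𝒯) (Functor.pi' R) h_obj
  refine ⟨fun x x' h => hi (Functor.pi_ext _ _ fun i => congrFun h i), fun y => ?_⟩
  obtain ⟨x, hx⟩ := hs (Functor.pi' y)
  exact ⟨x, funext fun i => (congrArg (· ⋙ Pi.eval _ i) hx).trans (Functor.pi'_eval y i)⟩

end FunctorBijective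

section Product

variable {ι : Type} {C : ι → Type u} [∀ i, Bicategory.{u, u} (C i)]

theorem pi_isoMk_eqToIso {J : Type} {E : J → Type u} [∀ j, Category.{u} (E j)] {f g : ∀ j, E j}
    (h : f = g) (e : ∀ j, f j ≅ g j) (he : ∀ j, e j = eqToIso (congrFun h j)) :
    Pi.isoMk e = eqToIso h := by
  subst h
  ext j
  exact congrArg Iso.hom (he j)

/-- The projections of a product of bicategories (without enrichment). -/
def piProj₀ (C : ι → Type u) [∀ i, Bicategory.{u, u} (C i)] (i : ι) :
    Pseudofunctor (∀ i, C i) (C i) where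
  obj a := a i
  map f := f i
  map₂ η := η i
  mapId _ := Iso.refl _
  mapComp _ _ := Iso.refl _
  map₂_id _ := rfl
  map₂_comp _ _ := rfl
  map₂_whisker_left f _ _ η := eq_id_comp_comp_id (Bicategory.whiskerLeft (f i) (η i))
  map₂_whisker_right η h := eq_id_comp_comp_id (Bicategory.whiskerRight (η i) (h i))
  map₂_associator f g h := associator_hom_eq_id_comp (f i) (g i) (h i)
  map₂_left_unitor f := leftUnitor_hom_eq_id_comp (f i)
  map₂_right_unitor f := rightUnitor_hom_eq_id_comp (f i)

variable [∀ i, SimplicialBicategory (C i)]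

/-- The projections of a product of bicategories. -/
def piProj (C : ι → Type u) [∀ i, Bicategory.{u, u} (C i)] [∀ i, SimplicialBicategory (C i)]
    (i : ι) : SPseudofunctor (∀ i, C i) (C i) where
  toPseudofunctor := piProj₀ C i
  mapCell _ _ :=
    { app := fun _ => TypeCat.ofHom fun x => x i
      naturality := fun _ _ _ => rfl }
  mapCell_vertex _ := rfl
  mapCell_comp _ _ := rfl
  mapCell_whiskerLeft f _ _ _ x := comp_deg_id_eq_deg_id_comp (whiskerLeft (f i) (x i))
  mapCell_whiskerRight x h := comp_deg_id_eq_deg_id_comp (whiskerRight (x i) (h i))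

theorem piProj_isNormal (i : ι) : (piProj C i).IsNormal :=
  ⟨fun _ => rfl, fun a => by ext; rfl⟩

variable {B : Type u} [Bicategory.{u, u} B] [SimplicialBicategory B]

theorem piLift_comp_piProj (F : ∀ i, SPseudofunctor B (C i)) (i : ι) :
    (piLift F).comp (piProj C i) = F i :=
  SPseudofunctor.ext' (SPseudofunctor.pseudo_ext rfl
    (fun _ => heq_of_eq (Iso.ext (Category.comp_id _)))
    (fun _ _ => heq_of_eq (Iso.ext (Category.comp_id _)))) (fun _ _ => HEq.rfl)

theorem piLift_isNormal {F : ∀ i, SPseudofunctor B (C i)} (hF : ∀ i, (F i).IsNormal) :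
    (piLift F).IsNormal := by
  choose h h' using hF
  exact ⟨fun a => funext fun i => h i a, fun a => pi_isoMk_eqToIso _ _ fun i => h' i a⟩

variable {I : Type} [Preorder I]

/-- The normal pseudofunctor to a product with given components. -/
def NorHom.pi {c : ∀ i, I → C i} (Z : ∀ i, NorHom (C i) (c i)) :
    NorHom (∀ i, C i) (fun j i => c i j) where
  map h := fun i => (Z i).map h
  mapId j := Pi.isoMk fun i => (Z i).mapId j
  mapComp h h' := Pi.isoMk fun i => (Z i).mapComp h h'
  map_assoc h h' h'' := funext fun i => (Z i).map_assoc h h' h''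
  map_left_unitor h := funext fun i => (Z i).map_left_unitor h
  map_right_unitor h := funext fun i => (Z i).map_right_unitor h
  normal := by
    choose h h' using fun i => (Z i).normal
    exact ⟨fun j => funext fun i => h i j, fun j => pi_isoMk_eqToIso _ _ fun i => h' i j⟩

section Postcomp

variable {c : I → ∀ i, C i} (X : NorHom (∀ i, C i) c) (i : ι)

theorem postcomp_piProj_mapId_hom (j : I) :
    ((X.postcomp (piProj C i) (piProj_isNormal i)).mapId j).hom = (X.mapId j).hom i :=
  Category.comp_id ((X.mapId j).hom i)

theorem postcomp_piProj_mapComp_hom {j k l : I} (h : j ≤ k) (h' : k ≤ l) :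
    ((X.postcomp (piProj C i) (piProj_isNormal i)).mapComp h h').hom = (X.mapComp h h').hom i :=
  Category.comp_id ((X.mapComp h h').hom i)

theorem NorHom.pi_postcomp :
    NorHom.pi (fun i => X.postcomp (piProj C i) (piProj_isNormal i)) = X := by
  refine NorHom.ext rfl (heq_of_eq ?_) (heq_of_eq ?_)
  · funext j
    exact Iso.ext (funext fun i => postcomp_piProj_mapId_hom X i j)
  · funext j k l h h'
    exact Iso.ext (funext fun i => postcomp_piProj_mapComp_hom X i h h')

end Postcomp

theorem NorHom.postcomp_pi {c : ∀ i, I → C i} (Z : ∀ i, NorHom (C i) (c i)) (i : ι) :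
    (NorHom.pi Z).postcomp (piProj C i) (piProj_isNormal i) = Z i := by
  refine NorHom.ext rfl (heq_of_eq ?_) (heq_of_eq ?_)
  · funext j
    exact Iso.ext (postcomp_piProj_mapId_hom (NorHom.pi Z) i j)
  · funext j k l h h'
    exact Iso.ext (postcomp_piProj_mapComp_hom (NorHom.pi Z) i h h')

/-- The icon between normal pseudofunctors to a product with given components. -/
def Icon.pi {k : SimplexCategoryᵒᵖ} {c : I → ∀ i, C i} {X Y : NorHom (∀ i, C i) c}
    (x : ∀ i, Icon k (X.postcomp (piProj C i) (piProj_isNormal i))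
      (Y.postcomp (piProj C i) (piProj_isNormal i))) : Icon k X Y where
  app h := fun i => (x i).app h
  app_id j := funext fun i => by
    have h_id := (x i).app_id j
    rw [postcomp_piProj_mapId_hom, postcomp_piProj_mapId_hom] at h_id
    exact h_id
  app_comp h h' := funext fun i => by
    have h_comp := (x i).app_comp h h'
    rw [postcomp_piProj_mapComp_hom, postcomp_piProj_mapComp_hom] at h_comp
    exact h_comp

/-- The `i`-th projection from the normal pseudofunctors to a product. -/
abbrev projFunctor (I : Type) [Preorder I] (C : ι → Type u) [∀ i, Bicategory.{u, u} (C i)]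
    [∀ i, SimplicialBicategory (C i)] (k : SimplexCategoryᵒᵖ) (i : ι) :
    NorCat I (∀ i, C i) k ⥤ NorCat I (C i) k :=
  postcompFunctor I (piProj C i) (piProj_isNormal i) k

theorem bijective_projFunctor_obj (k : SimplexCategoryᵒᵖ) :
    Function.Bijective fun (X : NorCat I (∀ i, C i) k) i => (projFunctor I C k i).obj X :=
  Function.bijective_iff_has_inverse.2
    ⟨fun Z => ⟨fun j i => (Z i).1 j, NorHom.pi fun i => (Z i).2⟩,
      fun X => congrArg (Sigma.mk X.1) (NorHom.pi_postcomp X.2),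
      fun Z => funext fun i =>
        congrArg (Sigma.mk (Z i).1) (NorHom.postcomp_pi (fun i => (Z i).2) i)⟩

theorem fst_eq_of_sigmaHom {J : Type*} {E : J → Type*} [∀ j, Category* (E j)] {X Y : Σ j, E j}
    (f : X ⟶ Y) : X.1 = Y.1 := by
  obtain ⟨_⟩ := f
  rfl

theorem bijective_projFunctor_map (k : SimplexCategoryᵒᵖ) (X Y : NorCat I (∀ i, C i) k) :
    Function.Bijective fun (f : X ⟶ Y) i => (projFunctor I C k i).map f := by
  obtain ⟨c, X⟩ := X
  obtain ⟨d, Y⟩ := Y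
  constructor
  · intro f g h
    obtain rfl := fst_eq_of_sigmaHom f
    obtain ⟨x, rfl⟩ := (Sigma.incl c).map_surjective f
    obtain ⟨y, rfl⟩ := (Sigma.incl c).map_surjective g
    refine congrArg Sigma.SigmaHom.mk (Icon.ext ?_)
    funext j l hjl i
    have h_i := (Sigma.incl _).map_injective (congrFun h i)
    exact congrArg (fun z : Icon k _ _ => z.app hjl) h_i
  · intro f
    obtain rfl : c = d := funext fun j => funext fun i => congrFun (fst_eq_of_sigmaHom (f i)) j
    choose x hx using fun i => (Sigma.incl _).map_surjective (f i)
    exact ⟨Sigma.SigmaHom.mk (C := NorLevel k) (X := X) (Y := Y) (Icon.pi (X := X) (Y := Y) x),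
      funext hx⟩

end Product

/-! ### Classifying spaces and the Segal condition -/

section HomotopyEquiv

open ContinuousMap (HomotopyEquiv)

variable {X X' Y Y' Z : Type u} [TopologicalSpace X] [TopologicalSpace X'] [TopologicalSpace Y]
  [TopologicalSpace Y'] [TopologicalSpace Z]

theorem homotopic_toFun_comp_of_homotopic_comp_invFun (e : HomotopyEquiv X X')
    (e' : HomotopyEquiv Y Y') {f : C(X, Y)} {g : C(X', Y')}
    (h : (f.comp e.invFun).Homotopic (e'.invFun.comp g)) :
    (g.comp e.toFun).Homotopic (e'.toFun.comp f) := by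
  have h_right : (g.comp e.toFun).Homotopic ((e'.toFun.comp (e'.invFun.comp g)).comp e.toFun) :=
    (e'.right_inv.comp (.refl (g.comp e.toFun))).symm
  have h_left : ((e'.toFun.comp (f.comp e.invFun)).comp e.toFun).Homotopic (e'.toFun.comp f) :=
    .comp (.refl (e'.toFun.comp f)) e.left_inv
  exact h_right.trans (.trans (.comp (.comp (.refl _) h.symm) (.refl _)) h_left)

theorem isWeakEquivalence_of_comp_homotopyEquiv (e : HomotopyEquiv X Y) {f : C(Y, Z)}
    (h : IsWeakEquivalence (f.comp e.toFun)) : IsWeakEquivalence f :=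
  IsWeakEquivalence.of_homotopic (.comp (.refl f) e.right_inv)
    (h.comp (isWeakEquivalence_of_homotopyEquiv e.symm))

theorem isWeakEquivalence_of_homotopyEquiv_comp (e : HomotopyEquiv Y Z) {f : C(X, Y)}
    (h : IsWeakEquivalence (e.toFun.comp f)) : IsWeakEquivalence f :=
  IsWeakEquivalence.of_homotopic (.comp e.left_inv (.refl f))
    ((isWeakEquivalence_of_homotopyEquiv e.symm).comp h)

end HomotopyEquiv

section Functoriality

variable {B C D : Bicat.{u}}

theorem classifyingSpaceMap_comp (F : SPseudofunctor B.carrier C.carrier) (hF : F.IsNormal)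
    (G : SPseudofunctor C.carrier D.carrier) (hG : G.IsNormal) :
    classifyingSpaceMap (F.comp G) (hF.comp hG) =
      (classifyingSpaceMap G hG).comp (classifyingSpaceMap F hF) :=
  congrArg TopCat.Hom.hom (classifyingSpace.map_comp (X := ⟨B⟩) (Y := ⟨C⟩) (Z := ⟨D⟩)
    ⟨F, hF⟩ ⟨G, hG⟩)

theorem classifyingSpaceMap_id (B : Bicat.{u}) :
    classifyingSpaceMap (SPseudofunctor.id B.carrier) SPseudofunctor.isNormal_id =
      ContinuousMap.id (classifyingSpaceObj B) :=
  congrArg TopCat.Hom.hom (classifyingSpace.map_id ⟨B⟩)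

theorem homotopic_comp_id (F : SPseudofunctor B.carrier C.carrier) (hF : F.IsNormal)
    (G : SPseudofunctor C.carrier B.carrier) (hG : G.IsNormal)
    (η : STrans (F.comp G) (SPseudofunctor.id B.carrier)) :
    ((classifyingSpaceMap G hG).comp (classifyingSpaceMap F hF)).Homotopic
      (ContinuousMap.id (classifyingSpaceObj B)) := by
  rw [← classifyingSpaceMap_comp, ← classifyingSpaceMap_id]
  exact homotopic_classifyingSpaceMap η _ _

end Functoriality

section HomotopyEquivalence

/-- Pseudofunctors that are invertible up to homotopy of pseudofunctors. This is weaker than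
`IsBiequivalence`: transformations may be composed in zigzags, and their components need not be
equivalences. -/
def IsHomotopyEquivalence {B C : Type u} [Bicategory.{u, u} B] [SimplicialBicategory B]
    [Bicategory.{u, u} C] [SimplicialBicategory C] (F : SPseudofunctor B C) : Prop :=
  ∃ G : SPseudofunctor C B, (SPseudofunctor.id B).Homotopic (F.comp G) ∧
    (SPseudofunctor.id C).Homotopic (G.comp F)

theorem IsBiequivalence.isHomotopyEquivalence {B C : Type u} [Bicategory.{u, u} B]
    [SimplicialBicategory B] [Bicategory.{u, u} C] [SimplicialBicategory C]
    {F : SPseudofunctor B C} (hF : IsBiequivalence F) : IsHomotopyEquivalence F := by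
  obtain ⟨G, ⟨η, -⟩, ⟨θ, -⟩⟩ := hF
  exact ⟨G, η.homotopic, θ.homotopic⟩

/-- The bicategory with new identities adjoined. -/
abbrev augBicat (B : Bicat.{u}) : Bicat.{u} := ⟨Augmentation B.carrier⟩

/-- Adjoining new identities does not change the homotopy type of the classifying space. -/
noncomputable def augHomotopyEquiv (B : Bicat.{u}) :
    ContinuousMap.HomotopyEquiv (classifyingSpaceObj B) (classifyingSpaceObj (augBicat B)) where
  toFun := classifyingSpaceMap (B := B) (C := augBicat B) (augIncl B.carrier) augIncl_isNormal
  invFun := classifyingSpaceMap (B := augBicat B) (C := B) (augProj B.carrier) augProj_isNormal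
  left_inv := homotopic_comp_id (B := B) (C := augBicat B) _ _ _ _
    nonempty_sTrans_augIncl_comp_augProj.some
  right_inv := homotopic_comp_id (B := augBicat B) (C := B) _ _ _ _
    nonempty_sTrans_augProj_comp_augIncl.some

variable {B C D : Bicat.{u}}

/-- The map of classifying spaces induced by a pseudofunctor, not necessarily normal, on the
bicategories with new identities adjoined. -/
noncomputable def augClassifyingSpaceMap (F : SPseudofunctor B.carrier C.carrier) :
    C(classifyingSpaceObj (augBicat B), classifyingSpaceObj (augBicat C)) :=
  ((normalization ⋙ classifyingSpace).map (X := B) (Y := C) F).hom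

theorem augClassifyingSpaceMap_id (B : Bicat.{u}) :
    augClassifyingSpaceMap (SPseudofunctor.id B.carrier) =
      ContinuousMap.id (classifyingSpaceObj (augBicat B)) :=
  congrArg TopCat.Hom.hom ((normalization ⋙ classifyingSpace).map_id B)

theorem augClassifyingSpaceMap_comp (F : SPseudofunctor B.carrier C.carrier)
    (G : SPseudofunctor C.carrier D.carrier) :
    augClassifyingSpaceMap (F.comp G) =
      (augClassifyingSpaceMap G).comp (augClassifyingSpaceMap F) :=
  congrArg TopCat.Hom.hom
    ((normalization ⋙ classifyingSpace).map_comp (X := B) (Y := C) (Z := D) F G)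

theorem homotopic_augClassifyingSpaceMap {F G : SPseudofunctor B.carrier C.carrier}
    (h : F.Homotopic G) : (augClassifyingSpaceMap F).Homotopic (augClassifyingSpaceMap G) :=
  h.induction (ContinuousMap.Homotopic.equivalence.comap augClassifyingSpaceMap) fun η =>
    homotopic_classifyingSpaceMap (B := augBicat B) (C := augBicat C)
      (nonempty_sTrans_augMap η).some (augMap_isNormal _) (augMap_isNormal _)

theorem homotopic_augClassifyingSpaceMap_comp {F G : SPseudofunctor B.carrier C.carrier}
    (hF : F.IsNormal) (h : F.Homotopic G) :
    ((augClassifyingSpaceMap G).comp (augHomotopyEquiv B).toFun).Homotopic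
      ((augHomotopyEquiv C).toFun.comp (classifyingSpaceMap F hF)) := by
  have proj_natural : ((classifyingSpaceMap F hF).comp (augHomotopyEquiv B).invFun).Homotopic
      ((augHomotopyEquiv C).invFun.comp (augClassifyingSpaceMap F)) := by
    have h_comp := classifyingSpaceMap_comp (B := augBicat B) _ augProj_isNormal F hF
    have h_comp' := classifyingSpaceMap_comp (B := augBicat B) (C := augBicat C) (D := C) _
      (augMap_isNormal F) _ augProj_isNormal
    exact h_comp ▸ h_comp' ▸ homotopic_classifyingSpaceMap (B := augBicat B)
      (nonempty_sTrans_comp_augMap (STrans.id F)).some _ _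
  exact .trans (.comp (homotopic_augClassifyingSpaceMap h).symm (.refl _))
    (homotopic_toFun_comp_of_homotopic_comp_invFun _ _ proj_natural)

theorem isWeakEquivalence_augClassifyingSpaceMap {F : SPseudofunctor B.carrier C.carrier}
    (hF : IsHomotopyEquivalence F) : IsWeakEquivalence (augClassifyingSpaceMap F) := by
  obtain ⟨G, hFG, hGF⟩ := hF
  replace hFG := homotopic_augClassifyingSpaceMap hFG.symm
  replace hGF := homotopic_augClassifyingSpaceMap hGF.symm
  rw [augClassifyingSpaceMap_id, augClassifyingSpaceMap_comp] at hFG hGF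
  exact isWeakEquivalence_of_homotopy_inverse hFG hGF

theorem isWeakEquivalence_classifyingSpaceMap {F G : SPseudofunctor B.carrier C.carrier}
    (hF : F.IsNormal) (h : F.Homotopic G) (hG : IsHomotopyEquivalence G) :
    IsWeakEquivalence (classifyingSpaceMap F hF) :=
  isWeakEquivalence_of_homotopyEquiv_comp (augHomotopyEquiv C) <|
    IsWeakEquivalence.of_homotopic (homotopic_augClassifyingSpaceMap_comp hF h) <|
      (isWeakEquivalence_augClassifyingSpaceMap hG).comp
        (isWeakEquivalence_of_homotopyEquiv (augHomotopyEquiv B))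

end HomotopyEquivalence

section Segal

/-- The power of a bicategory. -/
abbrev powBicat (B : Bicat.{u}) (n : ℕ) : Bicat.{u} := ⟨Fin n → B.carrier⟩

theorem isLevelwiseProduct_nerveDiagonal (B : Bicat.{u}) (n : ℕ) :
    IsLevelwiseProduct fun i : Fin n => nerveDiagonal.map (X := ⟨powBicat B n⟩) (Y := ⟨B⟩)
      ⟨piProj (fun _ : Fin n => B.carrier) i, piProj_isNormal i⟩ :=
  fun m => bijective_comp_pi (𝒯 := Fin (m.len + 1))
    (projFunctor (Fin (m.len + 1)) (fun _ : Fin n => B.carrier) (op m))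
    (bijective_projFunctor_obj (op m)) (bijective_projFunctor_map (op m))

theorem isWeakEquivalence_pi_classifyingSpaceMap {B C : Bicat.{u}} {n : ℕ}
    {F : Fin n → SPseudofunctor B.carrier C.carrier} (hF : ∀ i, (F i).IsNormal)
    {G : SPseudofunctor B.carrier (powBicat C n).carrier} (h : (piLift F).Homotopic G)
    (hG : IsHomotopyEquivalence G) :
    IsWeakEquivalence (ContinuousMap.pi fun i => classifyingSpaceMap (F i) (hF i)) := by
  have h_lift : IsWeakEquivalence (classifyingSpaceMap (C := powBicat C n) (piLift F)
      (piLift_isNormal hF)) :=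
    isWeakEquivalence_classifyingSpaceMap (C := powBicat C n) _ h hG
  have h_factor (i : Fin n) : classifyingSpaceMap (F i) (hF i) =
      (classifyingSpaceMap (B := powBicat C n) (piProj (fun _ : Fin n => C.carrier) i)
        (piProj_isNormal i)).comp
          (classifyingSpaceMap (C := powBicat C n) (piLift F) (piLift_isNormal hF)) := by
    rw [← classifyingSpaceMap_comp]
    congr 1
    exact (piLift_comp_piProj F i).symm
  simp only [h_factor]
  exact (isWeakEquivalence_realizationPi (isLevelwiseProduct_nerveDiagonal C n)).comp h_lift

/-- Γ-bicategories satisfying the Segal condition up to homotopy of pseudofunctors. -/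
def IsHomotopySpecial (A : FinStar ⥤ Bicat.{u}) : Prop :=
  ∀ n : ℕ, IsHomotopyEquivalence (segalPseudofunctor A n)

theorem IsSpecialΓBicategory.isHomotopySpecial {A : FinStar ⥤ Bicat.{u}}
    (hA : IsSpecialΓBicategory A) : IsHomotopySpecial A :=
  fun n => (hA n).isHomotopyEquivalence

theorem isSpecialΓSpace_comp_classifyingSpace {A : FinStar ⥤ NormalBicat.{u}}
    (hA : IsHomotopySpecial (A ⋙ wideSubcategoryInclusion normal.{u})) :
    IsSpecialΓSpace (A ⋙ classifyingSpace.{u}) := fun n =>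
  isWeakEquivalence_pi_classifyingSpaceMap (B := (A.obj ⟨n⟩).obj) (C := (A.obj ⟨1⟩).obj)
    (fun k => (A.map (proj n k)).property) (.refl _) (hA n)

theorem exists_isClassifyingΓSpace (A : FinStar ⥤ Bicat.{u}) :
    ∃ X : FinStar ⥤ TopCat.{u}, IsClassifyingΓSpace A X :=
  ⟨A ⋙ normalization ⋙ classifyingSpace, fun s => augHomotopyEquiv (A.obj s), fun _ _ _ =>
    ⟨exists_normalization _, fun _ hF ⟨η, _⟩ =>
      homotopic_augClassifyingSpaceMap_comp hF η.homotopic⟩⟩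

theorem IsClassifyingΓSpace.isSpecialΓSpace {A : FinStar ⥤ Bicat.{u}} {X : FinStar ⥤ TopCat.{u}}
    (hX : IsClassifyingΓSpace A X) (hA : IsHomotopySpecial A) : IsSpecialΓSpace X := by
  obtain ⟨e, he⟩ := hX
  intro n
  choose F hF hFA using fun k => (he (proj n k)).1
  have h_pi := isWeakEquivalence_pi_classifyingSpaceMap hF
    (STrans.pi fun k => (hFA k).choose).homotopic (hA n)
  have h_segal : ((ContinuousMap.HomotopyEquiv.piCongrRight fun _ : Fin n => e ⟨1⟩).toFun.comp
      (ContinuousMap.pi fun k => classifyingSpaceMap (F k) (hF k))).Homotopic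
        ((segalMap X n).comp (e ⟨n⟩).toFun) :=
    ContinuousMap.Homotopic.pi fun k => ((he (proj n k)).2 (F k) (hF k) (hFA k)).symm
  exact isWeakEquivalence_of_comp_homotopyEquiv (e ⟨n⟩)
    (.of_homotopic h_segal ((isWeakEquivalence_of_homotopyEquiv _).comp h_pi))

end Segal

end SegalGamma

open SegalGamma

theorem lemma3p5_general :
    (∀ A : FinStar ⥤ NormalBicat.{u},
      IsHomotopySpecial (A ⋙ wideSubcategoryInclusion normal.{u}) →
        IsSpecialΓSpace (A ⋙ classifyingSpace.{u})) ∧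
    (∀ A : FinStar ⥤ Bicat.{u},
      (∃ X : FinStar ⥤ TopCat.{u}, IsClassifyingΓSpace A X) ∧
      (IsHomotopySpecial A →
        ∀ X : FinStar ⥤ TopCat.{u}, IsClassifyingΓSpace A X → IsSpecialΓSpace X)) :=
  ⟨fun _ hA => isSpecialΓSpace_comp_classifyingSpace hA, fun A =>
    ⟨exists_isClassifyingΓSpace A, fun hA _ hX => hX.isSpecialΓSpace hA⟩⟩

theorem lemma3p5 :
    (∀ A : SegalGamma.FinStar ⥤ SegalGamma.NormalBicat.{u},
      SegalGamma.IsSpecialΓBicategory (A ⋙ wideSubcategoryInclusion SegalGamma.normal.{u}) →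
        SegalGamma.IsSpecialΓSpace (A ⋙ SegalGamma.classifyingSpace.{u})) ∧
    (∀ A : SegalGamma.FinStar ⥤ SegalGamma.Bicat.{u},
      SegalGamma.IsSpecialΓBicategory A →
        (∃ X : SegalGamma.FinStar ⥤ TopCat.{u}, SegalGamma.IsClassifyingΓSpace A X) ∧
        ∀ X : SegalGamma.FinStar ⥤ TopCat.{u},
          SegalGamma.IsClassifyingΓSpace A X → SegalGamma.IsSpecialΓSpace X) :=
  ⟨fun A hA => lemma3p5_general.1 A hA.isHomotopySpecial, fun A hA =>
    ⟨(lemma3p5_general.2 A).1, (lemma3p5_general.2 A).2 hA.isHomotopySpecial⟩⟩
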